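/- Let $d\in\mathbb N_0$ and $s>1$. **Spaces.** For $h>0$ and smooth $f:\mathbb R^d\to\mathbb C$ put $$\|f\|_{s,h}=\sup_{\alpha,\beta\in\mathbb N_0^d}\ \sup_{x\in\mathbb R^d}\frac{|x^\alpha\partial^\beta f(x)|}{h^{|\alpha+\beta|}(\alpha!\,\beta!)^s}.$$ The Gelfand–Shilov space $\mathcal S_s(\mathbb R^d)$ (resp. $\Sigma_s(\mathbb R^d)$) consists of all $f\in C^\infty(\mathbb R^d)$ with $\|f\|_{s,h}<\infty$ for some $h>0$ (resp. for every $h>0$), with the locally convex inductive (resp. projective) limit topology. $\mathcal S_s'(\mathbb R^d)$ and $\Sigma_s'(\mathbb R^d)$ are the spaces of continuous linear functionals on them, with the strong dual topology. A test function $g$ is identified with the functional $\varphi\mapsto\int_{\mathbb R^d} g\,\varphi\,dx$. For a functional $f$ and a real-valued test function $\psi$ write $\langle f,\psi\rangle=f(\psi)$. **Wilson bases.** A Wilson basis of exponential decay of $L^2(\mathbb R)$ is an orthonormal basis $\{\psi_{l,n}\}_{l\in\mathbb N_0,n\in\mathbb Z}$ of the form $\psi_{0,n}(x)=\psi(x-n)$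 and, for $l\ne0$, $$\psi_{l,n}(x)=\sqrt2\cos(2\pi l x)\,\psi(x-\tfrac n2)\ \ (l+n\text{ even}),\qquad \psi_{l,n}(x)=\sqrt2\sin(2\pi l x)\,\psi(x-\tfrac n2)\ \ (l+n\text{ odd}),$$ where $\psi:\mathbb R\to\mathbb R$ is continuous and $|\psi(x)|\le Ce^{-a|x|}$, $|\hat\psi(\xi)|\le Ce^{-b|\xi|}$ for some $a,b,C>0$, with $\hat\psi(\xi)=\int_{\mathbb R} e^{-2\pi i x\xi}\psi(x)\,dx$. On $\mathbb R^d$ one takes tensor products of $d$ such bases (the generators may differ): $\psi_{l,n}(x)=\prod_{k=1}^d\psi^{(k)}_{l_k,n_k}(x_k)$ for $l\in\mathbb N_0^d$, $n\in\mathbb Z^d$. Below, $|l|$ and $|n/2|$ are Euclidean norms, and sums over $(l,n)\in\mathbb N_0^d\times\mathbb Z^d$ converge unconditionally. **Theorem 3.3.** Let $s>1$ and let $\{\psi_{l,n}\}$ be such a Wilson basis of exponential decay on $\mathbb R^d$. Then every $\psi_{l,n}$ belongs to $\mathcal S_s(\mathbb R^d)$ (resp. $\Sigma_s(\mathbb R^d)$),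 and: a) Every $f\in\mathcal S_s'(\mathbb R^d)$ (resp. $f\in\Sigma_s'(\mathbb R^d)$) has the expansion $$f=\sum_{l,n}\langle f,\psi_{l,n}\rangle\,\psi_{l,n}$$ in $\mathcal S_s'(\mathbb R^d)$ (resp. in $\Sigma_s'(\mathbb R^d)$). The expansion is unique: if $f=\sum_{l,n}c_{l,n}\psi_{l,n}$, even only in the weak-$*$ sense, then $c_{l,n}=\langle f,\psi_{l,n}\rangle$ for all $l,n$. Moreover, with $c_{l,n}=\langle f,\psi_{l,n}\rangle$, $$\sum_{l,n}|c_{l,n}|^2e^{-2h(|n/2|+|l|)^{1/s}}<\infty\qquad(*)$$ for every $h>0$ (resp. for some $h\ge0$). b) Conversely, if a complex sequence $(c_{l,n})$ satisfies $(*)$ for every $h>0$ (resp. for some $h\ge0$), then there is $f\in\mathcal S_s'(\mathbb R^d)$ (resp. $f\in\Sigma_s'(\mathbb R^d)$) such that $f=\sum_{l,n}c_{l,n}\psi_{l,n}$ in $\mathcal S_s'(\mathbb R^d)$ (resp. in $\Sigma_s'(\mathbb R^d)$). -/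

import Mathlib

open MeasureTheory
open scoped ContDiff FourierTransform

noncomputable section

/-! ## Partial derivatives and Gelfand-Shilov spaces -/

/-- The partial derivative `∂ᵢ f`. -/
def partialDeriv {d : ℕ} (i : Fin d) (f : EuclideanSpace ℝ (Fin d) → ℂ) :
    EuclideanSpace ℝ (Fin d) → ℂ :=
  fun x => fderiv ℝ f x (EuclideanSpace.single i 1)

/-- The mixed partial derivative `∂^β f = ∂₁^{β₁} ⋯ ∂_d^{β_d} f`. -/
def multiDeriv {d : ℕ} (β : Fin d → ℕ) (f : EuclideanSpace ℝ (Fin d) → ℂ) :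
    EuclideanSpace ℝ (Fin d) → ℂ :=
  (List.finRange d).foldr (fun i g => (partialDeriv i)^[β i] g) f

/-- The quotient `|x^α ∂^β f(x)| / (h^{|α+β|} (α! β!)^s)`. -/
def gsQuotient {d : ℕ} (s h : ℝ) (f : EuclideanSpace ℝ (Fin d) → ℂ)
    (p : (Fin d → ℕ) × (Fin d → ℕ) × EuclideanSpace ℝ (Fin d)) : ℝ :=
  ‖((∏ i, p.2.2 i ^ p.1 i : ℝ) : ℂ) * multiDeriv p.2.1 f p.2.2‖ /
    (h ^ (∑ i, (p.1 i + p.2.1 i)) *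
      (((∏ i, (p.1 i).factorial) * (∏ i, (p.2.1 i).factorial) : ℕ) : ℝ) ^ s)

/-- The seminorm `‖f‖_{s,h} = sup_{α,β,x} |x^α ∂^β f(x)| / (h^{|α+β|} (α! β!)^s)`;
it is only used for `f` with `GSFinite s h f`, where the supremum is finite. -/
def gsNorm {d : ℕ} (s h : ℝ) (f : EuclideanSpace ℝ (Fin d) → ℂ) : ℝ :=
  ⨆ p, gsQuotient s h f p

/-- `f` is smooth and `‖f‖_{s,h} < ∞`. -/
def GSFinite {d : ℕ} (s h : ℝ) (f : EuclideanSpace ℝ (Fin d) → ℂ) : Prop :=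
  ContDiff ℝ ∞ f ∧ BddAbove (Set.range (gsQuotient s h f))

section helpers

variable {d : ℕ}

theorem contDiff_partialDeriv (i : Fin d) {f : EuclideanSpace ℝ (Fin d) → ℂ}
    (hf : ContDiff ℝ ∞ f) : ContDiff ℝ ∞ (partialDeriv i f) :=
  (hf.fderiv_right (m := ∞) (by simp)).clm_apply contDiff_const

theorem partialDeriv_add (i : Fin d) {f g : EuclideanSpace ℝ (Fin d) → ℂ}
    (hf : ContDiff ℝ ∞ f) (hg : ContDiff ℝ ∞ g) :
    partialDeriv i (f + g) = partialDeriv i f + partialDeriv i g := by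
  funext x
  simp only [partialDeriv, Pi.add_apply]
  rw [fderiv_add (hf.differentiable (by simp) x) (hg.differentiable (by simp) x)]
  simp

theorem partialDeriv_smul (i : Fin d) (c : ℂ) {f : EuclideanSpace ℝ (Fin d) → ℂ}
    (hf : ContDiff ℝ ∞ f) : partialDeriv i (c • f) = c • partialDeriv i f := by
  funext x
  simp only [partialDeriv, Pi.smul_apply]
  rw [fderiv_const_smul (hf.differentiable (by simp) x)]
  simp

theorem partialDeriv_iterate (i : Fin d) (k : ℕ) :
    (∀ f : EuclideanSpace ℝ (Fin d) → ℂ, ContDiff ℝ ∞ f →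
      ContDiff ℝ ∞ ((partialDeriv i)^[k] f)) ∧
    (∀ f g : EuclideanSpace ℝ (Fin d) → ℂ, ContDiff ℝ ∞ f → ContDiff ℝ ∞ g →
      (partialDeriv i)^[k] (f + g) = (partialDeriv i)^[k] f + (partialDeriv i)^[k] g) ∧
    (∀ (c : ℂ) (f : EuclideanSpace ℝ (Fin d) → ℂ), ContDiff ℝ ∞ f →
      (partialDeriv i)^[k] (c • f) = c • (partialDeriv i)^[k] f) := by
  induction k with
  | zero => simp
  | succ k ih =>
    obtain ⟨h1, h2, h3⟩ := ih
    refine ⟨fun f hf => ?_, fun f g hf hg => ?_, fun c f hf => ?_⟩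
    · rw [Function.iterate_succ_apply']
      exact contDiff_partialDeriv i (h1 f hf)
    · rw [Function.iterate_succ_apply', h2 f g hf hg, partialDeriv_add i (h1 f hf) (h1 g hg),
        Function.iterate_succ_apply', Function.iterate_succ_apply']
    · rw [Function.iterate_succ_apply', h3 c f hf, partialDeriv_smul i c (h1 f hf),
        Function.iterate_succ_apply']

theorem foldr_partialDeriv (β : Fin d → ℕ) (L : List (Fin d)) :
    (∀ f : EuclideanSpace ℝ (Fin d) → ℂ, ContDiff ℝ ∞ f →
      ContDiff ℝ ∞ (L.foldr (fun i g => (partialDeriv i)^[β i] g) f)) ∧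
    (∀ f g : EuclideanSpace ℝ (Fin d) → ℂ, ContDiff ℝ ∞ f → ContDiff ℝ ∞ g →
      L.foldr (fun i g => (partialDeriv i)^[β i] g) (f + g) =
        L.foldr (fun i g => (partialDeriv i)^[β i] g) f +
          L.foldr (fun i g => (partialDeriv i)^[β i] g) g) ∧
    (∀ (c : ℂ) (f : EuclideanSpace ℝ (Fin d) → ℂ), ContDiff ℝ ∞ f →
      L.foldr (fun i g => (partialDeriv i)^[β i] g) (c • f) =
        c • L.foldr (fun i g => (partialDeriv i)^[β i] g) f) := by
  induction L with
  | nil => simp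
  | cons i L ih =>
    obtain ⟨h1, h2, h3⟩ := ih
    obtain ⟨k1, k2, k3⟩ := partialDeriv_iterate i (β i)
    refine ⟨fun f hf => k1 _ (h1 f hf), fun f g hf hg => ?_, fun c f hf => ?_⟩
    · rw [List.foldr_cons, h2 f g hf hg, k2 _ _ (h1 f hf) (h1 g hg), List.foldr_cons,
        List.foldr_cons]
    · rw [List.foldr_cons, h3 c f hf, k3 _ _ (h1 f hf), List.foldr_cons]

theorem multiDeriv_add (β : Fin d → ℕ) {f g : EuclideanSpace ℝ (Fin d) → ℂ}
    (hf : ContDiff ℝ ∞ f) (hg : ContDiff ℝ ∞ g) :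
    multiDeriv β (f + g) = multiDeriv β f + multiDeriv β g :=
  (foldr_partialDeriv β _).2.1 f g hf hg

theorem multiDeriv_smul (β : Fin d → ℕ) (c : ℂ) {f : EuclideanSpace ℝ (Fin d) → ℂ}
    (hf : ContDiff ℝ ∞ f) : multiDeriv β (c • f) = c • multiDeriv β f :=
  (foldr_partialDeriv β _).2.2 c f hf

theorem multiDeriv_zero_index (f : EuclideanSpace ℝ (Fin d) → ℂ) :
    multiDeriv (0 : Fin d → ℕ) f = f := by
  unfold multiDeriv
  induction List.finRange d with
  | nil => rfl
  | cons i L ih => rw [List.foldr_cons, ih]; rfl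

theorem gsQuotient_denom_pos (s : ℝ) {h : ℝ} (hh : 0 < h) (α β : Fin d → ℕ) :
    0 < h ^ (∑ i, (α i + β i)) *
      (((∏ i, (α i).factorial) * (∏ i, (β i).factorial) : ℕ) : ℝ) ^ s := by
  refine mul_pos (pow_pos hh _) (Real.rpow_pos_of_pos ?_ _)
  exact_mod_cast Nat.mul_pos (Finset.prod_pos fun i _ => Nat.factorial_pos _)
    (Finset.prod_pos fun i _ => Nat.factorial_pos _)

theorem gsQuotient_nonneg (s : ℝ) {h : ℝ} (hh : 0 < h) (f : EuclideanSpace ℝ (Fin d) → ℂ)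
    (p : (Fin d → ℕ) × (Fin d → ℕ) × EuclideanSpace ℝ (Fin d)) : 0 ≤ gsQuotient s h f p :=
  div_nonneg (norm_nonneg _) (gsQuotient_denom_pos s hh _ _).le

theorem gsNorm_nonneg (s : ℝ) {h : ℝ} (hh : 0 < h) (f : EuclideanSpace ℝ (Fin d) → ℂ) :
    0 ≤ gsNorm s h f :=
  Real.iSup_nonneg (gsQuotient_nonneg s hh f)

theorem gsQuotient_add_le (s : ℝ) {h : ℝ} (hh : 0 < h) {f g : EuclideanSpace ℝ (Fin d) → ℂ}
    (hf : ContDiff ℝ ∞ f) (hg : ContDiff ℝ ∞ g)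
    (p : (Fin d → ℕ) × (Fin d → ℕ) × EuclideanSpace ℝ (Fin d)) :
    gsQuotient s h (f + g) p ≤ gsQuotient s h f p + gsQuotient s h g p := by
  unfold gsQuotient
  rw [← add_div, multiDeriv_add _ hf hg, Pi.add_apply, mul_add]
  exact div_le_div_of_nonneg_right (norm_add_le _ _) (gsQuotient_denom_pos s hh _ _).le

theorem gsQuotient_smul (s h : ℝ) (c : ℂ) {f : EuclideanSpace ℝ (Fin d) → ℂ}
    (hf : ContDiff ℝ ∞ f) (p : (Fin d → ℕ) × (Fin d → ℕ) × EuclideanSpace ℝ (Fin d)) :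
    gsQuotient s h (c • f) p = ‖c‖ * gsQuotient s h f p := by
  unfold gsQuotient
  rw [multiDeriv_smul _ c hf, Pi.smul_apply, smul_eq_mul, mul_left_comm, norm_mul, mul_div_assoc]

theorem GSFinite.add {s h : ℝ} (hh : 0 < h) {f g : EuclideanSpace ℝ (Fin d) → ℂ}
    (hf : GSFinite s h f) (hg : GSFinite s h g) : GSFinite s h (f + g) := by
  obtain ⟨A, hA⟩ := hf.2
  obtain ⟨B, hB⟩ := hg.2
  refine ⟨hf.1.add hg.1, A + B, ?_⟩
  rintro _ ⟨p, rfl⟩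
  exact (gsQuotient_add_le s hh hf.1 hg.1 p).trans
    (add_le_add (hA ⟨p, rfl⟩) (hB ⟨p, rfl⟩))

theorem GSFinite.smul {s h : ℝ} (c : ℂ) {f : EuclideanSpace ℝ (Fin d) → ℂ}
    (hf : GSFinite s h f) : GSFinite s h (c • f) := by
  obtain ⟨A, hA⟩ := hf.2
  refine ⟨hf.1.const_smul c, ‖c‖ * A, ?_⟩
  rintro _ ⟨p, rfl⟩
  rw [gsQuotient_smul s h c hf.1]
  exact mul_le_mul_of_nonneg_left (hA ⟨p, rfl⟩) (norm_nonneg _)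

theorem GSFinite.zero (s h : ℝ) : GSFinite s h (0 : EuclideanSpace ℝ (Fin d) → ℂ) := by
  refine ⟨contDiff_const, 0, ?_⟩
  rintro _ ⟨p, rfl⟩
  have := gsQuotient_smul s h (0 : ℂ)
    (f := (0 : EuclideanSpace ℝ (Fin d) → ℂ)) contDiff_const p
  simp only [zero_smul, norm_zero, zero_mul] at this
  exact this.le

theorem GSFinite.mono {s h k : ℝ} (hh : 0 < h) (hk : h ≤ k)
    {f : EuclideanSpace ℝ (Fin d) → ℂ} (hf : GSFinite s h f) : GSFinite s k f := by
  obtain ⟨A, hA⟩ := hf.2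
  refine ⟨hf.1, A, ?_⟩
  rintro _ ⟨p, rfl⟩
  refine le_trans ?_ (hA ⟨p, rfl⟩)
  unfold gsQuotient
  refine div_le_div_of_nonneg_left (norm_nonneg _) (gsQuotient_denom_pos s hh _ _) ?_
  gcongr

theorem gsNorm_add_le {s h : ℝ} (hh : 0 < h) {f g : EuclideanSpace ℝ (Fin d) → ℂ}
    (hf : GSFinite s h f) (hg : GSFinite s h g) :
    gsNorm s h (f + g) ≤ gsNorm s h f + gsNorm s h g :=
  ciSup_le fun p => (gsQuotient_add_le s hh hf.1 hg.1 p).trans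
    (add_le_add (le_ciSup hf.2 p) (le_ciSup hg.2 p))

theorem gsNorm_smul {s h : ℝ} (c : ℂ) {f : EuclideanSpace ℝ (Fin d) → ℂ}
    (hf : GSFinite s h f) : gsNorm s h (c • f) = ‖c‖ * gsNorm s h f := by
  unfold gsNorm
  rw [Real.mul_iSup_of_nonneg (norm_nonneg c)]
  exact iSup_congr fun p => gsQuotient_smul s h c hf.1 p

theorem GSFinite.norm_le {s h : ℝ} {f : EuclideanSpace ℝ (Fin d) → ℂ}
    (hf : GSFinite s h f) (x : EuclideanSpace ℝ (Fin d)) : ‖f x‖ ≤ gsNorm s h f := by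
  have := le_ciSup hf.2 ((0 : Fin d → ℕ), (0 : Fin d → ℕ), x)
  have h2 : gsQuotient s h f ((0 : Fin d → ℕ), (0 : Fin d → ℕ), x) = ‖f x‖ := by
    simp [gsQuotient, multiDeriv_zero_index]
  rw [h2] at this
  exact this

theorem GSFinite.exists_pow_bound {s h : ℝ} (hh : 0 < h) {f : EuclideanSpace ℝ (Fin d) → ℂ}
    (hf : GSFinite s h f) (N : ℕ) (i : Fin d) : ∃ C, ∀ x, |x i| ^ N * ‖f x‖ ≤ C := by
  obtain ⟨A, hA⟩ := hf.2
  refine ⟨A * (h ^ (∑ j, ((Pi.single i N : Fin d → ℕ) j + (0 : Fin d → ℕ) j)) *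
    (((∏ j, ((Pi.single i N : Fin d → ℕ) j).factorial) *
      (∏ j, ((0 : Fin d → ℕ) j).factorial) : ℕ) : ℝ) ^ s), fun x => ?_⟩
  have h1 := hA ⟨(Pi.single i N, (0 : Fin d → ℕ), x), rfl⟩
  unfold gsQuotient at h1
  rw [div_le_iff₀ (gsQuotient_denom_pos s hh _ _)] at h1
  have h2 : (∏ j, x j ^ (Pi.single i N : Fin d → ℕ) j : ℝ) = x i ^ N := by
    rw [Finset.prod_eq_single i]
    · simp
    · intro j _ hj; simp [hj]
    · simp
  simp only [h2, multiDeriv_zero_index] at h1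
  rw [norm_mul, Complex.norm_real, Real.norm_eq_abs, abs_pow] at h1
  exact h1

theorem GSFinite.integrable {s h : ℝ} (hh : 0 < h) {f : EuclideanSpace ℝ (Fin d) → ℂ}
    (hf : GSFinite s h f) : Integrable f := by
  choose C hC using hf.exists_pow_bound hh (d + 1)
  have hint : Integrable (fun x : EuclideanSpace ℝ (Fin d) =>
      (2 ^ (d + 1) * (gsNorm s h f + ∑ i, (d : ℝ) ^ (d + 1) * C i)) *
        (1 + ‖x‖) ^ (-((d : ℝ) + 1))) :=
    (integrable_one_add_norm (by simp)).const_mul _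
  refine hint.mono' hf.1.continuous.aestronglyMeasurable (.of_forall fun x => ?_)
  have hpos : 0 < (1 + ‖x‖) ^ (d + 1) := by positivity
  have hr : (1 + ‖x‖) ^ (-((d : ℝ) + 1)) = ((1 + ‖x‖) ^ (d + 1))⁻¹ := by
    rw [Real.rpow_neg (by positivity)]
    congr 1
    exact_mod_cast Real.rpow_natCast (1 + ‖x‖) (d + 1)
  rw [hr, ← div_eq_mul_inv, le_div_iff₀ hpos]
  have hC0 : ∀ i, 0 ≤ C i := fun i => le_trans (by positivity) (hC i x)
  have hsum0 : 0 ≤ ∑ i, (d : ℝ) ^ (d + 1) * C i :=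
    Finset.sum_nonneg fun i _ => mul_nonneg (by positivity) (hC0 i)
  have hN0 : 0 ≤ gsNorm s h f := gsNorm_nonneg s hh f
  rcases le_total ‖x‖ 1 with hx | hx
  · calc ‖f x‖ * (1 + ‖x‖) ^ (d + 1) ≤ gsNorm s h f * 2 ^ (d + 1) := by
          gcongr
          · exact hf.norm_le x
          · linarith
      _ ≤ _ := by
          rw [mul_comm]
          gcongr
          linarith
  · have hd : ∃ i, ‖x‖ ≤ d * |x i| := by
      by_contra hcon
      push Not at hcon
      have hle : ‖x‖ ≤ ∑ i, |x i| := by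
        rw [EuclideanSpace.norm_eq]
        refine Real.sqrt_le_iff.2 ⟨Finset.sum_nonneg fun i _ => abs_nonneg _, ?_⟩
        exact Finset.sum_sq_le_sq_sum_of_nonneg fun i _ => abs_nonneg _
      have hdpos : 0 < d := by
        rcases Nat.eq_zero_or_pos d with h0 | h0
        · subst h0
          simp at hle
          rw [hle] at hx
          simp at hx
          linarith
        · exact h0
      have : Nonempty (Fin d) := ⟨⟨0, hdpos⟩⟩
      have h2 : ∑ i : Fin d, (d : ℝ) * |x i| < ∑ _i : Fin d, ‖x‖ :=
        Finset.sum_lt_sum_of_nonempty Finset.univ_nonempty fun i _ => hcon i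
      rw [← Finset.mul_sum, Finset.sum_const, Finset.card_univ, Fintype.card_fin,
        nsmul_eq_mul] at h2
      have hdR : (0 : ℝ) < d := by exact_mod_cast hdpos
      exact absurd (lt_of_mul_lt_mul_left h2 hdR.le) (not_lt.2 hle)
    obtain ⟨i, hi⟩ := hd
    calc ‖f x‖ * (1 + ‖x‖) ^ (d + 1) ≤ ‖f x‖ * (2 * (d * |x i|)) ^ (d + 1) := by
          gcongr
          linarith
      _ = 2 ^ (d + 1) * ((d : ℝ) ^ (d + 1) * (|x i| ^ (d + 1) * ‖f x‖)) := by
          rw [mul_pow, mul_pow]; ring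
      _ ≤ 2 ^ (d + 1) * ((d : ℝ) ^ (d + 1) * C i) := by
          gcongr
          exact hC i x
      _ ≤ _ := by
          gcongr
          have := Finset.single_le_sum (f := fun i => (d : ℝ) ^ (d + 1) * C i)
            (fun j _ => mul_nonneg (by positivity) (hC0 j)) (Finset.mem_univ i)
          simp only at this
          linarith

theorem GSFinite.integrable_mul {s t h k : ℝ} (hh : 0 < h)
    {f g : EuclideanSpace ℝ (Fin d) → ℂ} (hg : GSFinite s h g) (hf : GSFinite t k f) :
    Integrable (fun x => g x * f x) :=
  (hg.integrable hh).mul_bdd (c := gsNorm t k f)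
    hf.1.continuous.aestronglyMeasurable (.of_forall fun x => hf.norm_le x)

theorem GSFinite.norm_integral_mul_le {s t h k : ℝ} (hh : 0 < h)
    {f g : EuclideanSpace ℝ (Fin d) → ℂ} (hg : GSFinite s h g) (hf : GSFinite t k f) :
    ‖∫ x, g x * f x‖ ≤ (∫ x, ‖g x‖) * gsNorm t k f := by
  rw [← integral_mul_const]
  refine norm_integral_le_of_norm_le ((hg.integrable hh).norm.mul_const _)
    (.of_forall fun x => ?_)
  rw [norm_mul]
  gcongr
  exact hf.norm_le x

end helpers

/-! ### Roumieu type -/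

/-- The Gelfand-Shilov space `𝒮_s(ℝ^d)`: all smooth `f` with `‖f‖_{s,h} < ∞` for some `h > 0`. -/
def gsRoumieu (d : ℕ) (s : ℝ) : Submodule ℂ (EuclideanSpace ℝ (Fin d) → ℂ) where
  carrier := {f | ∃ h, 0 < h ∧ GSFinite s h f}
  zero_mem' := ⟨1, one_pos, GSFinite.zero s 1⟩
  add_mem' := by
    rintro f g ⟨h, hh, hf⟩ ⟨k, hk, hg⟩
    exact ⟨max h k, lt_max_of_lt_left hh,
      (hf.mono hh (le_max_left _ _)).add (lt_max_of_lt_left hh) (hg.mono hk (le_max_right _ _))⟩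
  smul_mem' := by
    rintro c f ⟨h, hh, hf⟩
    exact ⟨h, hh, hf.smul c⟩

/-- `𝒮_s(ℝ^d)` as a type, so that it carries its inductive limit topology and not the
topology of pointwise convergence. -/
def GSRoumieu (d : ℕ) (s : ℝ) : Type := ↥(gsRoumieu d s)

instance (d : ℕ) (s : ℝ) : AddCommGroup (GSRoumieu d s) :=
  inferInstanceAs (AddCommGroup ↥(gsRoumieu d s))

instance (d : ℕ) (s : ℝ) : Module ℂ (GSRoumieu d s) :=
  inferInstanceAs (Module ℂ ↥(gsRoumieu d s))

/-- The index set of all seminorms on `𝒮_s` whose restriction to each of the normed spaces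
`{f | ‖f‖_{s,h} < ∞}`, `h > 0`, is continuous. -/
def RoumieuSeminorm (d : ℕ) (s : ℝ) : Type :=
  {q : Seminorm ℂ (GSRoumieu d s) // ∀ h, 0 < h →
    ∃ M : ℝ, ∀ f : GSRoumieu d s, GSFinite s h f.1 → q f ≤ M * gsNorm s h f.1}

instance (d : ℕ) (s : ℝ) : Nonempty (RoumieuSeminorm d s) :=
  ⟨⟨0, fun _ _ => ⟨0, fun _ _ => by simp⟩⟩⟩

/-- The family of all these seminorms. -/
def roumieuFamily (d : ℕ) (s : ℝ) : SeminormFamily ℂ (GSRoumieu d s) (RoumieuSeminorm d s) :=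
  fun q => q.1

/-- The inductive limit topology of `𝒮_s`: the finest locally convex topology for which the
inclusions of the normed spaces `{f | ‖f‖_{s,h} < ∞}` are continuous. -/
instance (d : ℕ) (s : ℝ) : TopologicalSpace (GSRoumieu d s) :=
  (roumieuFamily d s).moduleFilterBasis.topology

theorem roumieu_withSeminorms (d : ℕ) (s : ℝ) : WithSeminorms (roumieuFamily d s) := ⟨rfl⟩

/-- The bilinear integral pairing with a fixed `g ∈ 𝒮_s`, as a linear map. -/
def roumieuPairing {d : ℕ} {s : ℝ} (g : GSRoumieu d s) : GSRoumieu d s →ₗ[ℂ] ℂ where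
  toFun φ := ∫ x, g.1 x * φ.1 x
  map_add' := by
    rintro ⟨f, k, hk, hf⟩ ⟨f', k', hk', hf'⟩
    obtain ⟨h, hh, hg⟩ := g.2
    rw [← integral_add (hg.integrable_mul hh hf) (hg.integrable_mul hh hf')]
    exact integral_congr_ae (.of_forall fun x => mul_add _ _ _)
  map_smul' := by
    rintro c ⟨f, hf⟩
    rw [RingHom.id_apply, smul_eq_mul, ← integral_const_mul]
    exact integral_congr_ae (.of_forall fun x => mul_left_comm _ _ _)

/-- The embedding `𝒮_s ↪ 𝒮_s'`: `g` acts on test functions by `φ ↦ ∫ g φ`. -/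
def roumieuToDual {d : ℕ} {s : ℝ} (g : GSRoumieu d s) : StrongDual ℂ (GSRoumieu d s) :=
  ⟨roumieuPairing g, by
    let q : RoumieuSeminorm d s := ⟨(normSeminorm ℂ ℂ).comp (roumieuPairing g), fun k _ =>
      ⟨∫ x, ‖g.1 x‖, fun f hf => by
        obtain ⟨h, hh, hg⟩ := g.2
        exact hg.norm_integral_mul_le hh hf⟩⟩
    refine (roumieu_withSeminorms d s).continuous_normedSpace_rng _ _ ⟨{q}, 1, ?_⟩
    rw [Finset.sup_singleton, one_smul]
    exact le_refl _⟩

/-! ### Beurling type -/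

/-- The Gelfand-Shilov space `Σ_s(ℝ^d)`: all smooth `f` with `‖f‖_{s,h} < ∞` for every `h > 0`. -/
def gsBeurling (d : ℕ) (s : ℝ) : Submodule ℂ (EuclideanSpace ℝ (Fin d) → ℂ) where
  carrier := {f | ∀ h, 0 < h → GSFinite s h f}
  zero_mem' := fun h _ => GSFinite.zero s h
  add_mem' := fun hf hg h hh => (hf h hh).add hh (hg h hh)
  smul_mem' := fun c _ hf h hh => (hf h hh).smul c

/-- `Σ_s(ℝ^d)` as a type, so that it carries its projective limit topology and not the
topology of pointwise convergence. -/
def GSBeurling (d : ℕ) (s : ℝ) : Type := ↥(gsBeurling d s)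

instance (d : ℕ) (s : ℝ) : AddCommGroup (GSBeurling d s) :=
  inferInstanceAs (AddCommGroup ↥(gsBeurling d s))

instance (d : ℕ) (s : ℝ) : Module ℂ (GSBeurling d s) :=
  inferInstanceAs (Module ℂ ↥(gsBeurling d s))

/-- The seminorms `‖·‖_{s,h}`, `h > 0`, on `Σ_s`. -/
def beurlingFamily (d : ℕ) (s : ℝ) :
    SeminormFamily ℂ (GSBeurling d s) {h : ℝ // 0 < h} :=
  fun h => Seminorm.of (fun f => gsNorm s h.1 f.1)
    (fun f g => gsNorm_add_le h.2 (f.2 h.1 h.2) (g.2 h.1 h.2))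
    (fun c f => gsNorm_smul c (f.2 h.1 h.2))

instance : Nonempty {h : ℝ // 0 < h} := ⟨⟨1, one_pos⟩⟩

/-- The projective limit topology of `Σ_s`, generated by the seminorms `‖·‖_{s,h}`, `h > 0`. -/
instance (d : ℕ) (s : ℝ) : TopologicalSpace (GSBeurling d s) :=
  (beurlingFamily d s).moduleFilterBasis.topology

theorem beurling_withSeminorms (d : ℕ) (s : ℝ) : WithSeminorms (beurlingFamily d s) := ⟨rfl⟩

/-- The bilinear integral pairing with a fixed `g ∈ Σ_s`, as a linear map. -/
def beurlingPairing {d : ℕ} {s : ℝ} (g : GSBeurling d s) : GSBeurling d s →ₗ[ℂ] ℂ where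
  toFun φ := ∫ x, g.1 x * φ.1 x
  map_add' := by
    rintro ⟨f, hf⟩ ⟨f', hf'⟩
    rw [← integral_add ((g.2 1 one_pos).integrable_mul one_pos (hf 1 one_pos))
      ((g.2 1 one_pos).integrable_mul one_pos (hf' 1 one_pos))]
    exact integral_congr_ae (.of_forall fun x => mul_add _ _ _)
  map_smul' := by
    rintro c ⟨f, hf⟩
    rw [RingHom.id_apply, smul_eq_mul, ← integral_const_mul]
    exact integral_congr_ae (.of_forall fun x => mul_left_comm _ _ _)

/-- The embedding `Σ_s ↪ Σ_s'`: `g` acts on test functions by `φ ↦ ∫ g φ`. -/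
def beurlingToDual {d : ℕ} {s : ℝ} (g : GSBeurling d s) : StrongDual ℂ (GSBeurling d s) :=
  ⟨beurlingPairing g, by
    have hC : 0 ≤ ∫ x, ‖g.1 x‖ := integral_nonneg fun x => norm_nonneg _
    refine (beurling_withSeminorms d s).continuous_normedSpace_rng _ _
      ⟨{⟨1, one_pos⟩}, ⟨∫ x, ‖g.1 x‖, hC⟩, fun f => ?_⟩
    rw [Finset.sup_singleton]
    exact (g.2 1 one_pos).norm_integral_mul_le one_pos (f.2 1 one_pos)⟩

/-! ## Wilson bases of exponential decay -/

/-- The Wilson system on `ℝ` generated by `ψ`: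
`ψ_{0,n} = T_n ψ`, and for `l ≠ 0`
`ψ_{l,n} = √2 Re (M_l T_{n/2} ψ)` if `l + n` is even,
`ψ_{l,n} = √2 Im (M_l T_{n/2} ψ)` if `l + n` is odd (`ψ` is real-valued). -/
def wilson1 (ψ : ℝ → ℝ) (l : ℕ) (n : ℤ) (x : ℝ) : ℝ :=
  if l = 0 then ψ (x - n)
  else if Even ((l : ℤ) + n) then √2 * Real.cos (2 * Real.pi * l * x) * ψ (x - n / 2)
  else √2 * Real.sin (2 * Real.pi * l * x) * ψ (x - n / 2)

/-- `ψ` generates a Wilson basis of exponential decay on `ℝ`: `ψ` and its Fourier transform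
decay exponentially, and the Wilson system of `ψ` is an orthonormal basis of `L²(ℝ)`.
Exponential decay of `ψ` and `ψ̂` makes `ψ` almost everywhere equal to a continuous function;
`ψ` denotes that function. -/
structure IsWilsonGenerator (ψ : ℝ → ℝ) : Prop where
  continuous : Continuous ψ
  decay : ∃ a C : ℝ, 0 < a ∧ 0 < C ∧ ∀ x, |ψ x| ≤ C * Real.exp (-a * |x|)
  fourier_decay : ∃ b C : ℝ, 0 < b ∧ 0 < C ∧
    ∀ ξ : ℝ, ‖𝓕 (fun x : ℝ => (ψ x : ℂ)) ξ‖ ≤ C * Real.exp (-b * |ξ|)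
  basis : ∃ B : HilbertBasis (ℕ × ℤ) ℂ (Lp ℂ 2 (volume : Measure ℝ)),
    ∀ l n, (B (l, n) : ℝ → ℂ) =ᵐ[volume] fun x => (wilson1 ψ l n x : ℂ)

/-- The tensor product Wilson system on `ℝ^d`, indexed by `(l, n) ∈ ℕ₀^d × ℤ^d`:
`ψ_{l,n}(x) = ∏_k ψ_{l_k,n_k}(x_k)`. The values are real. -/
def wilson {d : ℕ} (ψ : Fin d → ℝ → ℝ) (i : (Fin d → ℕ) × (Fin d → ℤ)) :
    EuclideanSpace ℝ (Fin d) → ℂ :=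
  fun x => ((∏ k, wilson1 (ψ k) (i.1 k) (i.2 k) (x k) : ℝ) : ℂ)

/-- The quantity `|n/2| + |l|` with Euclidean norms. -/
def wilsonSize {d : ℕ} (i : (Fin d → ℕ) × (Fin d → ℤ)) : ℝ :=
  √(∑ k, ((i.2 k : ℝ) / 2) ^ 2) + √(∑ k, (i.1 k : ℝ) ^ 2)

/-- `∑ |c_{l,n}|² e^{-2h(|n/2|+|l|)^{1/s}} < ∞`. -/
def WilsonSummable {d : ℕ} (s h : ℝ) (c : (Fin d → ℕ) × (Fin d → ℤ) → ℂ) : Prop :=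
  Summable fun i => ‖c i‖ ^ 2 * Real.exp (-2 * h * wilsonSize i ^ (1 / s))

end

noncomputable section

/-! The proof is a two-sided comparison between the norms `gsNorm s k` and exponential weights in
`(|n/2| + |l|)^{1/s}` on the index set.

Size of the basis. Exponential decay of the Fourier transform makes each generator the trace of a
function holomorphic in a strip, and a Phragmén–Lindelöf argument carries the exponential decay of
the generator into a narrower strip. Cauchy's estimates on circles of radius ρ bound the β-th
derivative of a Wilson function of frequency l by `e^{2πlρ} β!/ρ^β`, up to a constant and a decaying
factor. Taking ρ of order `l^{-(s-1)/s}` turns this into `β!^s`, a geometric factor in β and an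
exponential of `l^{1/s}`; this uses s > 1. Free parameters then give both quantifier orders: any
growth rate at a sufficiently large step (`exists_wilsonStepBound_of_weight`), or any step with some
growth rate (`exists_wilsonStepBound_of_step`).

Size of the coefficients. The integral of a test function against a Wilson function decays in n
because both factors are localized, and in l because for l ≠ 0 it combines values at ±l of the
Fourier transform of a Gevrey function. In several variables one slices along a coordinate. The rate
obtained in `exists_wilson_coeff_le` tends to infinity as the step tends to 0.

Expansion. Completeness in `L²` identifies a test function with its Wilson series, and the two
estimates make that series absolutely summable in a step norm (`tendsto_gsNorm_sub_sum`). A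
functional may therefore be applied term by term; its coefficients grow no faster than the norms of
the Wilson functions. Uniqueness is orthonormality, tested on a single Wilson function.

Strong convergence. For an admissible sequence c the pairings stay absolutely summable after
multiplication by 1 + weight, with sum bounded by a continuous seminorm. The extra factor makes
tails uniformly small on bounded sets (`exists_hasSum_strongDual`). Applied to the coefficients of f
this yields a strong limit, which agrees with f on every test function. The Roumieu and Beurling
cases differ only in how steps and rates are quantified. -/

/-! ### Factorials against stretched exponentials -/

/-- One term of the exponential series at `c y^{1/σ}`, raised to the power σ. The free c trades the
geometric factor against the exponential rate. It is used with σ = s for powers of x and with σ = s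
- 1 for inverse radii. -/
theorem pow_le_factorial_rpow_mul_exp {σ c y : ℝ} (hσ : 0 < σ) (hc : 0 < c) (hy : 0 ≤ y) (j : ℕ) :
    y ^ j ≤ (j.factorial : ℝ) ^ σ * (c ^ (-σ)) ^ j * Real.exp (σ * c * y ^ (1 / σ)) := by
  have hjf : (0 : ℝ) < j.factorial := by exact_mod_cast j.factorial_pos
  have ht : 0 ≤ y ^ (1 / σ) := Real.rpow_nonneg hy _
  have h1 : (c * y ^ (1 / σ)) ^ j ≤ j.factorial * Real.exp (c * y ^ (1 / σ)) := by
    have := Real.pow_div_factorial_le_exp (c * y ^ (1 / σ)) (by positivity) j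
    rwa [div_le_iff₀ hjf, mul_comm (Real.exp _)] at this
  have h2 := Real.rpow_le_rpow (by positivity) h1 hσ.le
  rw [Real.mul_rpow hjf.le (Real.exp_pos _).le, ← Real.exp_mul] at h2
  have h3 : ((c * y ^ (1 / σ)) ^ j) ^ σ = (c ^ σ) ^ j * y ^ j := by
    rw [← Real.rpow_natCast, ← Real.rpow_mul (by positivity), mul_comm (j : ℝ) σ,
      Real.rpow_mul (by positivity), Real.mul_rpow hc.le ht, ← Real.rpow_mul hy,
      one_div_mul_cancel hσ.ne', Real.rpow_one, Real.rpow_natCast, mul_pow]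
  rw [h3] at h2
  have h4 : (c ^ (-σ)) ^ j * (c ^ σ) ^ j = 1 := by
    rw [← mul_pow, ← Real.rpow_add hc]; simp
  calc y ^ j = (c ^ (-σ)) ^ j * ((c ^ σ) ^ j * y ^ j) := by rw [← mul_assoc, h4, one_mul]
    _ ≤ (c ^ (-σ)) ^ j * ((j.factorial : ℝ) ^ σ * Real.exp (c * y ^ (1 / σ) * σ)) := by
        gcongr
    _ = _ := by rw [show c * y ^ (1 / σ) * σ = σ * c * y ^ (1 / σ) by ring]; ring

/-- After taking s-th roots the hypothesis bounds the terms of the exponential series at `t/(2κ)`,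
times u, by a geometric series of ratio 1/2. Its sum 2 becomes `2^s` on returning to the power s. -/
theorem le_exp_neg_of_forall_pow_mul_le {s k y v N : ℝ} (hs : 0 < s) (hk : 0 < k) (hy : 0 ≤ y)
    (hv : 0 ≤ v) (hN : 0 ≤ N)
    (h : ∀ j : ℕ, y ^ j * v ≤ N * (k ^ j * (j.factorial : ℝ) ^ s)) :
    v ≤ 2 ^ s * N * Real.exp (-(s / (2 * k ^ (1 / s))) * y ^ (1 / s)) := by
  set t := y ^ (1 / s)
  set κ := k ^ (1 / s)
  set u := v ^ (1 / s)
  set M := N ^ (1 / s)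
  have hκ : 0 < κ := Real.rpow_pos_of_pos hk _
  have hu : 0 ≤ u := Real.rpow_nonneg hv _
  have hM : 0 ≤ M := Real.rpow_nonneg hN _
  have ht : 0 ≤ t := Real.rpow_nonneg hy _
  have hpow : ∀ (a : ℝ) (j : ℕ), 0 ≤ a → (a ^ j) ^ (1 / s) = (a ^ (1 / s)) ^ j := fun a j ha => by
    rw [← Real.rpow_natCast, ← Real.rpow_natCast, ← Real.rpow_mul ha, ← Real.rpow_mul ha, mul_comm]
  have h1 : ∀ j : ℕ, t ^ j * u ≤ M * (κ ^ j * j.factorial) := fun j => by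
    have := Real.rpow_le_rpow (by positivity) (h j) (one_div_pos.2 hs).le
    rwa [Real.mul_rpow (by positivity) hv, Real.mul_rpow hN (by positivity),
      Real.mul_rpow (by positivity) (by positivity), hpow _ _ hy, hpow _ _ hk.le,
      ← Real.rpow_mul (by positivity), mul_one_div_cancel hs.ne', Real.rpow_one] at this
  have h2 : Real.exp (t / (2 * κ)) * u ≤ 2 * M := by
    have e1 := NormedSpace.expSeries_div_hasSum_exp (t / (2 * κ))
    rw [← Real.exp_eq_exp_ℝ] at e1
    have e2 := e1.mul_right u
    have e3 := (hasSum_geometric_two).mul_left M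
    rw [mul_comm M 2] at e3
    refine hasSum_le (fun j => ?_) e2 e3
    have hjf : (0 : ℝ) < j.factorial := by exact_mod_cast j.factorial_pos
    have := h1 j
    rw [div_pow, mul_pow]
    calc t ^ j / (2 ^ j * κ ^ j) / j.factorial * u
        = (t ^ j * u) / (2 ^ j * κ ^ j * j.factorial) := by field_simp
      _ ≤ (M * (κ ^ j * j.factorial)) / (2 ^ j * κ ^ j * j.factorial) := by gcongr
      _ = M * (1 / 2) ^ j := by
        rw [one_div, inv_pow]; field_simp
  have h3 : u ≤ 2 * M * Real.exp (-(t / (2 * κ))) := by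
    rw [Real.exp_neg, ← div_eq_mul_inv, le_div_iff₀ (Real.exp_pos _), mul_comm]; exact h2
  have h4 := Real.rpow_le_rpow hu h3 hs.le
  rw [← Real.rpow_mul hv, one_div_mul_cancel hs.ne', Real.rpow_one,
    Real.mul_rpow (by positivity) (Real.exp_pos _).le, Real.mul_rpow (by norm_num) hM,
    ← Real.rpow_mul hN, one_div_mul_cancel hs.ne', Real.rpow_one, ← Real.exp_mul] at h4
  refine h4.trans (le_of_eq ?_)
  congr 2
  field_simp

/-- Real-analytic derivative bounds are Gevrey bounds of every step: for s > 1 the surplus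
`m!^{s-1}` beats any geometric growth. -/
theorem exists_pow_mul_factorial_le {s B h : ℝ} (hs : 1 < s) (hB : 0 ≤ B) (hh : 0 < h) :
    ∃ C : ℝ, 0 < C ∧ ∀ m : ℕ,
      B ^ m * m.factorial ≤ C * (h ^ m * (m.factorial : ℝ) ^ s) := by
  have hs' : 0 < s - 1 := by linarith
  refine ⟨_, Real.exp_pos ((s - 1) * 1 * (B / h) ^ (1 / (s - 1))), fun m => ?_⟩
  have hf : (0 : ℝ) < m.factorial := by exact_mod_cast m.factorial_pos
  have := pow_le_factorial_rpow_mul_exp hs' one_pos (div_nonneg hB hh.le) m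
  rw [Real.one_rpow, one_pow, mul_one, div_pow, div_le_iff₀ (by positivity)] at this
  calc B ^ m * m.factorial ≤ ((m.factorial : ℝ) ^ (s - 1) *
          Real.exp ((s - 1) * 1 * (B / h) ^ (1 / (s - 1))) * h ^ m) * m.factorial := by gcongr
    _ = Real.exp ((s - 1) * 1 * (B / h) ^ (1 / (s - 1))) *
        (h ^ m * ((m.factorial : ℝ) ^ (s - 1) * m.factorial ^ (1 : ℝ))) := by
          generalize Real.exp ((s - 1) * 1 * (B / h) ^ (1 / (s - 1))) = A
          rw [Real.rpow_one]; ring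
    _ = _ := by rw [← Real.rpow_add hf]; simp

/-- Lets exponential decay absorb a stretched exponential. Writing `y = t·t^{s-1}` with `t =
y^{1/s}`, the linear term wins once `t^{s-1} ≥ ε/a`; below that threshold t is bounded and the
constant suffices. -/
theorem exists_rpow_le_linear {s ε a : ℝ} (hs : 1 < s) (hε : 0 ≤ ε) (ha : 0 < a) :
    ∃ C : ℝ, 0 ≤ C ∧ ∀ y : ℝ, 0 ≤ y → ε * y ^ (1 / s) ≤ a * y + C := by
  have hs' : 0 < s - 1 := by linarith
  refine ⟨ε * (ε / a) ^ (1 / (s - 1)), by positivity, fun y hy => ?_⟩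
  have ht : 0 ≤ y ^ (1 / s) := Real.rpow_nonneg hy _
  have hyt : y = y ^ (1 / s) * (y ^ (1 / s)) ^ (s - 1) := by
    conv_rhs => rw [← Real.rpow_mul hy]
    rcases hy.eq_or_lt with rfl | hy'
    · rw [Real.zero_rpow (by positivity), zero_mul]
    · rw [← Real.rpow_add hy', show 1 / s + 1 / s * (s - 1) = 1 by field_simp; ring, Real.rpow_one]
  rcases le_total (ε / a) ((y ^ (1 / s)) ^ (s - 1)) with h | h
  · have : ε ≤ a * (y ^ (1 / s)) ^ (s - 1) := by rwa [div_le_iff₀' ha] at h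
    have h2 : 0 ≤ ε * (ε / a) ^ (1 / (s - 1)) := by positivity
    calc ε * y ^ (1 / s) ≤ a * (y ^ (1 / s)) ^ (s - 1) * y ^ (1 / s) := by gcongr
      _ = a * (y ^ (1 / s) * (y ^ (1 / s)) ^ (s - 1)) := by ring
      _ = a * y := by rw [← hyt]
      _ ≤ _ := by linarith
  · have := Real.rpow_le_rpow (by positivity) h (one_div_pos.2 hs').le
    rw [← Real.rpow_mul ht, mul_one_div_cancel hs'.ne', Real.rpow_one] at this
    have h2 : 0 ≤ a * y := by positivity
    have := mul_le_mul_of_nonneg_left this hε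
    linarith

theorem rpow_add_le_of_one_lt {s x y : ℝ} (hs : 1 < s) (hx : 0 ≤ x) (hy : 0 ≤ y) :
    (x + y) ^ (1 / s) ≤ x ^ (1 / s) + y ^ (1 / s) := by
  refine Real.rpow_add_le_add_rpow hx hy (by positivity) ?_
  rw [div_le_one (by linarith)]; exact hs.le

theorem abs_rpow_add_le {s : ℝ} (hs : 1 < s) (x y : ℝ) :
    |x + y| ^ (1 / s) ≤ |x| ^ (1 / s) + |y| ^ (1 / s) :=
  (Real.rpow_le_rpow (abs_nonneg _) (abs_add_le x y) (by positivity)).trans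
    (rpow_add_le_of_one_lt hs (abs_nonneg _) (abs_nonneg _))

theorem sum_rpow_le_of_one_lt {ι : Type*} {s : ℝ} (hs : 1 < s) (S : Finset ι) (f : ι → ℝ)
    (hf : ∀ i, 0 ≤ f i) : (∑ i ∈ S, f i) ^ (1 / s) ≤ ∑ i ∈ S, f i ^ (1 / s) := by
  classical
  induction S using Finset.induction_on with
  | empty => simp [Real.zero_rpow (by positivity : s⁻¹ ≠ 0)]
  | insert a S ha ih =>
    rw [Finset.sum_insert ha, Finset.sum_insert ha]
    exact (rpow_add_le_of_one_lt hs (hf a) (Finset.sum_nonneg fun i _ => hf i)).trans (by gcongr)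

theorem integrable_exp_neg_mul_abs {c : ℝ} (hc : 0 < c) :
    Integrable fun x : ℝ => Real.exp (-c * |x|) := by
  rw [← integrableOn_univ, ← Set.Iic_union_Ioi (a := (0 : ℝ)), integrableOn_union]
  constructor
  · refine (integrableOn_exp_mul_Iic hc 0).congr_fun (fun x hx => ?_) measurableSet_Iic
    simp [abs_of_nonpos (Set.mem_Iic.1 hx)]
  · refine (integrableOn_exp_mul_Ioi (a := -c) (by linarith) 0).congr_fun (fun x hx => ?_)
      measurableSet_Ioi
    simp [abs_of_pos (Set.mem_Ioi.1 hx)]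

/-! ### Holomorphic extension of a generator to a strip -/

/-- The Fourier inversion integral makes sense for complex arguments with small imaginary part,
because the decay of the transform dominates the growth of the exponential kernel. -/
theorem exists_holomorphic_extension {ψ : ℝ → ℝ} (hψ : IsWilsonGenerator ψ) :
    ∃ (F : ℂ → ℂ) (R M : ℝ), 0 < R ∧ 0 < M ∧ DifferentiableOn ℂ F {z | |z.im| < R} ∧
      (∀ x : ℝ, F x = ψ x) ∧ ∀ z : ℂ, |z.im| < R → ‖F z‖ ≤ M := by
  obtain ⟨a, A, ha, hA, hdec⟩ := hψ.decay
  obtain ⟨b, C, hb, hC, hfou⟩ := hψ.fourier_decay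
  set g : ℝ → ℂ := 𝓕 (fun x : ℝ => (ψ x : ℂ)) with hg
  have hψc : Continuous fun x : ℝ => (ψ x : ℂ) := Complex.continuous_ofReal.comp hψ.continuous
  have hψi : Integrable fun x : ℝ => (ψ x : ℂ) :=
    ((integrable_exp_neg_mul_abs ha).const_mul A).mono' hψc.aestronglyMeasurable
      (.of_forall fun x => by simpa using hdec x)
  have hgc : Continuous g :=
    VectorFourier.fourierIntegral_continuous Real.continuous_fourierChar
      (by exact continuous_inner) hψi
  have hgi : Integrable g := ((integrable_exp_neg_mul_abs hb).const_mul C).mono'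
      hgc.aestronglyMeasurable (.of_forall hfou)
  have hinv := hψc.fourierInv_fourier_eq hψi hgi
  -- With this R the kernel grows at most like `e^{(b/2)|ξ|}`, so half of the decay rate b survives.
  -- Half of the remainder will pay for the factor ξ produced by differentiation.
  set R : ℝ := b / (4 * Real.pi) with hR
  have hRpos : 0 < R := by positivity
  have hexp : ∀ (ξ : ℝ) (z : ℂ), |z.im| < R →
      ‖Complex.exp (2 * Real.pi * Complex.I * ξ * z)‖ ≤ Real.exp (b / 2 * |ξ|) := by
    intro ξ z hz
    rw [Complex.norm_exp]
    refine Real.exp_le_exp.2 ?_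
    have : (2 * Real.pi * Complex.I * ξ * z : ℂ).re = -(2 * Real.pi * (ξ * z.im)) := by
      simp; ring
    rw [this]
    have h1 : |ξ * z.im| ≤ |ξ| * R := by rw [abs_mul]; gcongr
    have h2 := neg_le_of_abs_le h1
    calc -(2 * Real.pi * (ξ * z.im)) ≤ 2 * Real.pi * (|ξ| * R) := by nlinarith [Real.pi_pos]
      _ = b / 2 * |ξ| := by rw [hR]; field_simp; ring
  have hcont : ∀ z : ℂ, Continuous fun ξ : ℝ =>
      g ξ * Complex.exp (2 * Real.pi * Complex.I * ξ * z) := fun z => by fun_prop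
  have hbound : ∀ (ξ : ℝ) (z : ℂ), |z.im| < R →
      ‖g ξ * Complex.exp (2 * Real.pi * Complex.I * ξ * z)‖ ≤ C * Real.exp (-(b / 2) * |ξ|) := by
    intro ξ z hz
    rw [norm_mul]
    calc _ ≤ C * Real.exp (-b * |ξ|) * Real.exp (b / 2 * |ξ|) := by
          gcongr
          exacts [hfou ξ, hexp ξ z hz]
      _ = _ := by rw [mul_assoc, ← Real.exp_add]; ring_nf
  have hb2 : 0 < b / 2 := by positivity
  have hb4 : 0 < b / 4 := by positivity
  refine ⟨fun z => ∫ ξ : ℝ, g ξ * Complex.exp (2 * Real.pi * Complex.I * ξ * z), R,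
    (∫ ξ : ℝ, C * Real.exp (-(b / 2) * |ξ|)) + 1, hRpos, ?_, ?_, ?_, ?_⟩
  · have : 0 ≤ ∫ ξ : ℝ, C * Real.exp (-(b / 2) * |ξ|) :=
      integral_nonneg fun ξ => by positivity
    linarith
  · intro z hz
    have hopen : IsOpen {z : ℂ | |z.im| < R} :=
      isOpen_lt (Complex.continuous_im.abs) continuous_const
    refine (HasDerivAt.differentiableAt (hasDerivAt_integral_of_dominated_loc_of_deriv_le
      (F := fun (z : ℂ) (ξ : ℝ) => g ξ * Complex.exp (2 * Real.pi * Complex.I * ξ * z))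
      (F' := fun (z : ℂ) (ξ : ℝ) => g ξ * (Complex.exp (2 * Real.pi * Complex.I * ξ * z) *
        (2 * Real.pi * Complex.I * ξ)))
      (bound := fun ξ => C * (2 * Real.pi * (b / 4)⁻¹) * Real.exp (-(b / 4) * |ξ|))
      (hopen.mem_nhds hz) ?_ ?_ ?_ ?_ ?_ ?_).2).differentiableWithinAt
    · exact .of_forall fun w => (hcont w).aestronglyMeasurable
    · exact ((integrable_exp_neg_mul_abs hb2).const_mul C).mono' (hcont z).aestronglyMeasurable
        (.of_forall fun ξ => hbound ξ z hz)
    · exact (by fun_prop : Continuous fun ξ : ℝ =>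
        g ξ * (Complex.exp (2 * Real.pi * Complex.I * ξ * z) *
        (2 * Real.pi * Complex.I * ξ))).aestronglyMeasurable
    · refine .of_forall fun ξ w hw => ?_
      have h1 := hbound ξ w hw
      rw [← mul_assoc, norm_mul]
      have h2 : ‖(2 * Real.pi * Complex.I * ξ : ℂ)‖ = 2 * Real.pi * |ξ| := by
        simp [abs_of_pos Real.pi_pos]
      rw [h2]
      have h3 := Real.le_inv_mul_exp (|ξ|) hb4
      calc _ ≤ C * Real.exp (-(b / 2) * |ξ|) *
            (2 * Real.pi * ((b / 4)⁻¹ * Real.exp (b / 4 * |ξ|))) := by gcongr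
        _ = C * (2 * Real.pi * (b / 4)⁻¹) *
            (Real.exp (-(b / 2) * |ξ|) * Real.exp (b / 4 * |ξ|)) := by ring
        _ = _ := by rw [← Real.exp_add]; ring_nf
    · exact (integrable_exp_neg_mul_abs hb4).const_mul _
    · refine .of_forall fun ξ w hw => ?_
      have h1 : HasDerivAt (fun w : ℂ => 2 * Real.pi * Complex.I * ξ * w)
          (2 * Real.pi * Complex.I * ξ) w := by
        simpa using (hasDerivAt_id w).const_mul (2 * Real.pi * Complex.I * ξ : ℂ)
      exact (h1.cexp).const_mul (g ξ)
  · intro x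
    have := congrFun hinv x
    rw [Real.fourierInv_eq'] at this
    rw [← this]
    refine integral_congr_ae (.of_forall fun ξ => ?_)
    simp only [smul_eq_mul]
    rw [mul_comm]
    congr 2
    simp
    ring
  · intro z hz
    refine (norm_integral_le_of_norm_le ((integrable_exp_neg_mul_abs hb2).const_mul C)
      (.of_forall fun ξ => hbound ξ z hz)).trans ?_
    linarith

/-- Exponential decay on the real line propagates into the upper half of a strip. -/
theorem norm_le_exp_of_strip {F : ℂ → ℂ} {a C r : ℝ} (ha : 0 < a) (hr : 0 < r)
    (hF : DiffContOnCl ℂ F (Complex.im ⁻¹' Set.Ioo 0 r))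
    (hb : ∀ z : ℂ, 0 ≤ z.im → z.im ≤ r → ‖F z‖ ≤ C)
    (hd : ∀ x : ℝ, ‖F x‖ ≤ C * Real.exp (-a * |x|)) {ε : ℝ} (hε : ε = 1 ∨ ε = -1)
    {z : ℂ} (h0 : 0 ≤ z.im) (h1 : z.im ≤ r) :
    ‖F z‖ ≤ C * Real.exp (-a * (ε * z.re * (1 - z.im / r))) := by
  have hε1 : |ε| = 1 := by rcases hε with rfl | rfl <;> simp
  have hC : 0 ≤ C := (norm_nonneg _).trans (hb z h0 h1)
  -- The real part of `z + iz²/(2r)` is `Re z (1 - Im z / r)`: the multiplier cancels the decay on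
  -- the real line and has modulus 1 on the upper edge. Thus `G` is bounded by `C` on both edges.
  set G : ℂ → ℂ := fun z => F z * Complex.exp (a * ε * (z + Complex.I * z ^ 2 / (2 * r))) with hG
  have hre : ∀ z : ℂ, (a * ε * (z + Complex.I * z ^ 2 / (2 * r)) : ℂ).re =
      a * (ε * z.re * (1 - z.im / r)) := by
    intro z
    have e1 : (a * ε * (z + Complex.I * z ^ 2 / (2 * r)) : ℂ) =
        ((a * ε : ℝ) : ℂ) * (z + ((1 / (2 * r) : ℝ) : ℂ) * (Complex.I * z ^ 2)) := by
      push_cast; field_simp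
    have e2 : (Complex.I * z ^ 2).re = -(2 * z.re * z.im) := by
      rw [sq]; simp; ring
    rw [e1, Complex.re_ofReal_mul, Complex.add_re, Complex.re_ofReal_mul, e2]
    field_simp
    ring
  have hnorm : ∀ z : ℂ, ‖G z‖ = ‖F z‖ * Real.exp (a * (ε * z.re * (1 - z.im / r))) := by
    intro z
    rw [hG, norm_mul, Complex.norm_exp, hre]
  have key : ‖G z‖ ≤ C := by
    refine PhragmenLindelof.horizontal_strip (f := G) (a := 0) (b := r) ?_ ?_ ?_ ?_ h0 h1
    · have : Differentiable ℂ fun z : ℂ => Complex.exp (a * ε * (z + Complex.I * z ^ 2 / (2 * r))) :=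
        by fun_prop
      simpa only [smul_eq_mul, hG] using hF.smul this.diffContOnCl
    -- Phragmén–Lindelöf allows double exponential growth with inner rate below `π/r`. Half that
    -- rate is taken; it dominates the actual growth `e^{a|Re z|}`.
    · have hc : 0 < Real.pi / r / 2 := by positivity
      refine ⟨Real.pi / r / 2, ?_, a * (Real.pi / r / 2)⁻¹, ?_⟩
      · rw [sub_zero]; exact half_lt_self (by positivity)
      refine Asymptotics.IsBigO.of_bound C ?_
      rw [Filter.eventually_inf_principal]
      refine .of_forall fun w hw => ?_
      rw [hnorm, Real.norm_eq_abs, Real.abs_exp]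
      have hw1 : |1 - w.im / r| ≤ 1 := by
        have h1 : 0 < w.im / r := div_pos hw.1 hr
        have h2 : w.im / r < 1 := (div_lt_one hr).2 hw.2
        rw [abs_le]; constructor <;> linarith
      refine mul_le_mul (hb w hw.1.le hw.2.le) (Real.exp_le_exp.2 ?_) (Real.exp_pos _).le hC
      · rw [mul_assoc a _ (Real.exp _)]
        refine mul_le_mul_of_nonneg_left ?_ ha.le
        calc ε * w.re * (1 - w.im / r) ≤ |ε * w.re * (1 - w.im / r)| := le_abs_self _
          _ = |w.re| * |1 - w.im / r| := by rw [abs_mul, abs_mul, hε1, one_mul]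
          _ ≤ |w.re| := mul_le_of_le_one_right (abs_nonneg _) hw1
          _ ≤ _ := Real.le_inv_mul_exp _ hc
    · intro z hz
      have hzx : z = (z.re : ℂ) := Complex.ext (by simp) (by simp [hz])
      rw [hnorm, hz, zero_div, sub_zero, mul_one]
      have := hd z.re
      rw [← hzx] at this
      calc _ ≤ C * Real.exp (-a * |z.re|) * Real.exp (a * |z.re|) := by
            gcongr
            calc ε * z.re ≤ |ε * z.re| := le_abs_self _
              _ = |z.re| := by rw [abs_mul, hε1, one_mul]
        _ = C := by rw [mul_assoc, ← Real.exp_add]; simp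
    · intro z hz
      rw [hnorm, hz, div_self hr.ne']
      simpa using hb z (hz ▸ hr.le) hz.le
  rw [hnorm, ← le_div_iff₀ (Real.exp_pos _)] at key
  rwa [neg_mul, Real.exp_neg, ← div_eq_mul_inv]


/-- Boundedness in the strip and decay on the real line interpolate to decay between them. The lower
half-strip is reduced to the upper one by `z ↦ -z`. -/
theorem exists_holomorphic_extension_exp_decay {ψ : ℝ → ℝ} (hψ : IsWilsonGenerator ψ) :
    ∃ (F : ℂ → ℂ) (r a M : ℝ), 0 < r ∧ 0 < a ∧ 0 < M ∧
      DifferentiableOn ℂ F {z | |z.im| < r} ∧ (∀ x : ℝ, F x = ψ x) ∧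
      ∀ z : ℂ, |z.im| < r → ‖F z‖ ≤ M * Real.exp (-a * |z.re|) := by
  obtain ⟨F, R, M, hR, hM, hF, hFψ, hFM⟩ := exists_holomorphic_extension hψ
  obtain ⟨a, A, ha, hA, hdec⟩ := hψ.decay
  set C := max M A
  have hdx : ∀ x : ℝ, ‖F x‖ ≤ C * Real.exp (-a * |x|) := fun x => by
    rw [hFψ, Complex.norm_real, Real.norm_eq_abs]
    refine (hdec x).trans ?_
    gcongr
    exact le_max_right _ _
  have hclosure : closure (Complex.im ⁻¹' Set.Ioo 0 (R / 2)) ⊆ {z : ℂ | |z.im| < R} := by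
    have : closure (Complex.im ⁻¹' Set.Ioo 0 (R / 2)) ⊆ Complex.im ⁻¹' Set.Icc 0 (R / 2) :=
      closure_minimal (Set.preimage_mono Set.Ioo_subset_Icc_self)
        (isClosed_Icc.preimage Complex.continuous_im)
    refine this.trans fun z hz => ?_
    simp only [Set.mem_preimage, Set.mem_Icc] at hz
    simp only [Set.mem_ofPred_eq]
    rw [abs_of_nonneg hz.1]; linarith
  have hup : ∀ z : ℂ, 0 ≤ z.im → z.im < R / 4 → ∀ H : ℂ → ℂ,
      DifferentiableOn ℂ H {z | |z.im| < R} → (∀ z : ℂ, |z.im| < R → ‖H z‖ ≤ M) →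
      (∀ x : ℝ, ‖H x‖ ≤ C * Real.exp (-a * |x|)) →
      ‖H z‖ ≤ C * Real.exp (-(a / 2) * |z.re|) := by
    intro z h0 h1 H hH hHM hHd
    -- Interpolation runs over height R/2 but is used only up to R/4, so at least half of the decay
    -- rate remains.
    have hz : 1 / 2 ≤ 1 - z.im / (R / 2) := by
      have : z.im / (R / 2) ≤ 1 / 2 := by
        rw [div_le_iff₀ (by positivity)]; linarith
      linarith
    have main : ∀ ε : ℝ, (ε = 1 ∨ ε = -1) →
        ‖H z‖ ≤ C * Real.exp (-a * (ε * z.re * (1 - z.im / (R / 2)))) := fun ε hε =>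
      norm_le_exp_of_strip ha (half_pos hR) (hH.mono hclosure).diffContOnCl
        (fun w hw0 hw1 => (hHM w (by rw [abs_of_nonneg hw0]; linarith)).trans (le_max_left _ _))
        hHd hε h0 (by linarith)
    have hfin : ∀ ε : ℝ, (ε = 1 ∨ ε = -1) → |z.re| = ε * z.re →
        ‖H z‖ ≤ C * Real.exp (-(a / 2) * |z.re|) := fun ε hε he => by
      refine (main ε hε).trans ?_
      have hC : 0 ≤ C := hM.le.trans (le_max_left _ _)
      gcongr ?_ * Real.exp ?_
      rw [← he]
      nlinarith [mul_le_mul_of_nonneg_left hz (mul_nonneg ha.le (abs_nonneg z.re))]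
    rcases abs_choice z.re with h | h
    · exact hfin 1 (.inl rfl) (by rw [h]; ring)
    · exact hfin (-1) (.inr rfl) (by rw [h]; ring)
  refine ⟨F, R / 4, a / 2, C, by positivity, by positivity, hM.trans_le (le_max_left _ _),
    hF.mono fun z hz => ?_, hFψ, fun z hz => ?_⟩
  · simp only [Set.mem_ofPred_eq] at hz ⊢; linarith
  · rcases le_total 0 z.im with h0 | h0
    · exact hup z h0 (by rwa [abs_of_nonneg h0] at hz) F hF hFM hdx
    · have := hup (-z) (by simpa using h0) (by rwa [abs_of_nonpos h0] at hz) (fun w => F (-w))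
        (hF.comp differentiable_neg.differentiableOn fun w hw => by simpa using hw)
        (fun w hw => hFM _ (by simpa using hw))
        (fun x => by simpa using hdx (-x))
      simpa using this

/-- The restriction to the real line of a holomorphic function. -/
theorem contDiff_and_iteratedDeriv_of_differentiableOn {G : ℂ → ℂ} {r : ℝ} (hr : 0 < r)
    (hG : DifferentiableOn ℂ G {z | |z.im| < r}) {g : ℝ → ℂ} (hg : ∀ x : ℝ, g x = G x) :
    ContDiff ℝ ∞ g ∧ ∀ (m : ℕ) (x : ℝ), iteratedDeriv m g x = iteratedDeriv m G x := by
  have hopen : IsOpen {z : ℂ | |z.im| < r} :=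
    isOpen_lt (Complex.continuous_im.abs) continuous_const
  have han : AnalyticOnNhd ℂ G {z : ℂ | |z.im| < r} := hG.analyticOnNhd hopen
  have hmem : ∀ x : ℝ, (x : ℂ) ∈ {z : ℂ | |z.im| < r} := fun x => by simpa using hr
  have hder : ∀ (m : ℕ) (x : ℝ), HasDerivAt (fun y : ℝ => iteratedDeriv m G y)
      (iteratedDeriv (m + 1) G x) x := fun m x => by
    have h1 : DifferentiableAt ℂ (iteratedDeriv m G) x := by
      rw [iteratedDeriv_eq_iterate]
      exact (han.iterated_deriv m _ (hmem x)).differentiableAt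
    rw [iteratedDeriv_succ]
    exact h1.hasDerivAt.comp_ofReal
  have hit : ∀ m : ℕ, iteratedDeriv m g = fun x : ℝ => iteratedDeriv m G x := fun m => by
    induction m with
    | zero => funext x; simp [hg]
    | succ m ih =>
      rw [iteratedDeriv_succ, ih]
      funext x
      exact (hder m x).deriv
  refine ⟨contDiff_of_differentiable_iteratedDeriv fun m _ => ?_, fun m x => congrFun (hit m) x⟩
  rw [hit m]
  exact fun x => (hder m x).differentiableAt

/-- Cauchy's estimate on the circle of radius ρ about x. Points of that circle are horizontally
within r of x, which costs the factor `e^{ar}`. -/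
theorem norm_iteratedDeriv_le_of_strip {G : ℂ → ℂ} {r ρ a p M : ℝ} (hρ : 0 < ρ)
    (hρr : ρ < r) (ha : 0 ≤ a) (hM : 0 ≤ M) (hG : DifferentiableOn ℂ G {z | |z.im| < r})
    (hb : ∀ z : ℂ, |z.im| ≤ ρ → ‖G z‖ ≤ M * Real.exp (-a * |z.re - p|)) (m : ℕ) (x : ℝ) :
    ‖iteratedDeriv m G x‖ ≤
      Real.exp (a * r) * M * Real.exp (-a * |x - p|) * (m.factorial / ρ ^ m) := by
  have hsub : ∀ z ∈ Metric.closedBall (x : ℂ) ρ, |z.im| ≤ ρ ∧ |z.re - x| ≤ ρ := fun z hz => by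
    rw [mem_closedBall_iff_norm] at hz
    constructor
    · simpa using (Complex.abs_im_le_norm (z - x)).trans hz
    · simpa using (Complex.abs_re_le_norm (z - x)).trans hz
  have hcl : closure (Metric.ball (x : ℂ) ρ) ⊆ {z | |z.im| < r} :=
    Metric.closure_ball_subset_closedBall.trans fun z hz => ((hsub z hz).1).trans_lt hρr
  refine (Complex.norm_iteratedDeriv_le_of_forall_mem_sphere_norm_le (R := ρ)
    (C := Real.exp (a * r) * M * Real.exp (-a * |x - p|)) m hρ
    (hG.mono hcl).diffContOnCl fun z hz => ?_).trans (le_of_eq (by ring))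
  obtain ⟨h1, h2⟩ := hsub z (Metric.sphere_subset_closedBall hz)
  refine (hb z h1).trans ?_
  have h3 : |x - p| ≤ |z.re - p| + r := by
    have := abs_sub_le x z.re p
    rw [abs_sub_comm x z.re] at this
    linarith
  calc M * Real.exp (-a * |z.re - p|) ≤ M * Real.exp (a * r + -a * |x - p|) := by
        gcongr
        nlinarith
    _ = _ := by rw [Real.exp_add]; ring

/-! ### Gelfand–Shilov bounds for one-dimensional Wilson functions -/

/-- The point at which `wilson1 ψ l n` is concentrated. -/
def wilsonCenter (l : ℕ) (n : ℤ) : ℝ := if l = 0 then n else n / 2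

theorem Complex.norm_cos_le_exp (z : ℂ) : ‖Complex.cos z‖ ≤ Real.exp |z.im| := by
  rw [Complex.cos, norm_div]
  have h1 : ‖Complex.exp (z * Complex.I)‖ ≤ Real.exp |z.im| := by
    rw [Complex.norm_exp]; exact Real.exp_le_exp.2 (by simpa using neg_le_abs z.im)
  have h2 : ‖Complex.exp (-z * Complex.I)‖ ≤ Real.exp |z.im| := by
    rw [Complex.norm_exp]; exact Real.exp_le_exp.2 (by simpa using le_abs_self z.im)
  have := norm_add_le (Complex.exp (z * Complex.I)) (Complex.exp (-z * Complex.I))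
  rw [Complex.norm_ofNat]
  linarith

theorem Complex.norm_sin_le_exp (z : ℂ) : ‖Complex.sin z‖ ≤ Real.exp |z.im| := by
  rw [← Complex.cos_sub_pi_div_two]
  refine (Complex.norm_cos_le_exp _).trans (le_of_eq ?_)
  rw [Complex.sub_im]
  congr 2
  rw [show (Real.pi / 2 : ℂ) = ((Real.pi / 2 : ℝ) : ℂ) by push_cast; rfl, Complex.ofReal_im,
    sub_zero]

/-- Cauchy's estimate for the holomorphic extension of the modulated generator. The radius stays
free: a larger circle costs more through the complex sine or cosine, a smaller one through `ρ^{-m}`,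
and the best balance depends on l. -/
theorem wilson1_smooth_and_bound {ψ : ℝ → ℝ} (hψ : IsWilsonGenerator ψ) :
    (∀ l n, ContDiff ℝ ∞ fun x => (wilson1 ψ l n x : ℂ)) ∧
    ∃ a r C : ℝ, 0 < a ∧ 0 < r ∧ 0 < C ∧ ∀ (l : ℕ) (n : ℤ) (ρ : ℝ), 0 < ρ → ρ ≤ r →
      ∀ (m : ℕ) (x : ℝ), ‖iteratedDeriv m (fun x => (wilson1 ψ l n x : ℂ)) x‖ ≤
        C * Real.exp (2 * Real.pi * l * ρ) * Real.exp (-a * |x - wilsonCenter l n|) *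
          (m.factorial / ρ ^ m) := by
  obtain ⟨F, r, a, M, hr, ha, hM, hF, hFψ, hFM⟩ := exists_holomorphic_extension_exp_decay hψ
  have hmaps : ∀ (c : ℝ), Set.MapsTo (fun z : ℂ => z - (c : ℂ)) {z | |z.im| < r}
      {z | |z.im| < r} := fun c z hz => by simpa using hz
  have hshift : ∀ c : ℝ, DifferentiableOn ℂ (fun z => F (z - c)) {z | |z.im| < r} := fun c =>
    hF.comp (by fun_prop) (hmaps c)
  have key : ∀ (l : ℕ) (n : ℤ), ∃ G : ℂ → ℂ, DifferentiableOn ℂ G {z | |z.im| < r} ∧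
      (∀ x : ℝ, (wilson1 ψ l n x : ℂ) = G x) ∧ ∀ (ρ : ℝ), ρ < r → ∀ z : ℂ, |z.im| ≤ ρ →
        ‖G z‖ ≤ √2 * Real.exp (2 * Real.pi * l * ρ) * M *
          Real.exp (-a * |z.re - wilsonCenter l n|) := by
    intro l n
    have htrig : ∀ (t : ℂ → ℂ), (∀ z, ‖t z‖ ≤ Real.exp |z.im|) → ∀ (ρ : ℝ), ρ < r → ∀ z : ℂ,
        |z.im| ≤ ρ → ‖(√2 : ℂ) * t (2 * Real.pi * l * z) * F (z - ((n / 2 : ℝ) : ℂ))‖ ≤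
        √2 * Real.exp (2 * Real.pi * l * ρ) * M * Real.exp (-a * |z.re - n / 2|) := by
      intro t ht ρ hρ z hz
      rw [norm_mul, norm_mul, Complex.norm_real, Real.norm_of_nonneg (Real.sqrt_nonneg _),
        mul_assoc (√2 * _) M]
      have h1 := hFM (z - ((n / 2 : ℝ) : ℂ)) (by simpa using hz.trans_lt hρ)
      rw [Complex.sub_re, Complex.ofReal_re] at h1
      gcongr
      refine (ht _).trans (Real.exp_le_exp.2 ?_)
      rw [show (2 * Real.pi * l * z : ℂ) = ((2 * Real.pi * l : ℝ) : ℂ) * z by push_cast; ring,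
        Complex.im_ofReal_mul, abs_mul, abs_of_nonneg (by positivity)]
      gcongr
    unfold wilson1 wilsonCenter
    by_cases hl : l = 0
    · refine ⟨fun z => F (z - (n : ℝ)), hshift n, fun x => ?_, fun ρ hρ z hz => ?_⟩
      · simp only [hl, if_true]
        rw [← hFψ]; push_cast; rfl
      · simp only [hl, if_true]
        have h1 := hFM (z - ((n : ℝ) : ℂ)) (by simpa using hz.trans_lt hρ)
        rw [Complex.sub_re, Complex.ofReal_re] at h1
        refine h1.trans ?_
        have : (1 : ℝ) ≤ √2 := Real.one_le_sqrt.2 (by norm_num)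
        simp only [CharP.cast_eq_zero, mul_zero, zero_mul, Real.exp_zero, mul_one]
        gcongr
        nlinarith
    · simp only [hl, if_false]
      by_cases he : Even ((l : ℤ) + n)
      · simp only [he, if_true]
        refine ⟨fun z => (√2 : ℂ) * Complex.cos (2 * Real.pi * l * z) * F (z - ((n / 2 : ℝ) : ℂ)),
          (Differentiable.differentiableOn (by fun_prop)).mul (hshift _), fun x => ?_,
          htrig _ Complex.norm_cos_le_exp⟩
        beta_reduce
        rw [← Complex.ofReal_sub, hFψ]
        push_cast
        rfl
      · simp only [he, if_false]
        refine ⟨fun z => (√2 : ℂ) * Complex.sin (2 * Real.pi * l * z) * F (z - ((n / 2 : ℝ) : ℂ)),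
          (Differentiable.differentiableOn (by fun_prop)).mul (hshift _), fun x => ?_,
          htrig _ Complex.norm_sin_le_exp⟩
        beta_reduce
        rw [← Complex.ofReal_sub, hFψ]
        push_cast
        rfl
  refine ⟨fun l n => ?_, a, r / 2, Real.exp (a * r) * √2 * M, ha, half_pos hr, by positivity,
    fun l n ρ hρ hρr m x => ?_⟩
  · obtain ⟨G, hG, hgG, -⟩ := key l n
    exact (contDiff_and_iteratedDeriv_of_differentiableOn hr hG hgG).1
  · obtain ⟨G, hG, hgG, hGb⟩ := key l n
    rw [(contDiff_and_iteratedDeriv_of_differentiableOn hr hG hgG).2]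
    have hρr' : ρ < r := by linarith
    refine (norm_iteratedDeriv_le_of_strip hρ hρr' ha.le (by positivity) hG
      (hGb ρ hρr') m x).trans (le_of_eq ?_)
    ring

theorem abs_wilsonCenter_le (l : ℕ) (n : ℤ) : |wilsonCenter l n| ≤ |(n : ℝ)| := by
  unfold wilsonCenter
  split_ifs
  · exact le_rfl
  · rw [abs_div, Nat.abs_ofNat]
    exact half_le_self (abs_nonneg _)

theorem abs_le_two_mul_abs_wilsonCenter (l : ℕ) (n : ℤ) :
    |(n : ℝ)| ≤ 2 * |wilsonCenter l n| := by
  unfold wilsonCenter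
  split_ifs
  · linarith [abs_nonneg (n : ℝ)]
  · rw [abs_div, Nat.abs_ofNat]; linarith

/-- The one-dimensional weight `|n|^{1/s} + l^{1/s}`. -/
def wilsonWeight1 (s : ℝ) (l : ℕ) (n : ℤ) : ℝ := |(n : ℝ)| ^ (1 / s) + (l : ℝ) ^ (1 / s)

theorem wilsonWeight1_nonneg (s : ℝ) (l : ℕ) (n : ℤ) : 0 ≤ wilsonWeight1 s l n := by
  unfold wilsonWeight1; positivity

/-- Subadditivity of the power 1/s moves the stretched exponential from x to p, and the decay in x -
p absorbs the difference. -/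
theorem exists_pow_mul_exp_neg_le {s a c : ℝ} (hs : 1 < s) (ha : 0 < a) (hc : 0 < c) :
    ∃ C : ℝ, 0 < C ∧ ∀ (α : ℕ) (x p : ℝ), |x| ^ α * Real.exp (-a * |x - p|) ≤
      C * ((c ^ (-s)) ^ α * (α.factorial : ℝ) ^ s) * Real.exp (s * c * |p| ^ (1 / s)) := by
  have hs0 : 0 < s := by linarith
  obtain ⟨C, -, hC⟩ := exists_rpow_le_linear (ε := s * c) hs (by positivity) ha
  refine ⟨Real.exp C, Real.exp_pos _, fun α x p => ?_⟩
  have h1 := pow_le_factorial_rpow_mul_exp hs0 hc (abs_nonneg x) α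
  have h2 := hC _ (abs_nonneg (x - p))
  have h3 : |x| ^ (1 / s) ≤ |x - p| ^ (1 / s) + |p| ^ (1 / s) := by
    simpa using abs_rpow_add_le hs (x - p) p
  calc |x| ^ α * Real.exp (-a * |x - p|)
      ≤ (α.factorial : ℝ) ^ s * (c ^ (-s)) ^ α * Real.exp (s * c * |x| ^ (1 / s)) *
          Real.exp (-a * |x - p|) := by gcongr
    _ = (α.factorial : ℝ) ^ s * (c ^ (-s)) ^ α *
          Real.exp (s * c * |x| ^ (1 / s) + -a * |x - p|) := by rw [Real.exp_add]; ring
    _ ≤ (α.factorial : ℝ) ^ s * (c ^ (-s)) ^ α *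
          Real.exp (C + s * c * |p| ^ (1 / s)) := by
        refine mul_le_mul_of_nonneg_left (Real.exp_le_exp.2 ?_) (by positivity)
        have := mul_le_mul_of_nonneg_left h3 (by positivity : 0 ≤ s * c)
        linarith
    _ = _ := by rw [Real.exp_add]; ring

/-- The balance of radii. With `t = l^{1/s}` and `q = t^{s-1}`, so that l = tq, the radius `r/(1 +
Mq)` makes `lρ ≤ (r/M) t`, while `ρ^{-1/(s-1)}` is bounded by a multiple of 1 + t. Hence `ρ^{-β}`
costs `β!^{s-1}`, a geometric factor and an exponential of t. Large M and then small c make the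
total rate small. -/
theorem exists_radius_bound {s r M c : ℝ} (hs : 1 < s) (hr : 0 < r) (hM : 0 < M) (hc : 0 < c) :
    ∃ C : ℝ, 0 < C ∧ ∀ l : ℕ, ∃ ρ : ℝ, 0 < ρ ∧ ρ ≤ r ∧ ∀ β : ℕ,
      Real.exp (2 * Real.pi * l * ρ) * (β.factorial / ρ ^ β) ≤
        C * ((c ^ (-(s - 1))) ^ β * (β.factorial : ℝ) ^ s) *
          Real.exp ((2 * Real.pi * r / M + (s - 1) * c * (r⁻¹ * (1 + M)) ^ (1 / (s - 1))) *
            (l : ℝ) ^ (1 / s)) := by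
  have hs0 : 0 < s := by linarith
  have hs1 : 0 < s - 1 := by linarith
  set K := (r⁻¹ * (1 + M)) ^ (1 / (s - 1)) with hK
  have hK0 : 0 ≤ K := by positivity
  refine ⟨Real.exp ((s - 1) * c * K), Real.exp_pos _, fun l => ?_⟩
  set t : ℝ := (l : ℝ) ^ (1 / s) with ht
  have ht0 : 0 ≤ t := by positivity
  have hlt : (l : ℝ) = t * t ^ (s - 1) := by
    rw [ht, ← Real.rpow_mul (by positivity)]
    rcases Nat.eq_zero_or_pos l with rfl | hl
    · rw [Nat.cast_zero, Real.zero_rpow (by positivity), zero_mul]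
    · have hl' : (0 : ℝ) < l := by exact_mod_cast hl
      rw [← Real.rpow_add hl', show 1 / s + 1 / s * (s - 1) = 1 by field_simp; ring, Real.rpow_one]
  set q : ℝ := t ^ (s - 1) with hq
  have hq0 : 0 ≤ q := by positivity
  have hden : 0 < 1 + M * q := by positivity
  have hρ : 0 < r / (1 + M * q) := by positivity
  refine ⟨r / (1 + M * q), hρ, div_le_self hr.le (by nlinarith [mul_nonneg hM.le hq0]),
    fun β => ?_⟩
  have h1 : 2 * Real.pi * l * (r / (1 + M * q)) ≤ 2 * Real.pi * r / M * t := by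
    rw [hlt]
    have : q / (1 + M * q) ≤ 1 / M := by
      rw [div_le_div_iff₀ hden hM]; linarith
    calc 2 * Real.pi * (t * q) * (r / (1 + M * q)) = 2 * Real.pi * t * r * (q / (1 + M * q)) := by
          ring
      _ ≤ 2 * Real.pi * t * r * (1 / M) := by gcongr
      _ = _ := by ring
  set y : ℝ := (r / (1 + M * q))⁻¹ with hy
  have hy0 : 0 ≤ y := by positivity
  have hyK : y ^ (1 / (s - 1)) ≤ K * (1 + t) := by
    have e1 : y ≤ r⁻¹ * (1 + M) * (1 + t) ^ (s - 1) := by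
      have e2 : 1 ≤ (1 + t) ^ (s - 1) := Real.one_le_rpow (by linarith) hs1.le
      have e3 : q ≤ (1 + t) ^ (s - 1) := Real.rpow_le_rpow ht0 (by linarith) hs1.le
      rw [hy, inv_div, div_eq_inv_mul, mul_assoc]
      gcongr
      nlinarith
    have := Real.rpow_le_rpow hy0 e1 (by positivity : 0 ≤ 1 / (s - 1))
    rwa [Real.mul_rpow (by positivity) (by positivity), ← Real.rpow_mul (by positivity),
      mul_one_div_cancel hs1.ne', Real.rpow_one] at this
  have h2 := pow_le_factorial_rpow_mul_exp hs1 hc hy0 β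
  have hf : (0 : ℝ) < β.factorial := by exact_mod_cast β.factorial_pos
  calc Real.exp (2 * Real.pi * l * (r / (1 + M * q))) *
        (β.factorial / (r / (1 + M * q)) ^ β)
      = Real.exp (2 * Real.pi * l * (r / (1 + M * q))) * (β.factorial * y ^ β) := by
        rw [hy, inv_pow, div_eq_mul_inv (β.factorial : ℝ)]
    _ ≤ Real.exp (2 * Real.pi * r / M * t) * (β.factorial *
        ((β.factorial : ℝ) ^ (s - 1) * (c ^ (-(s - 1))) ^ β *
          Real.exp ((s - 1) * c * (K * (1 + t))))) := by
        gcongr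
        refine h2.trans ?_
        gcongr
    _ = ((c ^ (-(s - 1))) ^ β * ((β.factorial : ℝ) ^ (s - 1) * (β.factorial : ℝ) ^ (1 : ℝ))) *
        (Real.exp (2 * Real.pi * r / M * t) * Real.exp ((s - 1) * c * (K * (1 + t)))) := by
        rw [Real.rpow_one]; ring
    _ = ((c ^ (-(s - 1))) ^ β * (β.factorial : ℝ) ^ s) *
        (Real.exp ((s - 1) * c * K) *
          Real.exp ((2 * Real.pi * r / M + (s - 1) * c * K) * t)) := by
        rw [← Real.rpow_add hf, ← Real.exp_add, ← Real.exp_add]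
        congr 1
        · congr 2; ring
        · congr 1; ring
    _ = _ := by ring

/-- The parameters remain independent so that the rates can be made small at the price of the step,
or the step small at the price of the rates. -/
theorem wilson1_weighted_bound {s : ℝ} (hs : 1 < s) {ψ : ℝ → ℝ} (hψ : IsWilsonGenerator ψ) :
    ∃ r : ℝ, 0 < r ∧ ∀ M c c' : ℝ, 0 < M → 0 < c → 0 < c' → ∃ C : ℝ, 0 < C ∧
      ∀ (l : ℕ) (n : ℤ) (α β : ℕ) (x : ℝ),
        |x| ^ α * ‖iteratedDeriv β (fun x => (wilson1 ψ l n x : ℂ)) x‖ ≤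
          C * (((c ^ (-s)) ^ α * (α.factorial : ℝ) ^ s) *
            ((c' ^ (-(s - 1))) ^ β * (β.factorial : ℝ) ^ s)) *
            Real.exp (s * c * |(n : ℝ)| ^ (1 / s) +
              (2 * Real.pi * r / M + (s - 1) * c' * (r⁻¹ * (1 + M)) ^ (1 / (s - 1))) *
                (l : ℝ) ^ (1 / s)) := by
  have hs0 : 0 < s := by linarith
  obtain ⟨-, a, r, C₀, ha, hr, hC₀, hb⟩ := wilson1_smooth_and_bound hψ
  refine ⟨r, hr, fun M c c' hM hc hc' => ?_⟩
  obtain ⟨C₁, hC₁, h1⟩ := exists_pow_mul_exp_neg_le hs ha hc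
  obtain ⟨C₂, hC₂, h2⟩ := exists_radius_bound hs hr hM hc'
  refine ⟨C₀ * C₁ * C₂, by positivity, fun l n α β x => ?_⟩
  obtain ⟨ρ, hρ, hρr, hβ⟩ := h2 l
  have h3 := hb l n ρ hρ hρr β x
  have h4 := h1 α x (wilsonCenter l n)
  have h5 := hβ β
  have h6 : Real.exp (s * c * |wilsonCenter l n| ^ (1 / s)) ≤
      Real.exp (s * c * |(n : ℝ)| ^ (1 / s)) := by
    refine Real.exp_le_exp.2 (mul_le_mul_of_nonneg_left ?_ (by positivity))
    exact Real.rpow_le_rpow (abs_nonneg _) (abs_wilsonCenter_le l n) (by positivity)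
  rw [Real.exp_add]
  generalize Real.exp ((2 * Real.pi * r / M + (s - 1) * c' * (r⁻¹ * (1 + M)) ^ (1 / (s - 1))) *
    (l : ℝ) ^ (1 / s)) = E at *
  calc _ ≤ |x| ^ α * (C₀ * Real.exp (2 * Real.pi * l * ρ) *
        Real.exp (-a * |x - wilsonCenter l n|) * (β.factorial / ρ ^ β)) := by gcongr
    _ = C₀ * (|x| ^ α * Real.exp (-a * |x - wilsonCenter l n|)) *
        (Real.exp (2 * Real.pi * l * ρ) * (β.factorial / ρ ^ β)) := by ring
    _ ≤ C₀ * (C₁ * ((c ^ (-s)) ^ α * (α.factorial : ℝ) ^ s) *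
        Real.exp (s * c * |(n : ℝ)| ^ (1 / s))) *
        (C₂ * ((c' ^ (-(s - 1))) ^ β * (β.factorial : ℝ) ^ s) * E) := by
        refine mul_le_mul (mul_le_mul_of_nonneg_left (h4.trans ?_) hC₀.le) h5 (by positivity)
          (by positivity)
        gcongr
    _ = _ := by ring

theorem wilson1_bound_aux {s c c' k A B ε : ℝ} (hc : 0 < c) (hc' : 0 < c') (h1 : c ^ (-s) ≤ k)
    (h2 : c' ^ (-(s - 1)) ≤ k) (hA : A ≤ ε) (hB : B ≤ ε) (l : ℕ) (n : ℤ) (α β : ℕ) :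
    (((c ^ (-s)) ^ α * (α.factorial : ℝ) ^ s) *
      ((c' ^ (-(s - 1))) ^ β * (β.factorial : ℝ) ^ s)) *
      Real.exp (A * |(n : ℝ)| ^ (1 / s) + B * (l : ℝ) ^ (1 / s)) ≤
    (k ^ (α + β) * ((α.factorial : ℝ) * β.factorial) ^ s) *
      Real.exp (ε * wilsonWeight1 s l n) := by
  have hk : 0 < k := (Real.rpow_pos_of_pos hc _).trans_le h1
  rw [Real.mul_rpow (by positivity) (by positivity), pow_add, wilsonWeight1, mul_add]
  calc _ ≤ ((k ^ α * (α.factorial : ℝ) ^ s) * (k ^ β * (β.factorial : ℝ) ^ s)) *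
      Real.exp (ε * |(n : ℝ)| ^ (1 / s) + ε * (l : ℝ) ^ (1 / s)) := by gcongr
    _ = _ := by ring

/-- For arbitrarily small exponential weights, the Wilson functions lie uniformly in some step. -/
theorem wilson1_bound_of_weight {s ε : ℝ} (hs : 1 < s) (hε : 0 < ε) {ψ : ℝ → ℝ}
    (hψ : IsWilsonGenerator ψ) : ∃ k₀ : ℝ, 0 < k₀ ∧ ∃ C : ℝ, 0 < C ∧ ∀ k, k₀ ≤ k →
      ∀ (l : ℕ) (n : ℤ) (α β : ℕ) (x : ℝ),
        |x| ^ α * ‖iteratedDeriv β (fun x => (wilson1 ψ l n x : ℂ)) x‖ ≤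
          C * (k ^ (α + β) * ((α.factorial : ℝ) * β.factorial) ^ s) *
            Real.exp (ε * wilsonWeight1 s l n) := by
  have hs0 : 0 < s := by linarith
  have hs1 : 0 < s - 1 := by linarith
  obtain ⟨r, hr, h⟩ := wilson1_weighted_bound hs hψ
  -- M makes the modulation contribute rate ε/2 in frequency; given M, the choice of `c'` makes the
  -- Cauchy radius contribute the other ε/2. The choice of c gives rate ε in translation.
  set M := 2 * Real.pi * r / (ε / 2) with hM
  have hM0 : 0 < M := by positivity
  set K := (r⁻¹ * (1 + M)) ^ (1 / (s - 1)) with hK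
  have hK0 : 0 < K := by positivity
  set c := ε / s
  set c' := ε / 2 / ((s - 1) * K)
  have hc : 0 < c := by positivity
  have hc' : 0 < c' := by positivity
  obtain ⟨C, hC, hb⟩ := h M c c' hM0 hc hc'
  refine ⟨max (c ^ (-s)) (c' ^ (-(s - 1))), lt_max_of_lt_left (Real.rpow_pos_of_pos hc _), C, hC,
    fun k hk l n α β x => (hb l n α β x).trans ?_⟩
  rw [mul_assoc, mul_assoc C]
  refine mul_le_mul_of_nonneg_left (wilson1_bound_aux hc hc' ((le_max_left _ _).trans hk)
    ((le_max_right _ _).trans hk) (le_of_eq ?_) (le_of_eq ?_) l n α β) hC.le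
  · simp only [c]; field_simp
  · rw [← hK]
    have e1 : 2 * Real.pi * r / M = ε / 2 := by rw [hM]; field_simp
    have e2 : (s - 1) * c' * K = ε / 2 := by simp only [c']; field_simp
    rw [e1, e2]; ring

/-- The Wilson functions lie in every step, with exponential growth in the index. -/
theorem wilson1_bound_of_step {s k : ℝ} (hs : 1 < s) (hk : 0 < k) {ψ : ℝ → ℝ}
    (hψ : IsWilsonGenerator ψ) : ∃ ε₀ : ℝ, 0 < ε₀ ∧ ∃ C : ℝ, 0 < C ∧ ∀ ε, ε₀ ≤ ε →
      ∀ (l : ℕ) (n : ℤ) (α β : ℕ) (x : ℝ),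
        |x| ^ α * ‖iteratedDeriv β (fun x => (wilson1 ψ l n x : ℂ)) x‖ ≤
          C * (k ^ (α + β) * ((α.factorial : ℝ) * β.factorial) ^ s) *
            Real.exp (ε * wilsonWeight1 s l n) := by
  have hs0 : 0 < s := by linarith
  have hs1 : 0 < s - 1 := by linarith
  obtain ⟨r, hr, h⟩ := wilson1_weighted_bound hs hψ
  -- These values make both geometric factors, `c^{-s}` and `c'^{-(s-1)}`, equal to k. The value of
  -- M is then immaterial and is taken to be 1.
  set c := k ^ (-(1 / s))
  set c' := k ^ (-(1 / (s - 1)))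
  have hc : 0 < c := Real.rpow_pos_of_pos hk _
  have hc' : 0 < c' := Real.rpow_pos_of_pos hk _
  obtain ⟨C, hC, hb⟩ := h 1 c c' one_pos hc hc'
  refine ⟨max (s * c)
    (2 * Real.pi * r / 1 + (s - 1) * c' * (r⁻¹ * (1 + 1)) ^ (1 / (s - 1))),
    lt_max_of_lt_left (by positivity), C, hC,
    fun ε hε l n α β x => (hb l n α β x).trans ?_⟩
  rw [mul_assoc, mul_assoc C]
  refine mul_le_mul_of_nonneg_left (wilson1_bound_aux hc hc' (le_of_eq ?_)
    (le_of_eq ?_) ((le_max_left _ _).trans hε) ((le_max_right _ _).trans hε) l n α β) hC.le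
  · simp only [c]
    rw [← Real.rpow_mul hk.le, show -(1 / s) * -s = 1 by field_simp, Real.rpow_one]
  · simp only [c']
    rw [← Real.rpow_mul hk.le, show -(1 / (s - 1)) * -(s - 1) = 1 by field_simp, Real.rpow_one]

/-! ### Tensor products -/

/-- The tensor product `x ↦ ∏ₖ uₖ(xₖ)`. -/
def tensorFun {d : ℕ} (u : Fin d → ℝ → ℂ) : EuclideanSpace ℝ (Fin d) → ℂ :=
  fun x => ∏ k, u k (x k)

theorem wilson_eq_tensorFun {d : ℕ} (ψ : Fin d → ℝ → ℝ) (i : (Fin d → ℕ) × (Fin d → ℤ)) :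
    wilson ψ i = tensorFun fun k x => (wilson1 (ψ k) (i.1 k) (i.2 k) x : ℂ) := by
  funext x
  simp [wilson, tensorFun]

theorem contDiff_tensorFun {d : ℕ} {u : Fin d → ℝ → ℂ} (hu : ∀ k, ContDiff ℝ ∞ (u k)) :
    ContDiff ℝ ∞ (tensorFun u) := by
  unfold tensorFun
  refine contDiff_prod fun k _ => (hu k).comp ?_
  exact (EuclideanSpace.proj (𝕜 := ℝ) k).contDiff

theorem partialDeriv_tensorFun {d : ℕ} {u : Fin d → ℝ → ℂ} (hu : ∀ k, ContDiff ℝ ∞ (u k))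
    (j : Fin d) : partialDeriv j (tensorFun u) =
      tensorFun (Function.update u j (deriv (u j))) := by
  funext x
  have h1 : ∀ k ∈ Finset.univ, HasFDerivAt (fun y : EuclideanSpace ℝ (Fin d) => u k (y k))
      ((fderiv ℝ (u k) (x k)).comp (EuclideanSpace.proj (𝕜 := ℝ) k)) x := fun k _ =>
    (((hu k).differentiable (by simp)) (x k)).hasFDerivAt.comp x
      (EuclideanSpace.proj (𝕜 := ℝ) k).hasFDerivAt
  have h2 := HasFDerivAt.finsetProd h1
  unfold partialDeriv tensorFun
  rw [h2.fderiv, sum_apply, Finset.sum_eq_single j]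
  · rw [← Finset.mul_prod_erase _ _ (Finset.mem_univ j), Function.update_self, mul_comm]
    simp only [smul_apply, ContinuousLinearMap.comp_apply, smul_eq_mul]
    congr 1
    · refine Finset.prod_congr rfl fun k hk => ?_
      rw [Function.update_of_ne (Finset.ne_of_mem_erase hk)]
    · simp
  · intro k _ hk
    simp [hk]
  · simp

theorem contDiff_iteratedDeriv_top {u : ℝ → ℂ} (hu : ContDiff ℝ ∞ u) (m : ℕ) :
    ContDiff ℝ ∞ (iteratedDeriv m u) := by
  rw [iteratedDeriv_eq_iterate]
  exact hu.iterate_deriv m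

theorem partialDeriv_iterate_tensorFun {d : ℕ} {u : Fin d → ℝ → ℂ}
    (hu : ∀ k, ContDiff ℝ ∞ (u k)) (j : Fin d) (m : ℕ) :
    (partialDeriv j)^[m] (tensorFun u) =
      tensorFun (Function.update u j (iteratedDeriv m (u j))) := by
  induction m with
  | zero => simp
  | succ m ih =>
    rw [Function.iterate_succ_apply', ih, partialDeriv_tensorFun]
    · simp [iteratedDeriv_succ]
    · intro k
      by_cases hk : k = j
      · subst hk; simpa using contDiff_iteratedDeriv_top (hu k) m
      · simpa [hk] using hu k

theorem multiDeriv_tensorFun {d : ℕ} {u : Fin d → ℝ → ℂ} (hu : ∀ k, ContDiff ℝ ∞ (u k))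
    (β : Fin d → ℕ) : multiDeriv β (tensorFun u) =
      tensorFun fun k => iteratedDeriv (β k) (u k) := by
  -- Generalized to partial lists: exactly the coordinates already visited have been differentiated,
  -- each once because the list has no duplicates.
  have : ∀ L : List (Fin d), L.Nodup →
      L.foldr (fun i g => (partialDeriv i)^[β i] g) (tensorFun u) =
        tensorFun fun k => if k ∈ L then iteratedDeriv (β k) (u k) else u k := by
    intro L hL
    induction L with
    | nil => simp
    | cons j L ih =>
      obtain ⟨hj, hL⟩ := List.nodup_cons.1 hL
      rw [List.foldr_cons, ih hL, partialDeriv_iterate_tensorFun]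
      · congr 1
        funext k
        by_cases hk : k = j
        · subst hk; simp [hj]
        · simp [hk]
      · intro k
        split_ifs
        exacts [contDiff_iteratedDeriv_top (hu k) _, hu k]
  unfold multiDeriv
  rw [this _ (List.nodup_finRange d)]
  simp

/-- The weight `∑ₖ (|nₖ|^{1/s} + lₖ^{1/s})`, equivalent to `(|n/2| + |l|)^{1/s}`. -/
def wilsonWeight {d : ℕ} (s : ℝ) (i : (Fin d → ℕ) × (Fin d → ℤ)) : ℝ :=
  ∑ k, wilsonWeight1 s (i.1 k) (i.2 k)

/-- For a tensor product both numerator and denominator of the quotient factor over the coordinates.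
-/
theorem gsQuotient_tensorFun_le {d : ℕ} {s k : ℝ} (hk : 0 < k) {u : Fin d → ℝ → ℂ}
    (hu : ∀ j, ContDiff ℝ ∞ (u j)) {A : Fin d → ℝ}
    (h : ∀ j (α β : ℕ) (x : ℝ), |x| ^ α * ‖iteratedDeriv β (u j) x‖ ≤
      A j * (k ^ (α + β) * ((α.factorial : ℝ) * β.factorial) ^ s))
    (p : (Fin d → ℕ) × (Fin d → ℕ) × EuclideanSpace ℝ (Fin d)) :
    gsQuotient s k (tensorFun u) p ≤ ∏ j, A j := by
  unfold gsQuotient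
  rw [div_le_iff₀ (gsQuotient_denom_pos s hk _ _), multiDeriv_tensorFun hu, tensorFun]
  rw [Complex.ofReal_prod, ← Finset.prod_mul_distrib, norm_prod]
  push_cast
  rw [← Finset.prod_mul_distrib, ← Real.finsetProd_rpow _ _ (fun j _ => by positivity),
    ← Finset.prod_pow_eq_pow_sum, ← Finset.prod_mul_distrib, ← Finset.prod_mul_distrib]
  refine Finset.prod_le_prod (fun j _ => norm_nonneg _) fun j _ => ?_
  simpa using h j (p.1 j) (p.2.1 j) (p.2.2 j)

theorem contDiff_wilson {d : ℕ} {ψ : Fin d → ℝ → ℝ} (hψ : ∀ k, IsWilsonGenerator (ψ k))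
    (i : (Fin d → ℕ) × (Fin d → ℤ)) : ContDiff ℝ ∞ (wilson ψ i) := by
  rw [wilson_eq_tensorFun]
  exact contDiff_tensorFun fun k => (wilson1_smooth_and_bound (hψ k)).1 _ _

/-- Uniform bounds for the Wilson functions on a fixed step. -/
def WilsonStepBound {d : ℕ} (ψ : Fin d → ℝ → ℝ) (s k ε C : ℝ) : Prop :=
  ∀ i, GSFinite s k (wilson ψ i) ∧ gsNorm s k (wilson ψ i) ≤ C * Real.exp (ε * wilsonWeight s i)

theorem wilsonStepBound_of_wilson1 {d : ℕ} {s k ε : ℝ} (hk : 0 < k) {ψ : Fin d → ℝ → ℝ}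
    (hψ : ∀ j, IsWilsonGenerator (ψ j)) {C : Fin d → ℝ}
    (h : ∀ j (l : ℕ) (n : ℤ) (α β : ℕ) (x : ℝ),
        |x| ^ α * ‖iteratedDeriv β (fun x => (wilson1 (ψ j) l n x : ℂ)) x‖ ≤
          C j * (k ^ (α + β) * ((α.factorial : ℝ) * β.factorial) ^ s) *
            Real.exp (ε * wilsonWeight1 s l n)) :
    WilsonStepBound ψ s k ε (∏ j, C j) := by
  intro i
  have key : ∀ p, gsQuotient s k (wilson ψ i) p ≤
      (∏ j, C j) * Real.exp (ε * wilsonWeight s i) := by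
    intro p
    rw [wilson_eq_tensorFun, wilsonWeight, Finset.mul_sum, Real.exp_sum, ← Finset.prod_mul_distrib]
    refine gsQuotient_tensorFun_le hk (fun j => (wilson1_smooth_and_bound (hψ j)).1 _ _)
      (fun j α β x => (h j _ _ α β x).trans (le_of_eq (by ring))) p
  exact ⟨⟨contDiff_wilson hψ i, _, Set.forall_mem_range.2 key⟩, ciSup_le key⟩

/-- The Roumieu order of quantifiers. All larger steps share the constant, so the step can later be
raised to one that also contains a given test function. -/
theorem exists_wilsonStepBound_of_weight {d : ℕ} {s ε : ℝ} (hs : 1 < s) (hε : 0 < ε)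
    {ψ : Fin d → ℝ → ℝ} (hψ : ∀ k, IsWilsonGenerator (ψ k)) :
    ∃ k₀ C : ℝ, 0 < k₀ ∧ 0 < C ∧ ∀ k, k₀ ≤ k → WilsonStepBound ψ s k ε C := by
  choose k₀ hk₀ C hC h using fun j => wilson1_bound_of_weight hs hε (hψ j)
  have h0 : 0 ≤ ∑ j, k₀ j := Finset.sum_nonneg fun j _ => (hk₀ j).le
  refine ⟨1 + ∑ j, k₀ j, ∏ j, C j, by linarith, Finset.prod_pos fun j _ => hC j, fun k hk =>
    wilsonStepBound_of_wilson1 (by linarith) hψ fun j => h j k ?_⟩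
  have := Finset.single_le_sum (fun j _ => (hk₀ j).le) (Finset.mem_univ j)
  linarith

/-- The Beurling order of quantifiers; it also shows that every Wilson function lies in all steps.
-/
theorem exists_wilsonStepBound_of_step {d : ℕ} {s k : ℝ} (hs : 1 < s) (hk : 0 < k)
    {ψ : Fin d → ℝ → ℝ} (hψ : ∀ k, IsWilsonGenerator (ψ k)) :
    ∃ ε C : ℝ, 0 < ε ∧ 0 < C ∧ WilsonStepBound ψ s k ε C := by
  choose ε₀ hε₀ C hC h using fun j => wilson1_bound_of_step hs hk (hψ j)
  have h0 : 0 ≤ ∑ j, ε₀ j := Finset.sum_nonneg fun j _ => (hε₀ j).le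
  refine ⟨1 + ∑ j, ε₀ j, ∏ j, C j, by linarith, Finset.prod_pos fun j _ => hC j,
    wilsonStepBound_of_wilson1 hk hψ fun j => h j _ ?_⟩
  have := Finset.single_le_sum (fun j _ => (hε₀ j).le) (Finset.mem_univ j)
  linarith

/-! ### Decay of one-dimensional Wilson coefficients -/

theorem wilson1_decay {ψ : ℝ → ℝ} (hψ : IsWilsonGenerator ψ) :
    ∃ a C : ℝ, 0 < a ∧ 0 < C ∧ ∀ (l : ℕ) (n : ℤ) (x : ℝ),
      |wilson1 ψ l n x| ≤ C * Real.exp (-a * |x - wilsonCenter l n|) := by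
  obtain ⟨a, C, ha, hC, h⟩ := hψ.decay
  have h1 : (1 : ℝ) ≤ √2 := Real.one_le_sqrt.2 (by norm_num)
  refine ⟨a, √2 * C, ha, by positivity, fun l n x => ?_⟩
  unfold wilson1 wilsonCenter
  have key : ∀ t : ℝ, |t| ≤ 1 → |√2 * t * ψ (x - n / 2)| ≤
      √2 * C * Real.exp (-a * |x - n / 2|) := fun t ht => by
    rw [abs_mul, abs_mul, abs_of_nonneg (Real.sqrt_nonneg 2)]
    calc √2 * |t| * |ψ (x - n / 2)| ≤ √2 * 1 * (C * Real.exp (-a * |x - n / 2|)) := by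
          gcongr
          exact h _
      _ = _ := by ring
  split_ifs
  · refine (h _).trans ?_
    gcongr
    nlinarith
  · exact key _ (Real.abs_cos_le_one _)
  · exact key _ (Real.abs_sin_le_one _)

theorem continuous_wilson1 {ψ : ℝ → ℝ} (hψ : IsWilsonGenerator ψ) (l : ℕ) (n : ℤ) :
    Continuous (wilson1 ψ l n) := by
  have := hψ.continuous
  unfold wilson1
  split_ifs <;> fun_prop

theorem integrable_exp_neg_mul_abs_sub {a : ℝ} (ha : 0 < a) (p : ℝ) :
    Integrable fun x : ℝ => Real.exp (-a * |x - p|) :=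
  (integrable_exp_neg_mul_abs ha).comp_sub_right p

theorem integral_exp_neg_mul_abs_sub (a p : ℝ) :
    ∫ x : ℝ, Real.exp (-a * |x - p|) = ∫ x : ℝ, Real.exp (-a * |x|) :=
  integral_sub_right_eq_self (fun x : ℝ => Real.exp (-a * |x|)) p

theorem integrable_wilson1 {ψ : ℝ → ℝ} (hψ : IsWilsonGenerator ψ) (l : ℕ) (n : ℤ) :
    Integrable (wilson1 ψ l n) := by
  obtain ⟨a, C, ha, hC, h⟩ := wilson1_decay hψ
  exact ((integrable_exp_neg_mul_abs_sub ha _).const_mul C).mono'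
    (continuous_wilson1 hψ l n).aestronglyMeasurable (.of_forall fun x => h l n x)

/-- The uniformity in l and n lets the remaining coordinates of a tensor product be integrated out
at bounded cost. -/
theorem exists_integral_abs_wilson1_le {ψ : ℝ → ℝ} (hψ : IsWilsonGenerator ψ) :
    ∃ A : ℝ, 0 < A ∧ ∀ l n, ∫ x, |wilson1 ψ l n x| ≤ A := by
  obtain ⟨a, C, ha, hC, h⟩ := wilson1_decay hψ
  have h0 : 0 ≤ ∫ x : ℝ, Real.exp (-a * |x|) := integral_nonneg fun x => (Real.exp_pos _).le
  refine ⟨C * (∫ x : ℝ, Real.exp (-a * |x|)) + 1, by positivity, fun l n => ?_⟩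
  calc ∫ x, |wilson1 ψ l n x| ≤ ∫ x : ℝ, C * Real.exp (-a * |x - wilsonCenter l n|) :=
        integral_mono (integrable_wilson1 hψ l n).abs
          ((integrable_exp_neg_mul_abs_sub ha _).const_mul C) fun x => h l n x
    _ = C * ∫ x : ℝ, Real.exp (-a * |x|) := by
        rw [integral_const_mul, integral_exp_neg_mul_abs_sub]
    _ ≤ _ := by linarith

theorem half_mul_rpow_le {s x : ℝ} (hs : 1 < s) (hx : 0 ≤ x) :
    (2 * x) ^ (1 / s) ≤ 2 * x ^ (1 / s) := by
  rw [Real.mul_rpow (by norm_num) hx]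
  gcongr
  calc (2 : ℝ) ^ (1 / s) ≤ 2 ^ (1 : ℝ) :=
        Real.rpow_le_rpow_of_exponent_le (by norm_num) ((div_le_one (by linarith)).2 hs.le)
    _ = 2 := Real.rpow_one 2

/-- Decay of Wilson coefficients in the translation index. -/
theorem exists_wilson1_coeff_translation {s k : ℝ} (hs : 1 < s) (hk : 0 < k) {ψ : ℝ → ℝ}
    (hψ : IsWilsonGenerator ψ) : ∃ C : ℝ, 0 < C ∧ ∀ (u : ℝ → ℂ) (N : ℝ), 0 ≤ N →
      (∀ (j : ℕ) (x : ℝ), |x| ^ j * ‖u x‖ ≤ N * (k ^ j * (j.factorial : ℝ) ^ s)) →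
      ∀ (l : ℕ) (n : ℤ), ‖∫ x, (wilson1 ψ l n x : ℂ) * u x‖ ≤
        C * N * Real.exp (-(s / (4 * k ^ (1 / s))) * |(n : ℝ)| ^ (1 / s)) := by
  have hs0 : 0 < s := by linarith
  obtain ⟨a, A, ha, hA, hdec⟩ := wilson1_decay hψ
  set δ := s / (2 * k ^ (1 / s)) with hδ
  have hδ0 : 0 < δ := by positivity
  -- Half of the exponential decay transfers the weight from x to the centre p; the other half keeps
  -- the integrand integrable.
  obtain ⟨C₁, -, hC₁⟩ := exists_rpow_le_linear hs hδ0.le (half_pos ha)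
  have hI : 0 ≤ ∫ x : ℝ, Real.exp (-(a / 2) * |x|) := integral_nonneg fun x => (Real.exp_pos _).le
  refine ⟨A * (2 ^ s) * Real.exp C₁ * ((∫ x : ℝ, Real.exp (-(a / 2) * |x|)) + 1), by positivity,
    fun u N hN hu l n => ?_⟩
  set p := wilsonCenter l n with hp
  have hpt : ∀ x, ‖(wilson1 ψ l n x : ℂ) * u x‖ ≤
      A * (2 ^ s) * Real.exp C₁ * N * Real.exp (-δ * |p| ^ (1 / s)) *
        Real.exp (-(a / 2) * |x - p|) := by
    intro x
    have h1 := le_exp_neg_of_forall_pow_mul_le hs0 hk (abs_nonneg x) (norm_nonneg (u x)) hN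
      (fun j => hu j x)
    have h2 := hdec l n x
    have h3 : |p| ^ (1 / s) ≤ |x| ^ (1 / s) + |x - p| ^ (1 / s) := by
      have := abs_rpow_add_le hs x (p - x)
      rwa [add_sub_cancel, abs_sub_comm p x] at this
    have h4 := hC₁ _ (abs_nonneg (x - p))
    rw [norm_mul, Complex.norm_real, Real.norm_eq_abs]
    calc |wilson1 ψ l n x| * ‖u x‖ ≤ A * Real.exp (-a * |x - p|) *
          (2 ^ s * N * Real.exp (-δ * |x| ^ (1 / s))) := by gcongr
      _ = A * 2 ^ s * N * Real.exp (-a * |x - p| + -δ * |x| ^ (1 / s)) := by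
          rw [Real.exp_add]; ring
      _ ≤ A * 2 ^ s * N * Real.exp (C₁ + -δ * |p| ^ (1 / s) + -(a / 2) * |x - p|) := by
          refine mul_le_mul_of_nonneg_left (Real.exp_le_exp.2 ?_) (by positivity)
          have := mul_le_mul_of_nonneg_left h3 hδ0.le
          linarith
      _ = _ := by rw [Real.exp_add, Real.exp_add]; ring
  have hδp : -δ * |p| ^ (1 / s) ≤ -(s / (4 * k ^ (1 / s))) * |(n : ℝ)| ^ (1 / s) := by
    have e1 : |(n : ℝ)| ^ (1 / s) ≤ 2 * |p| ^ (1 / s) :=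
      (Real.rpow_le_rpow (abs_nonneg _) (abs_le_two_mul_abs_wilsonCenter l n)
        (by positivity)).trans (half_mul_rpow_le hs (abs_nonneg p))
    have e2 : s / (4 * k ^ (1 / s)) = δ / 2 := by rw [hδ]; field_simp; norm_num
    rw [e2]
    nlinarith
  calc _ ≤ ∫ x : ℝ, A * (2 ^ s) * Real.exp C₁ * N * Real.exp (-δ * |p| ^ (1 / s)) *
        Real.exp (-(a / 2) * |x - p|) :=
        norm_integral_le_of_norm_le
          ((integrable_exp_neg_mul_abs_sub (half_pos ha) p).const_mul _) (.of_forall hpt)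
    _ = A * (2 ^ s) * Real.exp C₁ * (∫ x : ℝ, Real.exp (-(a / 2) * |x|)) * N *
          Real.exp (-δ * |p| ^ (1 / s)) := by
        rw [integral_const_mul, integral_exp_neg_mul_abs_sub]; ring
    _ ≤ _ := by
        gcongr
        linarith

/-- By Leibniz. The generator, being analytic, satisfies Gevrey bounds of the same step k as u; the
binomial coefficients sum to `2^m`, which doubles the step. -/
theorem exists_norm_iteratedDeriv_mul_le {s k : ℝ} (hs : 1 < s) (hk : 0 < k) {ψ : ℝ → ℝ}
    (hψ : IsWilsonGenerator ψ) : ∃ a C : ℝ, 0 < a ∧ 0 < C ∧ ∀ (u : ℝ → ℂ) (N c : ℝ), 0 ≤ N →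
      ContDiff ℝ ∞ u →
      (∀ (j : ℕ) (x : ℝ), ‖iteratedDeriv j u x‖ ≤ N * (k ^ j * (j.factorial : ℝ) ^ s)) →
      ContDiff ℝ ∞ (fun x => (ψ (x - c) : ℂ) * u x) ∧ ∀ (m : ℕ) (x : ℝ),
        ‖iteratedDeriv m (fun x => (ψ (x - c) : ℂ) * u x) x‖ ≤
          C * N * ((2 * k) ^ m * (m.factorial : ℝ) ^ s) * Real.exp (-a * |x - c|) := by
  obtain ⟨hsm, a, r, C₀, ha, hr, hC₀, hb⟩ := wilson1_smooth_and_bound hψ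
  obtain ⟨C₁, hC₁, h1⟩ := exists_pow_mul_factorial_le hs (inv_pos.2 hr).le hk
  have hψ0 : (fun x => (wilson1 ψ 0 0 x : ℂ)) = fun x => (ψ x : ℂ) := by
    funext x; simp [wilson1]
  have hψs : ContDiff ℝ ∞ fun x => (ψ x : ℂ) := hψ0 ▸ hsm 0 0
  have hψb : ∀ (i : ℕ) (x : ℝ), ‖iteratedDeriv i (fun x => (ψ x : ℂ)) x‖ ≤
      C₀ * C₁ * (k ^ i * (i.factorial : ℝ) ^ s) * Real.exp (-a * |x|) := fun i x => by
    have h2 := hb 0 0 r hr le_rfl i x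
    rw [hψ0] at h2
    simp only [wilsonCenter, if_true, Int.cast_zero, sub_zero, CharP.cast_eq_zero, mul_zero,
      zero_mul, Real.exp_zero, mul_one] at h2
    have h3 := h1 i
    rw [inv_pow, mul_comm, ← div_eq_mul_inv] at h3
    calc _ ≤ C₀ * Real.exp (-a * |x|) * (i.factorial / r ^ i) := h2
      _ ≤ C₀ * Real.exp (-a * |x|) * (C₁ * (k ^ i * (i.factorial : ℝ) ^ s)) := by gcongr
      _ = _ := by ring
  refine ⟨a, C₀ * C₁, ha, by positivity, fun u N c hN hu hub => ?_⟩
  have hfs : ContDiff ℝ ∞ fun x => (ψ (x - c) : ℂ) := hψs.comp (contDiff_id.sub contDiff_const)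
  refine ⟨hfs.mul hu, fun m x => ?_⟩
  rw [← norm_iteratedFDeriv_eq_norm_iteratedDeriv]
  refine (norm_iteratedFDeriv_mul_le hfs hu x (n := m) (by exact_mod_cast le_top)).trans ?_
  have hterm : ∀ i ∈ Finset.range (m + 1),
      (m.choose i : ℝ) * ‖iteratedFDeriv ℝ i (fun x => (ψ (x - c) : ℂ)) x‖ *
        ‖iteratedFDeriv ℝ (m - i) u x‖ ≤ (m.choose i : ℝ) *
          (C₀ * C₁ * N * (k ^ m * (m.factorial : ℝ) ^ s) * Real.exp (-a * |x - c|)) := by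
    intro i hi
    have him : i ≤ m := Nat.lt_succ_iff.1 (Finset.mem_range.1 hi)
    rw [norm_iteratedFDeriv_eq_norm_iteratedDeriv, norm_iteratedFDeriv_eq_norm_iteratedDeriv,
      iteratedDeriv_comp_sub_const i (fun x => (ψ x : ℂ)) c, mul_assoc]
    refine mul_le_mul_of_nonneg_left ?_ (Nat.cast_nonneg _)
    have hfac : (i.factorial : ℝ) ^ s * ((m - i).factorial : ℝ) ^ s ≤ (m.factorial : ℝ) ^ s := by
      rw [← Real.mul_rpow (by positivity) (by positivity)]
      refine Real.rpow_le_rpow (by positivity) ?_ (by linarith)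
      exact_mod_cast Nat.le_of_dvd m.factorial_pos
        (Nat.factorial_mul_factorial_dvd_factorial him)
    calc _ ≤ (C₀ * C₁ * (k ^ i * (i.factorial : ℝ) ^ s) * Real.exp (-a * |x - c|)) *
          (N * (k ^ (m - i) * ((m - i).factorial : ℝ) ^ s)) :=
          mul_le_mul (hψb i _) (hub _ x) (norm_nonneg _) (by positivity)
      _ = C₀ * C₁ * N * ((k ^ i * k ^ (m - i)) *
          ((i.factorial : ℝ) ^ s * ((m - i).factorial : ℝ) ^ s)) * Real.exp (-a * |x - c|) := by
          ring
      _ ≤ C₀ * C₁ * N * ((k ^ i * k ^ (m - i)) * (m.factorial : ℝ) ^ s) *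
          Real.exp (-a * |x - c|) := by gcongr
      _ = _ := by rw [← pow_add, Nat.add_sub_cancel' him]
  refine (Finset.sum_le_sum hterm).trans (le_of_eq ?_)
  rw [← Finset.sum_mul, ← Nat.cast_sum, Nat.sum_range_choose, mul_pow]
  push_cast
  ring

/-- Decay of Wilson coefficients in the frequency index. -/
theorem exists_wilson1_coeff_frequency {s k : ℝ} (hs : 1 < s) (hk : 0 < k) {ψ : ℝ → ℝ}
    (hψ : IsWilsonGenerator ψ) : ∃ C : ℝ, 0 < C ∧ ∀ (u : ℝ → ℂ) (N : ℝ), 0 ≤ N →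
      ContDiff ℝ ∞ u →
      (∀ (j : ℕ) (x : ℝ), ‖iteratedDeriv j u x‖ ≤ N * (k ^ j * (j.factorial : ℝ) ^ s)) →
      ∀ (l : ℕ) (n : ℤ), l ≠ 0 → ‖∫ x, (wilson1 ψ l n x : ℂ) * u x‖ ≤
        C * N * Real.exp (-(s / (4 * k ^ (1 / s))) * (l : ℝ) ^ (1 / s)) := by
  have hs0 : 0 < s := by linarith
  obtain ⟨a, A, ha, hA, hb⟩ := exists_norm_iteratedDeriv_mul_le hs hk hψ
  set I := ∫ x : ℝ, Real.exp (-a * |x|) with hI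
  have hI0 : 0 ≤ I := integral_nonneg fun x => (Real.exp_pos _).le
  refine ⟨√2 * (2 ^ s * (A * (I + 1))), by positivity, fun u N hN hu hub l n hl => ?_⟩
  obtain ⟨hvs, hvb⟩ := hb u N (n / 2) hN hu hub
  set v : ℝ → ℂ := fun x => (ψ (x - n / 2) : ℂ) * u x with hv
  have hvi : ∀ m : ℕ, Integrable (iteratedDeriv m v) := fun m =>
    ((integrable_exp_neg_mul_abs_sub ha (n / 2)).const_mul _).mono'
      (contDiff_iteratedDeriv_top hvs m).continuous.aestronglyMeasurable (.of_forall (hvb m))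
  have hF : ∀ ξ : ℝ, |ξ| = l → ‖𝓕 v ξ‖ ≤ 2 ^ s * (A * (I + 1)) * N *
      Real.exp (-(s / (4 * k ^ (1 / s))) * (l : ℝ) ^ (1 / s)) := by
    -- Integrating by parts m times bounds `|2πξ|^m` times the transform by the `L¹` norm of the
    -- m-th derivative. Holding for all m, these bounds give stretched exponential decay in l.
    intro ξ hξ
    have h1 : ∀ m : ℕ, (l : ℝ) ^ m * ‖𝓕 v ξ‖ ≤
        (A * (I + 1) * N) * ((2 * k) ^ m * (m.factorial : ℝ) ^ s) := by
      intro m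
      have e1 : 𝓕 (iteratedDeriv m v) ξ = (2 * Real.pi * Complex.I * ξ) ^ m • 𝓕 v ξ := by
        have := Real.fourier_iteratedDeriv (N := ⊤) (n := m) hvs (fun n _ => hvi n) le_top
        exact congrFun this ξ
      have e2 : ‖𝓕 (iteratedDeriv m v) ξ‖ ≤ ∫ x, ‖iteratedDeriv m v x‖ :=
        VectorFourier.norm_fourierIntegral_le_integral_norm _ _ _ _ _
      have e3 : ∫ x, ‖iteratedDeriv m v x‖ ≤
          A * N * ((2 * k) ^ m * (m.factorial : ℝ) ^ s) * I := by
        rw [hI, ← integral_exp_neg_mul_abs_sub a (n / 2), ← integral_const_mul]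
        exact integral_mono (hvi m).norm
          ((integrable_exp_neg_mul_abs_sub ha (n / 2)).const_mul _) (hvb m)
      have e4 : ‖(2 * Real.pi * Complex.I * ξ : ℂ)‖ = 2 * Real.pi * l := by
        rw [← hξ]; simp [abs_of_pos Real.pi_pos]
      rw [e1, norm_smul, norm_pow, e4] at e2
      have e5 : (l : ℝ) ^ m ≤ (2 * Real.pi * l) ^ m := by
        gcongr
        have := Real.pi_gt_three
        nlinarith [Nat.cast_nonneg (α := ℝ) l]
      calc (l : ℝ) ^ m * ‖𝓕 v ξ‖ ≤ (2 * Real.pi * l) ^ m * ‖𝓕 v ξ‖ := by gcongr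
        _ ≤ A * N * ((2 * k) ^ m * (m.factorial : ℝ) ^ s) * I := e2.trans e3
        _ ≤ A * N * ((2 * k) ^ m * (m.factorial : ℝ) ^ s) * (I + 1) := by
            gcongr; linarith
        _ = _ := by ring
    have h2 := le_exp_neg_of_forall_pow_mul_le hs0 (by positivity : 0 < 2 * k)
      (Nat.cast_nonneg l) (norm_nonneg _) (by positivity) h1
    refine h2.trans ?_
    rw [← mul_assoc (2 ^ s) (A * (I + 1)) N]
    refine mul_le_mul_of_nonneg_left (Real.exp_le_exp.2 ?_) (by positivity)
    rw [neg_mul, neg_mul, neg_le_neg_iff]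
    have h3 := half_mul_rpow_le hs hk.le
    have h4 : s / (4 * k ^ (1 / s)) ≤ s / (2 * (2 * k) ^ (1 / s)) :=
      div_le_div_of_nonneg_left hs0.le (by positivity) (by linarith)
    exact mul_le_mul_of_nonneg_right h4 (by positivity)
  have hrot : ∀ (t : ℝ), Complex.exp (((-2 * Real.pi * t * (l : ℝ) : ℝ) : ℂ) * Complex.I) =
      Complex.cos (2 * Real.pi * l * t) - Complex.sin (2 * Real.pi * l * t) * Complex.I ∧
      Complex.exp (((-2 * Real.pi * t * (-(l : ℝ)) : ℝ) : ℂ) * Complex.I) =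
      Complex.cos (2 * Real.pi * l * t) + Complex.sin (2 * Real.pi * l * t) * Complex.I := by
    intro t
    constructor
    · rw [show (((-2 * Real.pi * t * (l : ℝ) : ℝ) : ℂ) * Complex.I) =
        (-(2 * Real.pi * l * t)) * Complex.I by push_cast; ring, Complex.exp_mul_I,
        Complex.cos_neg, Complex.sin_neg]
      ring
    · rw [show (((-2 * Real.pi * t * (-(l : ℝ)) : ℝ) : ℂ) * Complex.I) =
        (2 * Real.pi * l * t) * Complex.I by push_cast; ring, Complex.exp_mul_I]
  have hint : ∀ ξ : ℝ, Integrable fun x : ℝ =>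
      Complex.exp (((-2 * Real.pi * x * ξ : ℝ) : ℂ) * Complex.I) • v x := fun ξ => by
    have h0 : Integrable v := by simpa using hvi 0
    refine h0.norm.mono' ?_ (.of_forall fun x => ?_)
    · have := hvs.continuous
      exact (by fun_prop : Continuous fun x : ℝ =>
        Complex.exp (((-2 * Real.pi * x * ξ : ℝ) : ℂ) * Complex.I) • v x).aestronglyMeasurable
    · rw [norm_smul, Complex.norm_exp_ofReal_mul_I, one_mul]
  have hpos := hF l (abs_of_nonneg (Nat.cast_nonneg l))
  have hneg := hF (-l) (by rw [abs_neg]; exact abs_of_nonneg (Nat.cast_nonneg l))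
  -- A cosine or sine of frequency l combines the characters at l and -l, so the coefficient
  -- combines two values of the Fourier transform of v.
  have hcomb : ∀ (κ₁ κ₂ : ℂ), ‖κ₁‖ = √2 / 2 → ‖κ₂‖ = √2 / 2 →
      (∀ x : ℝ, (wilson1 ψ l n x : ℂ) * u x =
        κ₁ * (Complex.exp (((-2 * Real.pi * x * (l : ℝ) : ℝ) : ℂ) * Complex.I) • v x) +
        κ₂ * (Complex.exp (((-2 * Real.pi * x * (-(l : ℝ)) : ℝ) : ℂ) * Complex.I) • v x)) →
      ‖∫ x, (wilson1 ψ l n x : ℂ) * u x‖ ≤ √2 * (2 ^ s * (A * (I + 1))) * N *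
        Real.exp (-(s / (4 * k ^ (1 / s))) * (l : ℝ) ^ (1 / s)) := by
    intro κ₁ κ₂ h1 h2 hx
    have : ∫ x, (wilson1 ψ l n x : ℂ) * u x = κ₁ * 𝓕 v l + κ₂ * 𝓕 v (-l) := by
      rw [Real.fourier_real_eq_integral_exp_smul, Real.fourier_real_eq_integral_exp_smul,
        ← integral_const_mul, ← integral_const_mul,
        ← integral_add ((hint _).const_mul _) ((hint _).const_mul _)]
      exact integral_congr_ae (.of_forall hx)
    rw [this]
    refine (norm_add_le _ _).trans ?_
    rw [norm_mul, norm_mul, h1, h2]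
    have hq : 0 ≤ √2 / 2 := by positivity
    have := mul_le_mul_of_nonneg_left hpos hq
    have := mul_le_mul_of_nonneg_left hneg hq
    linarith
  have hsq : ‖(√2 / 2 : ℂ)‖ = √2 / 2 := by
    rw [norm_div, Complex.norm_real, Real.norm_of_nonneg (Real.sqrt_nonneg _), Complex.norm_ofNat]
  by_cases he : Even ((l : ℤ) + n)
  · refine hcomb (√2 / 2) (√2 / 2) hsq hsq fun x => ?_
    rw [(hrot x).1, (hrot x).2]
    simp only [wilson1, hl, he, if_true, if_false, smul_eq_mul, v]
    push_cast
    ring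
  · refine hcomb (√2 / 2 * Complex.I) (-(√2 / 2 * Complex.I)) (by rw [norm_mul, hsq]; simp)
      (by rw [norm_neg, norm_mul, hsq]; simp) fun x => ?_
    rw [(hrot x).1, (hrot x).2]
    simp only [wilson1, hl, he, if_false, smul_eq_mul, v]
    push_cast
    linear_combination ((√2 : ℂ) * Complex.sin (2 * Real.pi * l * x) * (ψ (x - n / 2)) * u x) *
      Complex.I_mul_I

/-- Decay of one-dimensional Wilson coefficients. -/
theorem exists_wilson1_coeff_le {s k : ℝ} (hs : 1 < s) (hk : 0 < k) {ψ : ℝ → ℝ}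
    (hψ : IsWilsonGenerator ψ) : ∃ C : ℝ, 0 < C ∧ ∀ (u : ℝ → ℂ) (N : ℝ), 0 ≤ N →
      ContDiff ℝ ∞ u →
      (∀ (j : ℕ) (x : ℝ), |x| ^ j * ‖u x‖ ≤ N * (k ^ j * (j.factorial : ℝ) ^ s)) →
      (∀ (j : ℕ) (x : ℝ), ‖iteratedDeriv j u x‖ ≤ N * (k ^ j * (j.factorial : ℝ) ^ s)) →
      ∀ (l : ℕ) (n : ℤ), ‖∫ x, (wilson1 ψ l n x : ℂ) * u x‖ ≤
        C * N * Real.exp (-(s / (8 * k ^ (1 / s))) * wilsonWeight1 s l n) := by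
  have hs0 : 0 < s := by linarith
  obtain ⟨C₁, hC₁, h1⟩ := exists_wilson1_coeff_translation hs hk hψ
  obtain ⟨C₂, hC₂, h2⟩ := exists_wilson1_coeff_frequency hs hk hψ
  refine ⟨C₁ + C₂, by positivity, fun u N hN hu hux hud l n => ?_⟩
  set δ := s / (8 * k ^ (1 / s)) with hδ
  have hδ0 : 0 < δ := by positivity
  have hδ2 : s / (4 * k ^ (1 / s)) = 2 * δ := by rw [hδ]; field_simp; norm_num
  have hn0 : 0 ≤ |(n : ℝ)| ^ (1 / s) := by positivity
  -- The larger of the two terms is at least half of their sum, so decay in that index alone yields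
  -- half its rate in the total weight. When l = 0 the frequency bound is unavailable and
  -- translation decay is used.
  rcases le_total ((l : ℝ) ^ (1 / s)) (|(n : ℝ)| ^ (1 / s)) with h | h
  · refine (h1 u N hN hux l n).trans ?_
    rw [hδ2]
    gcongr ?_ * _ * Real.exp ?_
    · linarith
    · unfold wilsonWeight1; nlinarith
  · by_cases hl : l = 0
    · refine (h1 u N hN hux l n).trans ?_
      have h0 : (l : ℝ) ^ (1 / s) = 0 := by
        rw [hl, Nat.cast_zero, Real.zero_rpow (by positivity)]
      rw [hδ2]
      gcongr ?_ * _ * Real.exp ?_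
      · linarith
      · unfold wilsonWeight1; nlinarith
    · refine (h2 u N hN hu hud l n hl).trans ?_
      rw [hδ2]
      gcongr ?_ * _ * Real.exp ?_
      · linarith
      · unfold wilsonWeight1; nlinarith

/-! ### Slicing along a coordinate and decay in several variables -/

/-- The point of `ℝ^{m+1}` with `j`-th coordinate `t` and remaining coordinates `y`. -/
def insertPoint {m : ℕ} (j : Fin (m + 1)) (t : ℝ) (y : Fin m → ℝ) :
    EuclideanSpace ℝ (Fin (m + 1)) :=
  WithLp.toLp 2 (j.insertNth (α := fun _ => ℝ) t y)

@[simp] theorem insertPoint_same {m : ℕ} (j : Fin (m + 1)) (t : ℝ) (y : Fin m → ℝ) :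
    insertPoint j t y j = t := by
  simp [insertPoint]

@[simp] theorem insertPoint_succAbove {m : ℕ} (j : Fin (m + 1)) (t : ℝ) (y : Fin m → ℝ)
    (k : Fin m) : insertPoint j t y (j.succAbove k) = y k := by
  simp [insertPoint]

theorem insertPoint_eq_add_smul {m : ℕ} (j : Fin (m + 1)) (t : ℝ) (y : Fin m → ℝ) :
    insertPoint j t y = insertPoint j 0 y + t • EuclideanSpace.single j (1 : ℝ) := by
  ext k
  rcases Fin.eq_self_or_eq_succAbove j k with rfl | ⟨k, rfl⟩
  · simp
  · simp

theorem measurePreserving_insertPoint {m : ℕ} (j : Fin (m + 1)) :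
    MeasurePreserving (fun q : ℝ × (Fin m → ℝ) => insertPoint j q.1 q.2)
      ((volume : Measure ℝ).prod volume) volume :=
  (PiLp.volume_preserving_toLp (Fin (m + 1))).comp
    ((volume_preserving_piFinSuccAbove (fun _ : Fin (m + 1) => ℝ) j).symm _)

theorem measurableEmbedding_insertPoint {m : ℕ} (j : Fin (m + 1)) :
    MeasurableEmbedding (fun q : ℝ × (Fin m → ℝ) => insertPoint j q.1 q.2) :=
  (MeasurableEquiv.toLp 2 (Fin (m + 1) → ℝ)).measurableEmbedding.comp
    (MeasurableEquiv.piFinSuccAbove (fun _ : Fin (m + 1) => ℝ) j).symm.measurableEmbedding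

theorem integral_eq_integral_insertPoint {m : ℕ} (j : Fin (m + 1))
    {H : EuclideanSpace ℝ (Fin (m + 1)) → ℂ} (hH : Integrable H) :
    ∫ x, H x = ∫ y : Fin m → ℝ, ∫ t : ℝ, H (insertPoint j t y) := by
  rw [← (measurePreserving_insertPoint j).integral_comp (measurableEmbedding_insertPoint j)]
  exact integral_prod_symm _
    (((measurePreserving_insertPoint j).integrable_comp_emb
      (measurableEmbedding_insertPoint j)).2 hH)

theorem iteratedDeriv_insertPoint {m : ℕ} (j : Fin (m + 1)) (y : Fin m → ℝ)
    {f : EuclideanSpace ℝ (Fin (m + 1)) → ℂ} (hf : ContDiff ℝ ∞ f) (r : ℕ) :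
    iteratedDeriv r (fun t => f (insertPoint j t y)) =
      fun t => (partialDeriv j)^[r] f (insertPoint j t y) := by
  induction r with
  | zero => simp
  | succ r ih =>
    rw [iteratedDeriv_succ, ih]
    funext t
    have h1 := (((partialDeriv_iterate j r).1 f hf).differentiable (by simp)
      (insertPoint j t y)).hasFDerivAt
    have h2 : HasDerivAt (fun t => insertPoint j t y) (EuclideanSpace.single j (1 : ℝ)) t := by
      have h3 : (fun t => insertPoint j t y) =
          fun t => insertPoint j 0 y + t • EuclideanSpace.single j (1 : ℝ) :=
        funext fun t => insertPoint_eq_add_smul j t y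
      rw [h3]
      simpa using ((hasDerivAt_id t).smul_const (EuclideanSpace.single j (1 : ℝ))).const_add
        (insertPoint j 0 y)
    rw [Function.iterate_succ_apply', partialDeriv]
    exact (h1.comp_hasDerivAt t h2).deriv

theorem multiDeriv_single {d : ℕ} (j : Fin d) (r : ℕ) (f : EuclideanSpace ℝ (Fin d) → ℂ) :
    multiDeriv (Pi.single j r) f = (partialDeriv j)^[r] f := by
  have h0 : ∀ L : List (Fin d), j ∉ L →
      L.foldr (fun i g => (partialDeriv i)^[(Pi.single j r : Fin d → ℕ) i] g) f = f := by
    intro L hL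
    induction L with
    | nil => rfl
    | cons i L ih =>
      rw [List.mem_cons, not_or] at hL
      rw [List.foldr_cons, ih hL.2, Pi.single_eq_of_ne (Ne.symm hL.1)]
      rfl
  have h1 : ∀ L : List (Fin d), L.Nodup → j ∈ L →
      L.foldr (fun i g => (partialDeriv i)^[(Pi.single j r : Fin d → ℕ) i] g) f =
        (partialDeriv j)^[r] f := by
    intro L hL hj
    induction L with
    | nil => simp at hj
    | cons i L ih =>
      obtain ⟨hi, hL⟩ := List.nodup_cons.1 hL
      rw [List.foldr_cons]
      rcases List.mem_cons.1 hj with rfl | hj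
      · rw [h0 L hi, Pi.single_eq_same]
      · rw [ih hL hj, Pi.single_eq_of_ne (by rintro rfl; exact hi hj)]
        rfl
  exact h1 _ (List.nodup_finRange d) (List.mem_finRange j)

theorem gsQuotient_le_gsNorm {d : ℕ} {s h : ℝ} {f : EuclideanSpace ℝ (Fin d) → ℂ}
    (hf : GSFinite s h f) (p) : gsQuotient s h f p ≤ gsNorm s h f :=
  le_ciSup hf.2 p

theorem GSFinite.pow_mul_norm_le {d : ℕ} {s h : ℝ} (hh : 0 < h)
    {f : EuclideanSpace ℝ (Fin d) → ℂ} (hf : GSFinite s h f) (j : Fin d) (r : ℕ)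
    (x : EuclideanSpace ℝ (Fin d)) :
    |x j| ^ r * ‖f x‖ ≤ gsNorm s h f * (h ^ r * (r.factorial : ℝ) ^ s) := by
  have h1 := gsQuotient_le_gsNorm hf (Pi.single j r, 0, x)
  unfold gsQuotient at h1
  rw [div_le_iff₀ (gsQuotient_denom_pos s hh _ _)] at h1
  have h2 : (∏ i, x i ^ (Pi.single j r : Fin d → ℕ) i : ℝ) = x j ^ r := by
    rw [Finset.prod_eq_single j]
    · simp
    · intro i _ hi; simp [hi]
    · simp
  have h3 : (∏ i, ((Pi.single j r : Fin d → ℕ) i).factorial) = r.factorial := by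
    rw [Finset.prod_eq_single j]
    · simp
    · intro i _ hi; simp [hi]
    · simp
  simp only [h2, h3, multiDeriv_zero_index] at h1
  simpa [Finset.sum_pi_single'] using h1

theorem GSFinite.norm_iterate_partialDeriv_le {d : ℕ} {s h : ℝ} (hh : 0 < h)
    {f : EuclideanSpace ℝ (Fin d) → ℂ} (hf : GSFinite s h f) (j : Fin d) (r : ℕ)
    (x : EuclideanSpace ℝ (Fin d)) :
    ‖(partialDeriv j)^[r] f x‖ ≤ gsNorm s h f * (h ^ r * (r.factorial : ℝ) ^ s) := by
  have h1 := gsQuotient_le_gsNorm hf (0, Pi.single j r, x)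
  unfold gsQuotient at h1
  rw [div_le_iff₀ (gsQuotient_denom_pos s hh _ _)] at h1
  have h3 : (∏ i, ((Pi.single j r : Fin d → ℕ) i).factorial) = r.factorial := by
    rw [Finset.prod_eq_single j]
    · simp
    · intro i _ hi; simp [hi]
    · simp
  simp only [h3, multiDeriv_single] at h1
  simpa [Finset.sum_pi_single'] using h1

/-- Each slice of the test function in direction j obeys the one-dimensional hypotheses with the
same norm and step, uniformly in the other variables. The one-dimensional decay applies to the inner
integral and the other Wilson factors are integrated in `L¹`. -/
theorem exists_wilson_coeff_le_of_coordinate {m : ℕ} {s k : ℝ} (hs : 1 < s) (hk : 0 < k)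
    {ψ : Fin (m + 1) → ℝ → ℝ} (hψ : ∀ j, IsWilsonGenerator (ψ j)) (j : Fin (m + 1)) :
    ∃ C : ℝ, 0 < C ∧ ∀ φ, GSFinite s k φ → ∀ i,
      Integrable (fun x => wilson ψ i x * φ x) → ‖∫ x, wilson ψ i x * φ x‖ ≤
        C * gsNorm s k φ * Real.exp (-(s / (8 * k ^ (1 / s))) * wilsonWeight1 s (i.1 j) (i.2 j)) := by
  obtain ⟨C, hC, h1⟩ := exists_wilson1_coeff_le hs hk (hψ j)
  choose A hA hAb using fun r => exists_integral_abs_wilson1_le (hψ (j.succAbove r))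
  refine ⟨C * ∏ r, A r, mul_pos hC (Finset.prod_pos fun r _ => hA r), fun φ hφ i hint => ?_⟩
  have hN : 0 ≤ gsNorm s k φ := gsNorm_nonneg s hk φ
  set E := C * gsNorm s k φ *
    Real.exp (-(s / (8 * k ^ (1 / s))) * wilsonWeight1 s (i.1 j) (i.2 j)) with hE
  have hE0 : 0 ≤ E := by positivity
  set g : Fin m → ℝ → ℝ := fun r => wilson1 (ψ (j.succAbove r)) (i.1 (j.succAbove r))
    (i.2 (j.succAbove r)) with hg
  have hw : ∀ t y, wilson ψ i (insertPoint j t y) =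
      (wilson1 (ψ j) (i.1 j) (i.2 j) t : ℂ) * ((∏ r, g r (y r) : ℝ) : ℂ) := fun t y => by
    rw [wilson, Fin.prod_univ_succAbove _ j]
    simp [hg]
  have hinner : ∀ y : Fin m → ℝ, ‖∫ t, wilson ψ i (insertPoint j t y) * φ (insertPoint j t y)‖ ≤
      (∏ r, |g r (y r)|) * E := by
    intro y
    have h2 := h1 (fun t => φ (insertPoint j t y)) (gsNorm s k φ) hN
      (by
        have : (fun t => φ (insertPoint j t y)) = fun t =>
            φ (insertPoint j 0 y + t • EuclideanSpace.single j (1 : ℝ)) :=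
          funext fun t => by rw [← insertPoint_eq_add_smul]
        rw [this]
        exact hφ.1.comp (contDiff_const.add (contDiff_id.smul contDiff_const)))
      (fun r t => by simpa using hφ.pow_mul_norm_le hk j r (insertPoint j t y))
      (fun r t => by
        rw [iteratedDeriv_insertPoint j y hφ.1]
        exact hφ.norm_iterate_partialDeriv_le hk j r _) (i.1 j) (i.2 j)
    calc _ = ‖((∏ r, g r (y r) : ℝ) : ℂ) *
          ∫ t, (wilson1 (ψ j) (i.1 j) (i.2 j) t : ℂ) * φ (insertPoint j t y)‖ := by
          rw [← integral_const_mul]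
          congr 2
          funext t
          rw [hw]; ring
      _ ≤ (∏ r, |g r (y r)|) * E := by
          rw [norm_mul, Complex.norm_real, Real.norm_eq_abs, Finset.abs_prod]
          gcongr
  rw [integral_eq_integral_insertPoint j hint]
  have hgi : Integrable (fun y : Fin m → ℝ => (∏ r, |g r (y r)|) * E) :=
    (Integrable.fintype_prod (f := fun r t => |g r t|)
      fun r => (integrable_wilson1 (hψ _) _ _).abs).mul_const E
  refine (norm_integral_le_of_norm_le hgi (.of_forall hinner)).trans ?_
  rw [integral_mul_const, integral_fintype_prod_volume_eq_prod (fun r t => |g r t|)]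
  calc (∏ r, ∫ t, |g r t|) * E ≤ (∏ r, A r) * E := by
        refine mul_le_mul_of_nonneg_right (Finset.prod_le_prod (fun r _ =>
          integral_nonneg fun t => abs_nonneg _) fun r _ => hAb r _ _) hE0
    _ = _ := by rw [hE]; ring

/-- Decay of the Wilson coefficients of a test function of step `k`. -/
theorem exists_wilson_coeff_le {d : ℕ} {s k : ℝ} (hs : 1 < s) (hk : 0 < k)
    {ψ : Fin d → ℝ → ℝ} (hψ : ∀ j, IsWilsonGenerator (ψ j)) :
    ∃ C : ℝ, 0 < C ∧ ∀ φ, GSFinite s k φ → ∀ i, ‖∫ x, wilson ψ i x * φ x‖ ≤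
      C * gsNorm s k φ * Real.exp (-(s / (8 * k ^ (1 / s) * (d + 1))) * wilsonWeight s i) := by
  have hs0 : 0 < s := by linarith
  obtain ⟨ε, C₀, hε, hC₀, hstep⟩ := exists_wilsonStepBound_of_step hs hk hψ
  rcases d with _ | m
  · refine ⟨1, one_pos, fun φ hφ i => ?_⟩
    have hw : wilson ψ i = 1 := by funext x; simp [wilson]
    have hT : wilsonWeight s i = 0 := by simp [wilsonWeight]
    rw [hw, hT, mul_zero, Real.exp_zero, mul_one, one_mul]
    rw [volume_euclideanSpace_eq_dirac, integral_dirac]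
    simpa using hφ.norm_le 0
  · choose C hC h using fun j => exists_wilson_coeff_le_of_coordinate hs hk hψ j
    refine ⟨∑ j, C j, Finset.sum_pos (fun j _ => hC j) Finset.univ_nonempty, fun φ hφ i => ?_⟩
    have hN : 0 ≤ gsNorm s k φ := gsNorm_nonneg s hk φ
    -- Some coordinate carries at least the average weight, so its decay controls the total up to
    -- the dimension. The rate is stated with d + 1 so that it makes sense for d = 0.
    obtain ⟨j, -, hj⟩ := Finset.exists_le_of_sum_le (s := (Finset.univ : Finset (Fin (m + 1))))
      (f := fun _ => wilsonWeight s i / (m + 1 : ℝ))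
      (g := fun j => wilsonWeight1 s (i.1 j) (i.2 j)) Finset.univ_nonempty (by
        rw [Finset.sum_const, Finset.card_univ, Fintype.card_fin, nsmul_eq_mul]
        push_cast
        rw [mul_div_cancel₀ _ (by positivity)]
        rfl)
    refine (h j φ hφ i ((hstep i).1.integrable_mul hk hφ)).trans ?_
    have hT : 0 ≤ wilsonWeight s i := Finset.sum_nonneg fun j _ => wilsonWeight1_nonneg _ _ _
    gcongr ?_ * _ * Real.exp ?_
    · exact mul_nonneg (Finset.sum_nonneg fun j _ => (hC j).le) hN
    · exact Finset.single_le_sum (fun j _ => (hC j).le) (Finset.mem_univ j)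
    · rw [neg_mul, neg_mul, neg_le_neg_iff]
      push_cast
      calc s / (8 * k ^ (1 / s) * ((m : ℝ) + 1 + 1)) * wilsonWeight s i
          ≤ s / (8 * k ^ (1 / s) * ((m : ℝ) + 1)) * wilsonWeight s i := by
            gcongr; linarith
        _ = s / (8 * k ^ (1 / s)) * (wilsonWeight s i / (m + 1)) := by
            field_simp
        _ ≤ _ := by gcongr

/-! ### Orthonormality and completeness -/

theorem integral_wilson1_mul_wilson1 {ψ : ℝ → ℝ} (hψ : IsWilsonGenerator ψ) (l l' : ℕ)
    (n n' : ℤ) : ∫ x, (wilson1 ψ l n x : ℂ) * (wilson1 ψ l' n' x : ℂ) =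
      if (l, n) = (l', n') then 1 else 0 := by
  obtain ⟨B, hB⟩ := hψ.basis
  rw [← orthonormal_iff_ite.1 B.orthonormal (l, n) (l', n'), L2.inner_def]
  refine integral_congr_ae ?_
  filter_upwards [hB l n, hB l' n'] with x h1 h2
  rw [h1, h2]
  simp [mul_comm]

/-- Wilson functions are real, so the bilinear integrals are the `L²` coefficients; continuity
upgrades vanishing almost everywhere to vanishing everywhere. -/
theorem eq_zero_of_integral_wilson1_mul {ψ : ℝ → ℝ} (hψ : IsWilsonGenerator ψ) {g : ℝ → ℂ}
    (hg : Continuous g) (hg2 : MemLp g 2)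
    (h : ∀ l n, ∫ x, (wilson1 ψ l n x : ℂ) * g x = 0) : g = 0 := by
  obtain ⟨B, hB⟩ := hψ.basis
  have h0 : hg2.toLp g = 0 := by
    apply B.repr.injective
    rw [map_zero]
    ext ⟨l, n⟩
    rw [B.repr_apply_apply, L2.inner_def]
    simp only [lp.coeFn_zero, Pi.zero_apply]
    rw [← h l n]
    refine integral_congr_ae ?_
    filter_upwards [hB l n, hg2.coeFn_toLp] with x h1 h2
    rw [h1, h2]
    simp [mul_comm]
  have h1 : g =ᵐ[volume] 0 := by
    have := hg2.coeFn_toLp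
    rw [h0] at this
    exact this.symm.trans (Lp.coeFn_zero ℂ 2 volume)
  exact Continuous.ae_eq_iff_eq volume hg continuous_zero |>.1 h1

theorem integral_wilson_mul_wilson {d : ℕ} {ψ : Fin d → ℝ → ℝ}
    (hψ : ∀ k, IsWilsonGenerator (ψ k)) (i j : (Fin d → ℕ) × (Fin d → ℤ)) :
    ∫ x, wilson ψ i x * wilson ψ j x = if i = j then 1 else 0 := by
  rw [← (PiLp.volume_preserving_toLp (Fin d)).integral_comp
    (MeasurableEquiv.toLp 2 (Fin d → ℝ)).measurableEmbedding]
  have h1 : ∀ y : Fin d → ℝ, wilson ψ i (WithLp.toLp 2 y) * wilson ψ j (WithLp.toLp 2 y) =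
      ∏ k, ((wilson1 (ψ k) (i.1 k) (i.2 k) (y k) : ℂ) *
        (wilson1 (ψ k) (j.1 k) (j.2 k) (y k) : ℂ)) := fun y => by
    rw [Finset.prod_mul_distrib]
    simp [wilson]
  simp_rw [h1]
  rw [integral_fintype_prod_volume_eq_prod fun k t =>
    (wilson1 (ψ k) (i.1 k) (i.2 k) t : ℂ) * (wilson1 (ψ k) (j.1 k) (j.2 k) t : ℂ)]
  simp_rw [integral_wilson1_mul_wilson1 (hψ _)]
  split_ifs with hij
  · subst hij; simp
  · have : ∃ k, ¬ ((i.1 k, i.2 k) = (j.1 k, j.2 k)) := by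
      by_contra hcon
      push Not at hcon
      refine hij (Prod.ext (funext fun k => ?_) (funext fun k => ?_))
      exacts [(Prod.mk.inj (hcon k)).1, (Prod.mk.inj (hcon k)).2]
    obtain ⟨k, hk⟩ := this
    exact Finset.prod_eq_zero (Finset.mem_univ k) (if_neg hk)

theorem inv_one_add_sq_le_one (t : ℝ) : (1 + t ^ 2)⁻¹ ≤ 1 :=
  inv_le_one_of_one_le₀ (by nlinarith [sq_nonneg t])

theorem memLp_two_of_norm_le_inv_one_add_sq {g : ℝ → ℂ} (hg : Continuous g) {C : ℝ}
    (h : ∀ t, ‖g t‖ ≤ C * (1 + t ^ 2)⁻¹) : MemLp g 2 := by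
  rw [memLp_two_iff_integrable_sq_norm hg.aestronglyMeasurable]
  refine (integrable_inv_one_add_sq.const_mul (C ^ 2)).mono'
    (by fun_prop : Continuous fun x => ‖g x‖ ^ 2).aestronglyMeasurable (.of_forall fun t => ?_)
  have hp : 0 < (1 + t ^ 2)⁻¹ := by positivity
  rw [Real.norm_of_nonneg (by positivity)]
  calc ‖g t‖ ^ 2 ≤ (C * (1 + t ^ 2)⁻¹) ^ 2 := by gcongr; exact h t
    _ = C ^ 2 * ((1 + t ^ 2)⁻¹ * (1 + t ^ 2)⁻¹) := by ring
    _ ≤ C ^ 2 * ((1 + t ^ 2)⁻¹ * 1) := by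
        gcongr
        exact inv_one_add_sq_le_one t
    _ = _ := by ring

/-- Completeness of tensor products of Wilson systems, for functions of quadratic decay in every
coordinate. -/
theorem eq_zero_of_integral_prod_wilson1_mul {d : ℕ} {ψ : Fin d → ℝ → ℝ}
    (hψ : ∀ k, IsWilsonGenerator (ψ k)) {g : (Fin d → ℝ) → ℂ} (hg : Continuous g) {C : ℝ}
    (hC : ∀ y, ‖g y‖ ≤ C * ∏ k, (1 + y k ^ 2)⁻¹)
    (h : ∀ (l : Fin d → ℕ) (n : Fin d → ℤ),
      ∫ y, (∏ k, (wilson1 (ψ k) (l k) (n k) (y k) : ℂ)) * g y = 0) : g = 0 := by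
  induction d generalizing C with
  | zero =>
    have := h 0 0
    simp only [Finset.univ_eq_empty, Finset.prod_empty, one_mul] at this
    rw [Measure.volume_pi_eq_dirac default, integral_dirac] at this
    funext y
    rw [Subsingleton.elim y default, this]; rfl
  | succ d ih =>
    have hC0 : 0 ≤ C := by
      have h1 := (norm_nonneg _).trans (hC 0)
      simpa using h1
    set W : (Fin d → ℕ) → (Fin d → ℤ) → (Fin d → ℝ) → ℂ := fun l n y =>
      ∏ k, (wilson1 (ψ k.succ) (l k) (n k) (y k) : ℂ) with hW
    have hW1 : ∀ l n, Integrable (W l n) := fun l n => by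
      have h1 : ∀ k : Fin d, Integrable
          (fun t : ℝ => (wilson1 (ψ k.succ) (l k) (n k) t : ℂ)) :=
        fun k => (integrable_wilson1 (hψ k.succ) (l k) (n k)).ofReal
      exact Integrable.fintype_prod h1
    have hWc : ∀ l n, Continuous (W l n) := fun l n => by
      refine continuous_finsetProd _ fun k _ => Complex.continuous_ofReal.comp
        ((continuous_wilson1 (hψ _) _ _).comp (continuous_apply k))
    have hcons : Continuous fun q : ℝ × (Fin d → ℝ) => (Fin.cons q.1 q.2 : Fin (d + 1) → ℝ) :=
      Continuous.finCons continuous_fst continuous_snd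
    have hgc : Continuous fun q : ℝ × (Fin d → ℝ) => g (Fin.cons q.1 q.2) := hg.comp hcons
    have hgb : ∀ t y, ‖g (Fin.cons t y)‖ ≤ C * (1 + t ^ 2)⁻¹ * ∏ k, (1 + y k ^ 2)⁻¹ := by
      intro t y
      have := hC (Fin.cons t y)
      rwa [Fin.prod_univ_succ, Fin.cons_zero, ← mul_assoc] at this
    have hprod1 : ∀ y : Fin d → ℝ, ∏ k, (1 + y k ^ 2)⁻¹ ≤ 1 := fun y =>
      Finset.prod_le_one (fun k _ => by positivity) fun k _ => inv_one_add_sq_le_one _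
    have hgb1 : ∀ t y, ‖g (Fin.cons t y)‖ ≤ C * (1 + t ^ 2)⁻¹ := fun t y =>
      (hgb t y).trans (mul_le_of_le_one_right (by positivity) (hprod1 y))
    have hgb2 : ∀ t y, ‖g (Fin.cons t y)‖ ≤ C := fun t y =>
      (hgb1 t y).trans (mul_le_of_le_one_right hC0 (inv_one_add_sq_le_one t))
    -- Freeze the indices of the last d variables and integrate these out. What remains is
    -- continuous and square integrable in t and orthogonal to the one-dimensional system, hence
    -- zero for every t; the induction hypothesis then applies to each slice of g.
    have hG : ∀ l n t, ∫ y, W l n y * g (Fin.cons t y) = 0 := by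
      intro l n t
      have hGc : Continuous fun t => ∫ y, W l n y * g (Fin.cons t y) := by
        refine continuous_of_dominated (bound := fun y => ‖W l n y‖ * C) (fun t => ?_)
          (fun t => .of_forall fun y => ?_) ((hW1 l n).norm.mul_const C) (.of_forall fun y => ?_)
        · exact ((hWc l n).mul (hgc.comp (Continuous.prodMk_right t))).aestronglyMeasurable
        · rw [norm_mul]; gcongr; exact hgb2 t y
        · exact continuous_const.mul (hgc.comp (Continuous.prodMk_left y))
      have hGb : ∀ t, ‖∫ y, W l n y * g (Fin.cons t y)‖ ≤
          (C * ∫ y, ‖W l n y‖) * (1 + t ^ 2)⁻¹ := by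
        intro t
        refine (norm_integral_le_of_norm_le ((hW1 l n).norm.mul_const (C * (1 + t ^ 2)⁻¹))
          (.of_forall fun y => ?_)).trans (le_of_eq ?_)
        · rw [norm_mul]; gcongr; exact hgb1 t y
        · rw [integral_mul_const]; ring
      refine congrFun (eq_zero_of_integral_wilson1_mul (hψ 0) hGc
        (memLp_two_of_norm_le_inv_one_add_sq hGc hGb) fun l₀ n₀ => ?_) t
      have h1 := h (Fin.cons l₀ l) (Fin.cons n₀ n)
      rw [← ((volume_preserving_piFinSuccAbove (fun _ : Fin (d + 1) => ℝ) 0).symm).integral_comp']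
        at h1
      have hpt : ∀ q : ℝ × (Fin d → ℝ),
          (∏ k, (wilson1 (ψ k) ((Fin.cons l₀ l : Fin (d + 1) → ℕ) k)
            ((Fin.cons n₀ n : Fin (d + 1) → ℤ) k)
            ((MeasurableEquiv.piFinSuccAbove (fun _ : Fin (d + 1) => ℝ) 0).symm q k) : ℂ)) *
            g ((MeasurableEquiv.piFinSuccAbove (fun _ : Fin (d + 1) => ℝ) 0).symm q) =
          (wilson1 (ψ 0) l₀ n₀ q.1 : ℂ) * W l n q.2 * g (Fin.cons q.1 q.2) := by
        intro q
        have hq : (MeasurableEquiv.piFinSuccAbove (fun _ : Fin (d + 1) => ℝ) 0).symm q =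
            Fin.cons q.1 q.2 := by
          simp [MeasurableEquiv.piFinSuccAbove_symm_apply, Fin.insertNthEquiv]
        rw [hq, Fin.prod_univ_succ]
        simp only [Fin.cons_zero, Fin.cons_succ, hW]
      simp_rw [hpt] at h1
      rw [Measure.volume_eq_prod, integral_prod] at h1
      · rw [← h1]
        refine integral_congr_ae (.of_forall fun t => ?_)
        simp only [mul_assoc]
        rw [integral_const_mul]
      · refine Integrable.mul_bdd (c := C) ?_ hgc.aestronglyMeasurable
          (.of_forall fun q => hgb2 q.1 q.2)
        exact (integrable_wilson1 (hψ 0) l₀ n₀).ofReal.mul_prod (hW1 l n)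
    funext z
    rw [← Fin.cons_self_tail z]
    refine congrFun (ih (ψ := fun k => ψ k.succ) (fun k => hψ _)
      (g := fun y => g (Fin.cons (z 0) y)) (hgc.comp (Continuous.prodMk_right (z 0)))
      (fun y => hgb (z 0) y) fun l n => hG l n (z 0)) (Fin.tail z)

theorem eq_zero_of_integral_wilson_mul {d : ℕ} {ψ : Fin d → ℝ → ℝ}
    (hψ : ∀ k, IsWilsonGenerator (ψ k)) {g : EuclideanSpace ℝ (Fin d) → ℂ} (hg : Continuous g)
    {C : ℝ} (hC : ∀ x, ‖g x‖ ≤ C * ∏ k, (1 + x k ^ 2)⁻¹)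
    (h : ∀ i, ∫ x, wilson ψ i x * g x = 0) : g = 0 := by
  have := eq_zero_of_integral_prod_wilson1_mul hψ (g := fun y => g (WithLp.toLp 2 y))
    (hg.comp (PiLp.continuous_toLp 2 _)) (fun y => hC _) fun l n => by
      have h1 := h (l, n)
      rw [← (PiLp.volume_preserving_toLp (Fin d)).integral_comp
        (MeasurableEquiv.toLp 2 (Fin d → ℝ)).measurableEmbedding] at h1
      rw [← h1]
      refine integral_congr_ae (.of_forall fun y => ?_)
      simp [wilson]
  funext x
  exact congrFun this (WithLp.ofLp x)

/-- Expand `∏ (1 + x_k²)` over subsets of the coordinates; each monomial is controlled by the norm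
with exponent 2 on the subset and no derivative. -/
theorem exists_norm_mul_prod_one_add_sq_le {d : ℕ} {s h : ℝ} (hh : 0 < h) :
    ∃ K : ℝ, 0 < K ∧ ∀ f : EuclideanSpace ℝ (Fin d) → ℂ, GSFinite s h f →
      ∀ x, ‖f x‖ ≤ K * gsNorm s h f * ∏ k, (1 + x k ^ 2)⁻¹ := by
  classical
  set e : Finset (Fin d) → Fin d → ℕ := fun S k => if k ∈ S then 2 else 0 with he
  refine ⟨∑ S : Finset (Fin d), h ^ (∑ i, (e S i + (0 : Fin d → ℕ) i)) *
    (((∏ i, (e S i).factorial) * (∏ i, ((0 : Fin d → ℕ) i).factorial) : ℕ) : ℝ) ^ s,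
    Finset.sum_pos (fun S _ => gsQuotient_denom_pos s hh _ _) Finset.univ_nonempty,
    fun f hf x => ?_⟩
  rw [Finset.prod_inv_distrib, ← div_eq_mul_inv,
    le_div_iff₀ (Finset.prod_pos fun k _ => by positivity), Finset.prod_one_add,
    Finset.powerset_univ, Finset.mul_sum, Finset.sum_mul]
  refine Finset.sum_le_sum fun S _ => ?_
  have h1 := gsQuotient_le_gsNorm hf (e S, 0, x)
  unfold gsQuotient at h1
  rw [div_le_iff₀ (gsQuotient_denom_pos s hh _ _)] at h1
  have h2 : (∏ i, x i ^ e S i : ℝ) = ∏ i ∈ S, x i ^ 2 := by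
    rw [← Finset.prod_filter_mul_prod_filter_not Finset.univ (· ∈ S)]
    rw [Finset.prod_congr rfl (g := fun i => x i ^ 2)
      (fun i hi => by simp [he, (Finset.mem_filter.1 hi).2]),
      Finset.prod_congr rfl (g := fun _ => (1 : ℝ))
      (s₁ := Finset.univ.filter (fun i => ¬ i ∈ S))
      (fun i hi => by simp [he, (Finset.mem_filter.1 hi).2])]
    simp
  simp only [h2, multiDeriv_zero_index] at h1
  rw [norm_mul, Complex.norm_real, Real.norm_of_nonneg (Finset.prod_nonneg fun i _ => sq_nonneg _)]
    at h1
  linarith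

/-! ### The weights -/

theorem wilsonWeight_nonneg {d : ℕ} (s : ℝ) (i : (Fin d → ℕ) × (Fin d → ℤ)) :
    0 ≤ wilsonWeight s i :=
  Finset.sum_nonneg fun _ _ => wilsonWeight1_nonneg _ _ _

theorem sqrt_sum_sq_le_sum {ι : Type*} (S : Finset ι) (f : ι → ℝ) (hf : ∀ i, 0 ≤ f i) :
    √(∑ i ∈ S, f i ^ 2) ≤ ∑ i ∈ S, f i :=
  Real.sqrt_le_iff.2 ⟨Finset.sum_nonneg fun i _ => hf i,
    Finset.sum_sq_le_sq_sum_of_nonneg fun i _ => hf i⟩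

theorem le_sqrt_sum_sq {ι : Type*} {S : Finset ι} {f : ι → ℝ} {i : ι} (hi : i ∈ S) :
    |f i| ≤ √(∑ i ∈ S, f i ^ 2) :=
  Real.abs_le_sqrt (Finset.single_le_sum (f := fun i => f i ^ 2) (fun _ _ => sq_nonneg _) hi)

theorem wilsonSize_nonneg {d : ℕ} (i : (Fin d → ℕ) × (Fin d → ℤ)) : 0 ≤ wilsonSize i := by
  unfold wilsonSize; positivity

theorem wilsonSize_rpow_le {d : ℕ} {s : ℝ} (hs : 1 < s) (i : (Fin d → ℕ) × (Fin d → ℤ)) :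
    wilsonSize i ^ (1 / s) ≤ wilsonWeight s i := by
  have h1 : wilsonSize i ≤ ∑ k, (|(i.2 k : ℝ)| + i.1 k) := by
    rw [Finset.sum_add_distrib]
    refine add_le_add ?_ (sqrt_sum_sq_le_sum _ _ fun k => Nat.cast_nonneg _)
    refine le_trans ?_ (sqrt_sum_sq_le_sum _ (fun k => |(i.2 k : ℝ)|) fun k => abs_nonneg _)
    refine Real.sqrt_le_sqrt (Finset.sum_le_sum fun k _ => ?_)
    rw [sq_abs, div_pow]
    nlinarith [sq_nonneg (i.2 k : ℝ)]
  refine (Real.rpow_le_rpow (wilsonSize_nonneg i) h1 (by positivity)).trans ?_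
  refine (sum_rpow_le_of_one_lt hs _ _ fun k => by positivity).trans ?_
  exact Finset.sum_le_sum fun k _ => rpow_add_le_of_one_lt hs (abs_nonneg _) (Nat.cast_nonneg _)

theorem wilsonWeight_le {d : ℕ} {s : ℝ} (hs : 1 < s) (i : (Fin d → ℕ) × (Fin d → ℤ)) :
    wilsonWeight s i ≤ 3 * d * wilsonSize i ^ (1 / s) := by
  have hsize := wilsonSize_nonneg i
  have h1 : ∀ k, wilsonWeight1 s (i.1 k) (i.2 k) ≤ 3 * wilsonSize i ^ (1 / s) := by
    intro k
    have e1 : |(i.2 k : ℝ)| ≤ 2 * wilsonSize i := by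
      have h2 := le_sqrt_sum_sq (f := fun k => (i.2 k : ℝ) / 2) (Finset.mem_univ k)
      have h3 : 0 ≤ √(∑ k, (i.1 k : ℝ) ^ 2) := Real.sqrt_nonneg _
      rw [abs_div, Nat.abs_ofNat] at h2
      unfold wilsonSize
      linarith
    have e2 : (i.1 k : ℝ) ≤ wilsonSize i := by
      have h2 := le_sqrt_sum_sq (f := fun k => (i.1 k : ℝ)) (Finset.mem_univ k)
      have h3 : 0 ≤ √(∑ k, ((i.2 k : ℝ) / 2) ^ 2) := Real.sqrt_nonneg _
      rw [Nat.abs_cast] at h2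
      unfold wilsonSize
      linarith
    have e3 := (Real.rpow_le_rpow (abs_nonneg _) e1 (by positivity : 0 ≤ 1 / s)).trans
      (half_mul_rpow_le hs hsize)
    have e4 := Real.rpow_le_rpow (Nat.cast_nonneg _) e2 (by positivity : 0 ≤ 1 / s)
    unfold wilsonWeight1
    linarith
  refine (Finset.sum_le_sum fun k _ => h1 k).trans (le_of_eq ?_)
  rw [Finset.sum_const, Finset.card_univ, Fintype.card_fin, nsmul_eq_mul]
  ring

/-- Comparison with `1/(n+1)²`, through the quadratic case of the factorial bound at n + 1; the
shift costs only the factor `e^ε`. -/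
theorem summable_exp_neg_rpow {s ε : ℝ} (hs : 1 < s) (hε : 0 < ε) :
    Summable fun n : ℕ => Real.exp (-ε * (n : ℝ) ^ (1 / s)) := by
  have hs0 : 0 < s := by linarith
  have hc : 0 < ε / s := by positivity
  set K := ((2 : ℕ).factorial : ℝ) ^ s * ((ε / s) ^ (-s)) ^ 2 with hK
  have h1 : Summable fun n : ℕ => Real.exp ε * K * (1 / ((n + 1 : ℕ) : ℝ) ^ 2) :=
    ((summable_nat_add_iff 1).2 (Real.summable_one_div_nat_pow.2 one_lt_two)).mul_left _
  refine h1.of_nonneg_of_le (fun n => (Real.exp_pos _).le) fun n => ?_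
  have h2 := pow_le_factorial_rpow_mul_exp hs0 hc (y := ((n + 1 : ℕ) : ℝ)) (by positivity) 2
  rw [mul_div_cancel₀ _ hs0.ne', ← hK] at h2
  have h3 : ((n + 1 : ℕ) : ℝ) ^ (1 / s) ≤ (n : ℝ) ^ (1 / s) + 1 := by
    push_cast
    simpa using rpow_add_le_of_one_lt hs (Nat.cast_nonneg n) zero_le_one
  have hp : (0 : ℝ) < ((n + 1 : ℕ) : ℝ) ^ 2 := by positivity
  rw [mul_one_div, le_div_iff₀ hp]
  calc Real.exp (-ε * (n : ℝ) ^ (1 / s)) * ((n + 1 : ℕ) : ℝ) ^ 2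
      ≤ Real.exp (-ε * (n : ℝ) ^ (1 / s)) * (K * Real.exp (ε * ((n : ℝ) ^ (1 / s) + 1))) := by
        gcongr
        refine h2.trans ?_
        gcongr
    _ = K * Real.exp (-ε * (n : ℝ) ^ (1 / s) + ε * ((n : ℝ) ^ (1 / s) + 1)) := by
        rw [Real.exp_add]; ring
    _ = Real.exp ε * K := by rw [mul_comm (Real.exp ε)]; congr 2; ring

theorem summable_prod_apply {α : Type*} {f : α → ℝ} (hf0 : ∀ a, 0 ≤ f a) (hf : Summable f)
    (d : ℕ) : Summable fun l : Fin d → α => ∏ k, f (l k) := by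
  induction d with
  | zero => exact (hasSum_fintype _).summable
  | succ d ih =>
    rw [← (Fin.insertNthEquiv (fun _ : Fin (d + 1) => α) 0).summable_iff]
    refine (hf.mul_of_nonneg ih hf0 fun l => Finset.prod_nonneg fun k _ => hf0 _).congr
      fun q => ?_
    simp [Fin.prod_univ_succ, Fin.insertNthEquiv]

theorem summable_exp_neg_wilsonWeight (d : ℕ) {s ε : ℝ} (hs : 1 < s) (hε : 0 < ε) :
    Summable fun i : (Fin d → ℕ) × (Fin d → ℤ) => Real.exp (-ε * wilsonWeight s i) := by
  have h1 := summable_exp_neg_rpow hs hε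
  have h2 : Summable fun n : ℤ => Real.exp (-ε * |(n : ℝ)| ^ (1 / s)) :=
    Summable.of_nat_of_neg (by simpa using h1) (by simpa using h1)
  refine ((summable_prod_apply (fun n => (Real.exp_pos _).le) h1 d).mul_of_nonneg
    (summable_prod_apply (fun n => (Real.exp_pos _).le) h2 d)
    (fun l => Finset.prod_nonneg fun k _ => (Real.exp_pos _).le)
    (fun l => Finset.prod_nonneg fun k _ => (Real.exp_pos _).le)).congr fun i => ?_
  rw [← Finset.prod_mul_distrib, wilsonWeight, Finset.mul_sum, Real.exp_sum]
  refine Finset.prod_congr rfl fun k _ => ?_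
  rw [← Real.exp_add, wilsonWeight1]
  ring_nf

theorem tendsto_wilsonWeight_cofinite (d : ℕ) {s : ℝ} (hs : 1 < s) :
    Filter.Tendsto (fun i : (Fin d → ℕ) × (Fin d → ℤ) => wilsonWeight s i) Filter.cofinite
      Filter.atTop := by
  have h := (summable_exp_neg_wilsonWeight d hs one_pos).tendsto_cofinite_zero
  have h2 := Real.tendsto_exp_comp_nhds_zero.1 h
  refine (Filter.tendsto_neg_atBot_atTop.comp h2).congr fun i => ?_
  simp

/-! ### Term by term differentiation -/

theorem norm_le_sum_norm_apply_single {d : ℕ} (L : EuclideanSpace ℝ (Fin d) →L[ℝ] ℂ) :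
    ‖L‖ ≤ ∑ j, ‖L (EuclideanSpace.single j 1)‖ := by
  refine L.opNorm_le_bound (Finset.sum_nonneg fun j _ => norm_nonneg _) fun x => ?_
  have hx : x = ∑ j, x j • EuclideanSpace.single j (1 : ℝ) := by
    ext k
    simp [Pi.single_apply]
  conv_lhs => rw [hx]
  rw [map_sum, Finset.sum_mul]
  refine (norm_sum_le _ _).trans (Finset.sum_le_sum fun j _ => ?_)
  rw [map_smul, norm_smul, mul_comm]
  gcongr
  exact PiLp.norm_apply_le x j

/-- In a tensor product each coordinate is differentiated separately, so the fixed order of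
derivatives in `multiDeriv` does no harm and no symmetry of mixed derivatives is needed. -/
theorem partialDeriv_multiDeriv_wilson {d : ℕ} {ψ : Fin d → ℝ → ℝ}
    (hψ : ∀ k, IsWilsonGenerator (ψ k)) (i : (Fin d → ℕ) × (Fin d → ℤ)) (j : Fin d)
    (β : Fin d → ℕ) : partialDeriv j (multiDeriv β (wilson ψ i)) =
      multiDeriv (β + Pi.single j 1) (wilson ψ i) := by
  have hu : ∀ k, ContDiff ℝ ∞ fun x => (wilson1 (ψ k) (i.1 k) (i.2 k) x : ℂ) :=
    fun k => (wilson1_smooth_and_bound (hψ k)).1 _ _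
  rw [wilson_eq_tensorFun, multiDeriv_tensorFun hu, multiDeriv_tensorFun hu,
    partialDeriv_tensorFun fun k => contDiff_iteratedDeriv_top (hu k) _]
  congr 1
  funext k
  by_cases hk : k = j
  · subst hk; simp [iteratedDeriv_succ]
  · simp [hk]

theorem contDiff_multiDeriv {d : ℕ} (β : Fin d → ℕ) {f : EuclideanSpace ℝ (Fin d) → ℂ}
    (hf : ContDiff ℝ ∞ f) : ContDiff ℝ ∞ (multiDeriv β f) :=
  (foldr_partialDeriv β _).1 f hf

theorem exists_norm_multiDeriv_le {d : ℕ} {s h : ℝ} (hh : 0 < h) (β : Fin d → ℕ) :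
    ∃ K : ℝ, 0 < K ∧ ∀ f : EuclideanSpace ℝ (Fin d) → ℂ, GSFinite s h f → ∀ x,
      ‖multiDeriv β f x‖ ≤ K * gsNorm s h f := by
  refine ⟨_, gsQuotient_denom_pos s hh 0 β, fun f hf x => ?_⟩
  have h1 := gsQuotient_le_gsNorm hf (0, β, x)
  unfold gsQuotient at h1
  rw [div_le_iff₀ (gsQuotient_denom_pos s hh _ _)] at h1
  simp only [Pi.zero_apply, pow_zero, Finset.prod_const_one, Complex.ofReal_one, one_mul] at h1
  rw [mul_comm]
  exact h1

section Expansion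

variable {d : ℕ} {s k : ℝ} {ψ : Fin d → ℝ → ℝ} {a : (Fin d → ℕ) × (Fin d → ℤ) → ℂ}

theorem summable_mul_multiDeriv_wilson (hk : 0 < k) (hw : ∀ i, GSFinite s k (wilson ψ i))
    (ha : Summable fun i => ‖a i‖ * gsNorm s k (wilson ψ i)) (β : Fin d → ℕ)
    (x : EuclideanSpace ℝ (Fin d)) :
    Summable fun i => a i * multiDeriv β (wilson ψ i) x := by
  obtain ⟨K, hK, h⟩ := exists_norm_multiDeriv_le (s := s) hk β
  refine (ha.mul_left K).of_norm_bounded fun i => ?_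
  rw [norm_mul]
  calc _ ≤ ‖a i‖ * (K * gsNorm s k (wilson ψ i)) := by gcongr; exact h _ (hw i) x
    _ = _ := by ring

theorem partialDeriv_tsum_wilson (hψ : ∀ k, IsWilsonGenerator (ψ k)) (hk : 0 < k)
    (hw : ∀ i, GSFinite s k (wilson ψ i))
    (ha : Summable fun i => ‖a i‖ * gsNorm s k (wilson ψ i)) (j : Fin d) (β : Fin d → ℕ) :
    partialDeriv j (fun x => ∑' i, a i * multiDeriv β (wilson ψ i) x) =
      fun x => ∑' i, a i * multiDeriv (β + Pi.single j 1) (wilson ψ i) x := by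
  choose K hK hKb using fun r : Fin d =>
    exists_norm_multiDeriv_le (s := s) hk (β + Pi.single r 1)
  have hsm : ∀ i, ContDiff ℝ ∞ (multiDeriv β (wilson ψ i)) := fun i =>
    contDiff_multiDeriv β (contDiff_wilson hψ i)
  have hdiff : ∀ i, Differentiable ℝ fun x => a i * multiDeriv β (wilson ψ i) x := fun i =>
    ((hsm i).differentiable (by simp)).const_mul _
  have hap : ∀ i x (r : Fin d), fderiv ℝ (fun x => a i * multiDeriv β (wilson ψ i) x) x
      (EuclideanSpace.single r 1) = a i * multiDeriv (β + Pi.single r 1) (wilson ψ i) x := by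
    intro i x r
    rw [fderiv_const_mul ((hsm i).differentiable (by simp) x),
      ← partialDeriv_multiDeriv_wilson hψ, partialDeriv]
    rfl
  have hbound : ∀ i x, ‖fderiv ℝ (fun x => a i * multiDeriv β (wilson ψ i) x) x‖ ≤
      (∑ r, K r) * (‖a i‖ * gsNorm s k (wilson ψ i)) := by
    intro i x
    refine (norm_le_sum_norm_apply_single _).trans ?_
    rw [Finset.sum_mul]
    refine Finset.sum_le_sum fun r _ => ?_
    rw [hap, norm_mul]
    calc _ ≤ ‖a i‖ * (K r * gsNorm s k (wilson ψ i)) := by gcongr; exact hKb r _ (hw i) x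
      _ = _ := by ring
  have hsum := ha.mul_left (∑ r, K r)
  funext x
  have hx := fderiv_tsum_apply hsum hdiff hbound
    (x₀ := 0) (summable_mul_multiDeriv_wilson hk hw ha β 0) x
  have hsf : Summable fun i => fderiv ℝ (fun x => a i * multiDeriv β (wilson ψ i) x) x :=
    hsum.of_norm_bounded fun i => hbound i x
  rw [partialDeriv, hx]
  have := (ContinuousLinearMap.apply ℝ ℂ (EuclideanSpace.single j (1 : ℝ))).map_tsum hsf
  simp only [ContinuousLinearMap.apply_apply, hap] at this
  exact this

theorem multiDeriv_tsum_wilson (hψ : ∀ k, IsWilsonGenerator (ψ k)) (hk : 0 < k)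
    (hw : ∀ i, GSFinite s k (wilson ψ i))
    (ha : Summable fun i => ‖a i‖ * gsNorm s k (wilson ψ i)) (β : Fin d → ℕ) :
    multiDeriv β (fun x => ∑' i, a i * wilson ψ i x) =
      fun x => ∑' i, a i * multiDeriv β (wilson ψ i) x := by
  have hit : ∀ (j : Fin d) (r : ℕ) (γ : Fin d → ℕ),
      (partialDeriv j)^[r] (fun x => ∑' i, a i * multiDeriv γ (wilson ψ i) x) =
        fun x => ∑' i, a i * multiDeriv (γ + Pi.single j r) (wilson ψ i) x := by
    intro j r γ
    induction r with
    | zero => simp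
    | succ r ih =>
      rw [Function.iterate_succ_apply', ih, partialDeriv_tsum_wilson hψ hk hw ha, add_assoc,
        ← Pi.single_add]
  have hfold : ∀ L : List (Fin d), L.Nodup →
      L.foldr (fun i g => (partialDeriv i)^[β i] g) (fun x => ∑' i, a i * wilson ψ i x) =
        fun x => ∑' i, a i * multiDeriv (fun r => if r ∈ L then β r else 0) (wilson ψ i) x := by
    intro L hL
    induction L with
    | nil =>
      have h0 : (fun r : Fin d => if r ∈ ([] : List (Fin d)) then β r else 0) = 0 := by
        funext r; simp
      simp only [h0, multiDeriv_zero_index, List.foldr_nil]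
    | cons j L ih =>
      obtain ⟨hj, hL⟩ := List.nodup_cons.1 hL
      rw [List.foldr_cons, ih hL, hit]
      have h0 : ((fun r => if r ∈ L then β r else 0) + Pi.single j (β j) : Fin d → ℕ) =
          fun r => if r ∈ j :: L then β r else 0 := by
        funext r
        by_cases hr : r = j
        · subst hr; simp [hj]
        · simp [hr]
      rw [h0]
  have := hfold _ (List.nodup_finRange d)
  simpa [multiDeriv] using this

/-- A test function is the pointwise sum of its Wilson expansion. -/
theorem eq_tsum_wilson (hψ : ∀ k, IsWilsonGenerator (ψ k)) (hk : 0 < k)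
    (hw : ∀ i, GSFinite s k (wilson ψ i)) {φ : EuclideanSpace ℝ (Fin d) → ℂ}
    (hφ : GSFinite s k φ)
    (ha : Summable fun i => ‖∫ x, wilson ψ i x * φ x‖ * gsNorm s k (wilson ψ i)) :
    φ = fun x => ∑' i, (∫ y, wilson ψ i y * φ y) * wilson ψ i x := by
  set a := fun i => ∫ x, wilson ψ i x * φ x with hadef
  obtain ⟨K, hK, hKb⟩ := exists_norm_mul_prod_one_add_sq_le (d := d) (s := s) hk
  have hsum : ∀ x, Summable fun i => a i * wilson ψ i x := fun x => by
    simpa [multiDeriv_zero_index] using summable_mul_multiDeriv_wilson hk hw ha 0 x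
  have hterm : ∀ i x, ‖a i * wilson ψ i x‖ ≤ ‖a i‖ * gsNorm s k (wilson ψ i) := fun i x => by
    rw [norm_mul]; gcongr; exact (hw i).norm_le x
  have hcont : Continuous fun x => ∑' i, a i * wilson ψ i x :=
    continuous_tsum (fun i => continuous_const.mul (contDiff_wilson hψ i).continuous) ha hterm
  have hP : ∀ x : EuclideanSpace ℝ (Fin d), 0 ≤ ∏ r, (1 + x r ^ 2)⁻¹ := fun x =>
    Finset.prod_nonneg fun r _ => by positivity
  -- The difference of φ and its series is continuous, decays quadratically in every coordinate and
  -- is orthogonal to all Wilson functions, so completeness applies.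
  have hzero := eq_zero_of_integral_wilson_mul hψ
    (g := fun x => φ x - ∑' i, a i * wilson ψ i x) (hφ.1.continuous.sub hcont)
    (C := K * gsNorm s k φ + K * ∑' i, ‖a i‖ * gsNorm s k (wilson ψ i)) (fun x => ?_)
    (fun j => ?_)
  · funext x
    exact sub_eq_zero.1 (congrFun hzero x)
  · rw [add_mul]
    refine (norm_sub_le _ _).trans (add_le_add (hKb φ hφ x) ?_)
    refine tsum_of_norm_bounded
      (g := fun i => K * (‖a i‖ * gsNorm s k (wilson ψ i)) * ∏ r, (1 + x r ^ 2)⁻¹) ?_ fun i => ?_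
    · exact ((ha.hasSum.mul_left K).mul_right _)
    · rw [norm_mul]
      calc _ ≤ ‖a i‖ * (K * gsNorm s k (wilson ψ i) * ∏ r, (1 + x r ^ 2)⁻¹) := by
            gcongr; exact hKb _ (hw i) x
        _ = _ := by ring
  · have hF : ∀ i, Integrable fun x => wilson ψ j x * (a i * wilson ψ i x) := fun i => by
      have := ((hw j).integrable_mul hk (hw i)).const_mul (a i)
      exact this.congr (.of_forall fun x => by simp only; ring)
    have hs1 := hasSum_integral_of_summable_integral_norm hF (by
      refine (ha.mul_left (∫ x, ‖wilson ψ j x‖)).of_nonneg_of_le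
        (fun i => integral_nonneg fun x => norm_nonneg _) fun i => ?_
      rw [← integral_mul_const]
      refine integral_mono (hF i).norm (((hw j).integrable hk).norm.mul_const _) fun x => ?_
      simp only
      rw [norm_mul]
      gcongr
      exact hterm i x)
    have hs2 : (fun i => ∫ x, wilson ψ j x * (a i * wilson ψ i x)) =
        fun i => if i = j then a j else 0 := by
      funext i
      have : (fun x => wilson ψ j x * (a i * wilson ψ i x)) =
          fun x => a i * (wilson ψ j x * wilson ψ i x) := by funext x; ring
      rw [this, integral_const_mul, integral_wilson_mul_wilson hψ]
      by_cases hij : i = j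
      · subst hij; simp
      · simp [hij, Ne.symm hij]
    rw [hs2] at hs1
    have hs3 := hs1.unique (hasSum_ite_eq j (a j))
    simp_rw [mul_sub]
    have hint2 : Integrable fun x => wilson ψ j x * ∑' i, a i * wilson ψ i x := by
      refine ((hw j).integrable hk).mul_bdd (c := ∑' i, ‖a i‖ * gsNorm s k (wilson ψ i))
        hcont.aestronglyMeasurable (.of_forall fun x => ?_)
      exact tsum_of_norm_bounded ha.hasSum fun i => hterm i x
    rw [integral_sub ((hw j).integrable_mul hk hφ) hint2, sub_eq_zero]
    simp_rw [← tsum_mul_left]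
    rw [hs3]

theorem multiDeriv_finset_sum {ι : Type*} (β : Fin d → ℕ) (F : Finset ι)
    (f : ι → EuclideanSpace ℝ (Fin d) → ℂ) (c : ι → ℂ) (hf : ∀ i, ContDiff ℝ ∞ (f i)) :
    ContDiff ℝ ∞ (∑ i ∈ F, c i • f i) ∧
      multiDeriv β (∑ i ∈ F, c i • f i) = ∑ i ∈ F, c i • multiDeriv β (f i) := by
  classical
  induction F using Finset.induction_on with
  | empty =>
    refine ⟨by rw [Finset.sum_empty]; exact contDiff_const, ?_⟩
    have := multiDeriv_smul β 0 (f := (0 : EuclideanSpace ℝ (Fin d) → ℂ)) contDiff_const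
    simpa using this
  | insert i F hi ih =>
    rw [Finset.sum_insert hi, Finset.sum_insert hi]
    have hcf : ContDiff ℝ ∞ (c i • f i) := (hf i).const_smul (c i)
    refine ⟨hcf.add ih.1, ?_⟩
    rw [multiDeriv_add β hcf ih.1, multiDeriv_smul β _ (hf i), ih.2]

/-- The remainder of the Wilson expansion in the norm of a step. -/
theorem gsNorm_sub_sum_le (hψ : ∀ k, IsWilsonGenerator (ψ k)) (hk : 0 < k)
    (hw : ∀ i, GSFinite s k (wilson ψ i)) {φ : EuclideanSpace ℝ (Fin d) → ℂ}
    (hφ : GSFinite s k φ)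
    (ha : Summable fun i => ‖∫ x, wilson ψ i x * φ x‖ * gsNorm s k (wilson ψ i))
    (F : Finset ((Fin d → ℕ) × (Fin d → ℤ))) :
    gsNorm s k (φ - ∑ i ∈ F, (∫ x, wilson ψ i x * φ x) • wilson ψ i) ≤
      ∑' i : { i // i ∉ F }, ‖∫ x, wilson ψ i.1 x * φ x‖ * gsNorm s k (wilson ψ i.1) := by
  set a := fun i => ∫ x, wilson ψ i x * φ x with hadef
  have hsm := contDiff_wilson hψ
  refine ciSup_le fun p => ?_
  have hden := gsQuotient_denom_pos s hk p.1 p.2.1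
  obtain ⟨hS, hSd⟩ := multiDeriv_finset_sum p.2.1 F (wilson ψ) a hsm
  have hd : multiDeriv p.2.1 (φ - ∑ i ∈ F, a i • wilson ψ i) p.2.2 =
      ∑' i : { i // i ∉ F }, a i * multiDeriv p.2.1 (wilson ψ i) p.2.2 := by
    have e1 : φ - ∑ i ∈ F, a i • wilson ψ i = φ + (-1 : ℂ) • ∑ i ∈ F, a i • wilson ψ i := by
      rw [neg_one_smul, sub_eq_add_neg]
    have e2 : multiDeriv p.2.1 φ p.2.2 = ∑' i, a i * multiDeriv p.2.1 (wilson ψ i) p.2.2 := by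
      conv_lhs => rw [eq_tsum_wilson hψ hk hw hφ ha]
      exact congrFun (multiDeriv_tsum_wilson hψ hk hw ha p.2.1) p.2.2
    have e3 := (summable_mul_multiDeriv_wilson hk hw ha p.2.1 p.2.2).sum_add_tsum_subtype_compl F
    have e4 : ContDiff ℝ ∞ ((-1 : ℂ) • ∑ i ∈ F, a i • wilson ψ i) := hS.const_smul (-1 : ℂ)
    rw [e1, multiDeriv_add _ hφ.1 e4, multiDeriv_smul _ _ hS, hSd, Pi.add_apply,
      e2, ← e3]
    simp only [Pi.smul_apply, Finset.sum_apply, smul_eq_mul, a]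
    ring
  unfold gsQuotient
  -- The denominator is moved inside the tail, where each term becomes a quotient of a single Wilson
  -- function and is bounded by its norm.
  rw [hd, ← tsum_mul_left, div_eq_inv_mul, ← Real.norm_of_nonneg (inv_nonneg.2 hden.le),
    ← Complex.norm_real, ← norm_mul, ← tsum_mul_left]
  refine tsum_of_norm_bounded (ha.subtype _).hasSum fun i => ?_
  have h1 := gsQuotient_le_gsNorm (hw i.1) p
  unfold gsQuotient at h1
  rw [norm_mul, Complex.norm_real, Real.norm_of_nonneg (inv_nonneg.2 hden.le), mul_left_comm,
    norm_mul, mul_left_comm, ← div_eq_inv_mul]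
  exact mul_le_mul_of_nonneg_left h1 (norm_nonneg _)

/-- The Wilson expansion of a test function converges in the norm of a step. -/
theorem tendsto_gsNorm_sub_sum (hψ : ∀ k, IsWilsonGenerator (ψ k)) (hk : 0 < k)
    (hw : ∀ i, GSFinite s k (wilson ψ i)) {φ : EuclideanSpace ℝ (Fin d) → ℂ}
    (hφ : GSFinite s k φ)
    (ha : Summable fun i => ‖∫ x, wilson ψ i x * φ x‖ * gsNorm s k (wilson ψ i)) :
    Filter.Tendsto (fun F : Finset ((Fin d → ℕ) × (Fin d → ℤ)) =>
      gsNorm s k (φ - ∑ i ∈ F, (∫ x, wilson ψ i x * φ x) • wilson ψ i)) Filter.atTop (nhds 0) :=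
  squeeze_zero (fun _ => gsNorm_nonneg s hk _) (gsNorm_sub_sum_le hψ hk hw hφ ha)
    (tendsto_tsum_compl_atTop_zero
      fun i => ‖∫ x, wilson ψ i x * φ x‖ * gsNorm s k (wilson ψ i))

end Expansion

/-! ### Convergence in the strong dual -/

/-- A series of functionals converges in the strong dual if its terms, multiplied by weights tending
to infinity, are absolutely summable with sums bounded by a continuous seminorm. -/
theorem exists_hasSum_strongDual {E ι κ : Type*} [AddCommGroup E] [Module ℂ E]
    [TopologicalSpace E] [Nonempty κ] {p : SeminormFamily ℂ E κ} (hp : WithSeminorms p)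
    {u : ι → StrongDual ℂ E} {wt : ι → ℝ} (hwt : Filter.Tendsto wt Filter.cofinite Filter.atTop)
    (hwt_one : ∀ i, 1 ≤ wt i) (j : κ) {C : ℝ} (hC : 0 ≤ C)
    (hs : ∀ φ, Summable fun i => wt i * ‖u i φ‖)
    (hb : ∀ φ, ∑' i, wt i * ‖u i φ‖ ≤ C * p j φ) :
    ∃ f : StrongDual ℂ E, HasSum u f ∧ ∀ φ, HasSum (fun i => u i φ) (f φ) := by
  classical
  have hle : ∀ φ i, ‖u i φ‖ ≤ wt i * ‖u i φ‖ := fun φ i =>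
    le_mul_of_one_le_left (norm_nonneg _) (hwt_one i)
  have hn : ∀ φ, Summable fun i => ‖u i φ‖ := fun φ =>
    (hs φ).of_nonneg_of_le (fun i => norm_nonneg _) (hle φ)
  have hsum : ∀ φ, Summable fun i => u i φ := fun φ => (hn φ).of_norm
  let f₀ : E →ₗ[ℂ] ℂ :=
    { toFun := fun φ => ∑' i, u i φ
      map_add' := fun φ χ => by
        simp only [map_add]
        exact (hsum φ).tsum_add (hsum χ)
      map_smul' := fun c φ => by
        simp only [map_smul, smul_eq_mul, RingHom.id_apply]
        exact tsum_mul_left }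
  have hf₀ : ∀ φ, ‖f₀ φ‖ ≤ C * p j φ := fun φ =>
    ((norm_tsum_le_tsum_norm (hn φ)).trans ((hn φ).tsum_le_tsum (hle φ) (hs φ))).trans (hb φ)
  have hcont : Continuous f₀ := by
    refine hp.continuous_normedSpace_rng _ _ ⟨{j}, ⟨C, hC⟩, fun φ => ?_⟩
    rw [Finset.sup_singleton]
    exact hf₀ φ
  refine ⟨⟨f₀, hcont⟩, ?_, fun φ => (hsum φ).hasSum⟩
  -- Strong convergence is uniform convergence on von Neumann bounded sets, where the seminorm `p j`
  -- is bounded.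
  refine (UniformConvergenceCLM.tendsto_iff_tendstoUniformlyOn (RingHom.id ℂ) ℂ
    {S : Set E | Bornology.IsVonNBounded ℂ S}).2 fun B hB => ?_
  obtain ⟨M, hM⟩ := (hp.isVonNBounded_iff_seminorm_bddAbove).1 hB j
  have hM' : ∀ φ ∈ B, p j φ ≤ max M 0 := fun φ hφ =>
    (hM ⟨φ, hφ, rfl⟩).trans (le_max_left _ _)
  rw [Metric.tendstoUniformlyOn_iff]
  intro ε hε
  -- Outside a finite index set the weight is at least R, so a tail is at most `R⁻¹` times the
  -- weighted sum; the added 1 makes the final inequality strict.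
  set R := (C * max M 0 + 1) / ε with hR
  have hR0 : 0 < R := by positivity
  have hfin : {i | ¬ R ≤ wt i}.Finite := hwt.eventually_ge_atTop R
  filter_upwards [Filter.eventually_ge_atTop hfin.toFinset] with F hF φ hφ
  have h1 : (∑ i ∈ F, u i) φ = ∑ i ∈ F, u i φ := by simp
  have h2 : f₀ φ - ∑ i ∈ F, u i φ = ∑' i : {i // i ∉ F}, u i φ := by
    rw [show f₀ φ = ∑' i, u i φ from rfl, ← (hsum φ).sum_add_tsum_subtype_compl F]
    exact add_sub_cancel_left _ _
  have h3 : ‖∑' i : {i // i ∉ F}, u i φ‖ ≤ R⁻¹ * ∑' i : {i // i ∉ F}, wt i * ‖u i φ‖ := by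
    refine tsum_of_norm_bounded (((hs φ).subtype _).hasSum.mul_left R⁻¹) fun i => ?_
    have hi : R ≤ wt i.1 := by
      by_contra hcon
      exact i.2 (hF (hfin.mem_toFinset.2 hcon))
    rw [← div_eq_inv_mul, le_div_iff₀ hR0, mul_comm]
    exact mul_le_mul_of_nonneg_right hi (norm_nonneg _)
  have h4 : ∑' i : {i // i ∉ F}, wt i * ‖u i φ‖ ≤ ∑' i, wt i * ‖u i φ‖ :=
    Summable.tsum_subtype_le (fun i => wt i * ‖u i φ‖) {i | i ∉ F}
      (fun i => mul_nonneg (zero_le_one.trans (hwt_one i)) (norm_nonneg _)) (hs φ)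
  rw [dist_eq_norm]
  change ‖f₀ φ - (∑ i ∈ F, u i) φ‖ < ε
  rw [h1, h2]
  calc _ ≤ R⁻¹ * (C * max M 0) := by
        refine h3.trans ?_
        gcongr
        exact h4.trans ((hb φ).trans (by gcongr; exact hM' φ hφ))
    _ < ε := by
        rw [← div_eq_inv_mul, div_lt_iff₀ hR0, hR, mul_div_cancel₀ _ hε.ne']
        linarith

/-- A continuous functional is bounded by a finite sum of the defining seminorms. -/
theorem exists_norm_le_sum_seminorm {E κ : Type*} [AddCommGroup E] [Module ℂ E]
    [TopologicalSpace E] [Nonempty κ] {p : SeminormFamily ℂ E κ} (hp : WithSeminorms p)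
    (f : StrongDual ℂ E) :
    ∃ (S : Finset κ) (C : ℝ), 0 ≤ C ∧ ∀ φ, ‖f φ‖ ≤ C * ∑ j ∈ S, p j φ := by
  obtain ⟨S, C, -, h⟩ := Seminorm.bound_of_continuous hp
    ((normSeminorm ℂ ℂ).comp f.toLinearMap) (continuous_norm.comp f.continuous)
  refine ⟨S, C, C.2, fun φ => (h φ).trans ?_⟩
  exact mul_le_mul_of_nonneg_left (Seminorm.finset_sup_apply_le
    (Finset.sum_nonneg fun i _ => apply_nonneg _ _) fun i hi =>
      Finset.single_le_sum (f := fun i => p i φ) (fun j _ => apply_nonneg _ _) hi) C.2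

/-! ### Growth of coefficient sequences -/

theorem WilsonSummable.exists_norm_le {d : ℕ} {s h : ℝ} (hs : 1 < s) (hh : 0 ≤ h)
    {c : (Fin d → ℕ) × (Fin d → ℤ) → ℂ} (hc : WilsonSummable s h c) :
    ∃ C : ℝ, 0 < C ∧ ∀ i, ‖c i‖ ≤ C * Real.exp (h * wilsonWeight s i) := by
  set S := ∑' i, ‖c i‖ ^ 2 * Real.exp (-2 * h * wilsonSize i ^ (1 / s)) with hS
  have hS0 : 0 ≤ S := tsum_nonneg fun i => by positivity
  refine ⟨S + 1, by positivity, fun i => ?_⟩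
  have h1 : ‖c i‖ ^ 2 * Real.exp (-2 * h * wilsonSize i ^ (1 / s)) ≤ S :=
    hc.le_tsum i fun j _ => by positivity
  have h2 : ‖c i‖ ^ 2 * Real.exp (-2 * h * wilsonSize i ^ (1 / s)) =
      (‖c i‖ * Real.exp (-(h * wilsonSize i ^ (1 / s)))) ^ 2 := by
    rw [mul_pow, ← Real.exp_nat_mul]
    congr 2
    push_cast
    ring
  rw [h2] at h1
  have h3 : ‖c i‖ * Real.exp (-(h * wilsonSize i ^ (1 / s))) ≤ S + 1 :=
    le_of_sq_le_sq (h1.trans (by nlinarith)) (by positivity)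
  rw [Real.exp_neg, ← div_eq_mul_inv, div_le_iff₀ (Real.exp_pos _)] at h3
  refine h3.trans ?_
  gcongr
  exact wilsonSize_rpow_le hs i

/-- The factor 3d + 1 compares the coordinatewise weight with the Euclidean size. The further 2
makes the squared coefficients use only half of the available decay; the rest gives summability. -/
theorem wilsonSummable_of_norm_le {d : ℕ} {s h C : ℝ} (hs : 1 < s) (hh : 0 < h)
    {c : (Fin d → ℕ) × (Fin d → ℤ) → ℂ}
    (hc : ∀ i, ‖c i‖ ≤ C * Real.exp (h / (2 * (3 * d + 1)) * wilsonWeight s i)) :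
    WilsonSummable s h c := by
  have hd : (0 : ℝ) < 3 * d + 1 := by positivity
  refine ((summable_exp_neg_wilsonWeight d hs (div_pos hh hd)).mul_left (C ^ 2)).of_nonneg_of_le
    (fun i => by positivity) fun i => ?_
  have h1 : wilsonWeight s i / (3 * d + 1) ≤ wilsonSize i ^ (1 / s) := by
    have h0 : 0 ≤ wilsonSize i ^ (1 / s) := Real.rpow_nonneg (wilsonSize_nonneg i) _
    rw [div_le_iff₀ hd]
    linarith [wilsonWeight_le hs i]
  calc ‖c i‖ ^ 2 * Real.exp (-2 * h * wilsonSize i ^ (1 / s))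
      ≤ (C * Real.exp (h / (2 * (3 * d + 1)) * wilsonWeight s i)) ^ 2 *
          Real.exp (-2 * h * (wilsonWeight s i / (3 * d + 1))) := by
        refine mul_le_mul (pow_le_pow_left₀ (norm_nonneg _) (hc i) 2) (Real.exp_le_exp.2 ?_)
          (Real.exp_pos _).le (by positivity)
        nlinarith
    _ = C ^ 2 * (Real.exp (2 * (h / (2 * (3 * d + 1)) * wilsonWeight s i)) *
          Real.exp (-2 * h * (wilsonWeight s i / (3 * d + 1)))) := by
        rw [mul_pow, ← Real.exp_nat_mul]
        push_cast
        ring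
    _ = _ := by
        rw [← Real.exp_add]
        congr 2
        field_simp
        ring

/-- The decay rate δ of the pairings is spent in three parts: δ/4 on the growth of c, δ/4 on the
factor 1 + weight, and δ/2 on summability. -/
theorem exists_tsum_weight_mul_coeff_le {d : ℕ} {s k C₀ : ℝ} (hs : 1 < s) (hk : 0 < k)
    {ψ : Fin d → ℝ → ℝ} (hψ : ∀ j, IsWilsonGenerator (ψ j))
    {c : (Fin d → ℕ) × (Fin d → ℤ) → ℂ} (hC₀ : 0 < C₀)
    (hc : ∀ i, ‖c i‖ ≤
      C₀ * Real.exp (s / (8 * k ^ (1 / s) * (d + 1)) / 4 * wilsonWeight s i)) :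
    ∃ M : ℝ, 0 ≤ M ∧ ∀ φ, GSFinite s k φ →
      (Summable fun i => (1 + wilsonWeight s i) * ‖c i * ∫ x, wilson ψ i x * φ x‖) ∧
      ∑' i, (1 + wilsonWeight s i) * ‖c i * ∫ x, wilson ψ i x * φ x‖ ≤ M * gsNorm s k φ := by
  have hs0 : 0 < s := by linarith
  obtain ⟨C, hC, hcoeff⟩ := exists_wilson_coeff_le hs hk hψ
  set δ := s / (8 * k ^ (1 / s) * ((d : ℝ) + 1)) with hδ
  have hδ0 : 0 < δ := by positivity
  have hδ4 : 0 < δ / 4 := by positivity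
  have hδ2 : 0 < δ / 2 := by positivity
  have hsum := summable_exp_neg_wilsonWeight d hs hδ2
  set K := (1 + (δ / 4)⁻¹) * (C₀ * C) with hK
  have hK0 : 0 < K := by positivity
  have hterm : ∀ φ, GSFinite s k φ → ∀ i,
      (1 + wilsonWeight s i) * ‖c i * ∫ x, wilson ψ i x * φ x‖ ≤
        K * gsNorm s k φ * Real.exp (-(δ / 2) * wilsonWeight s i) := by
    intro φ hφ i
    have hN : 0 ≤ gsNorm s k φ := gsNorm_nonneg s hk φ
    have hT := wilsonWeight_nonneg s i
    set T := wilsonWeight s i with hTdef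
    have h1 : 1 + T ≤ (1 + (δ / 4)⁻¹) * Real.exp (δ / 4 * T) := by
      have e1 := Real.le_inv_mul_exp T hδ4
      have e2 : 1 ≤ Real.exp (δ / 4 * T) := Real.one_le_exp (by positivity)
      linarith
    rw [norm_mul]
    calc _ ≤ (1 + (δ / 4)⁻¹) * Real.exp (δ / 4 * T) *
          ((C₀ * Real.exp (δ / 4 * T)) * (C * gsNorm s k φ * Real.exp (-δ * T))) := by
          gcongr
          · exact hc i
          · exact hcoeff φ hφ i
      _ = K * gsNorm s k φ * (Real.exp (δ / 4 * T) * Real.exp (δ / 4 * T) *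
          Real.exp (-δ * T)) := by rw [hK]; ring
      _ = _ := by
          rw [← Real.exp_add, ← Real.exp_add]
          congr 2
          ring
  refine ⟨K * ∑' i : (Fin d → ℕ) × (Fin d → ℤ), Real.exp (-(δ / 2) * wilsonWeight s i),
    mul_nonneg hK0.le (tsum_nonneg fun i => (Real.exp_pos _).le), fun φ hφ => ?_⟩
  have hS : Summable fun i => (1 + wilsonWeight s i) * ‖c i * ∫ x, wilson ψ i x * φ x‖ :=
    (hsum.mul_left (K * gsNorm s k φ)).of_nonneg_of_le (fun i => mul_nonneg
      (by linarith [wilsonWeight_nonneg s i]) (norm_nonneg _)) (hterm φ hφ)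
  refine ⟨hS, (hS.tsum_le_tsum (hterm φ hφ) (hsum.mul_left _)).trans (le_of_eq ?_)⟩
  rw [tsum_mul_left]
  ring

theorem summable_coeff_mul_gsNorm {d : ℕ} {s k k' C' : ℝ} (hs : 1 < s) (hk : 0 < k)
    (hk' : 0 < k') {ψ : Fin d → ℝ → ℝ} (hψ : ∀ j, IsWilsonGenerator (ψ j)) {ε : ℝ}
    (hε : ε < s / (8 * k ^ (1 / s) * (d + 1))) (hstep : WilsonStepBound ψ s k' ε C')
    {φ : EuclideanSpace ℝ (Fin d) → ℂ} (hφ : GSFinite s k φ) :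
    Summable fun i => ‖∫ x, wilson ψ i x * φ x‖ * gsNorm s k' (wilson ψ i) := by
  obtain ⟨C, hC, hcoeff⟩ := exists_wilson_coeff_le hs hk hψ
  set δ := s / (8 * k ^ (1 / s) * ((d : ℝ) + 1)) with hδ
  have hN : 0 ≤ gsNorm s k φ := gsNorm_nonneg s hk φ
  refine ((summable_exp_neg_wilsonWeight d hs (sub_pos.2 hε)).mul_left
    (C * gsNorm s k φ * C')).of_nonneg_of_le
    (fun i => mul_nonneg (norm_nonneg _) (gsNorm_nonneg s hk' _)) fun i => ?_
  calc _ ≤ (C * gsNorm s k φ * Real.exp (-δ * wilsonWeight s i)) *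
        (C' * Real.exp (ε * wilsonWeight s i)) :=
        mul_le_mul (hcoeff φ hφ i) (hstep i).2 (gsNorm_nonneg s hk' _) (by positivity)
    _ = C * gsNorm s k φ * C' * (Real.exp (-δ * wilsonWeight s i) *
        Real.exp (ε * wilsonWeight s i)) := by ring
    _ = _ := by
        rw [← Real.exp_add]
        congr 2
        ring

/-- The step with a prescribed decay rate of the Wilson coefficients. -/
theorem exists_step_of_rate (d : ℕ) {s δ : ℝ} (hs : 1 < s) (hδ : 0 < δ) :
    ∃ k : ℝ, 0 < k ∧ s / (8 * k ^ (1 / s) * (d + 1)) = δ := by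
  have hs0 : 0 < s := by linarith
  refine ⟨(s / (8 * δ * (d + 1))) ^ s, by positivity, ?_⟩
  rw [← Real.rpow_mul (by positivity), mul_one_div_cancel hs0.ne', Real.rpow_one]
  field_simp

/-! ### The Wilson expansion of a functional -/

section Functional

variable {d : ℕ} {s : ℝ} {ψ : Fin d → ℝ → ℝ} {E : Type*} [AddCommGroup E] [Module ℂ E]
  [TopologicalSpace E] {val : E →ₗ[ℂ] (EuclideanSpace ℝ (Fin d) → ℂ)}
  {w : (Fin d → ℕ) × (Fin d → ℤ) → E} {D : (Fin d → ℕ) × (Fin d → ℤ) → StrongDual ℂ E}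

/-- The partial sums of the expansion of φ converge in a step norm that bounds f, so f passes to the
limit. The map `val` serves both kinds of test space. -/
theorem hasSum_wilson_functional (hψ : ∀ j, IsWilsonGenerator (ψ j))
    (hw : ∀ i, val (w i) = wilson ψ i) (hD : ∀ i φ, D i φ = ∫ x, wilson ψ i x * val φ x)
    {f : StrongDual ℂ E} {k M : ℝ} (hk : 0 < k)
    (hf : ∀ g : E, GSFinite s k (val g) → ‖f g‖ ≤ M * gsNorm s k (val g))
    (hws : ∀ i, GSFinite s k (wilson ψ i)) {φ : E} (hφ : GSFinite s k (val φ))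
    (ha : Summable fun i => ‖∫ x, wilson ψ i x * val φ x‖ * gsNorm s k (wilson ψ i)) :
    HasSum (fun i => f (w i) * D i φ) (f φ) := by
  have hval : ∀ F : Finset _, val (φ - ∑ i ∈ F, D i φ • w i) =
      val φ - ∑ i ∈ F, (∫ x, wilson ψ i x * val φ x) • wilson ψ i := fun F => by
    rw [map_sub, map_sum]
    congr 1
    refine Finset.sum_congr rfl fun i _ => ?_
    rw [map_smul, hw, hD]
  have hfin : ∀ F : Finset _, GSFinite s k (val (φ - ∑ i ∈ F, D i φ • w i)) := fun F => by
    classical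
    have h1 : GSFinite s k (∑ i ∈ F, (-(∫ x, wilson ψ i x * val φ x)) • wilson ψ i) := by
      induction F using Finset.induction_on with
      | empty => simpa using GSFinite.zero s k
      | insert i F hi ih =>
        rw [Finset.sum_insert hi]
        exact ((hws i).smul _).add hk ih
    rw [hval, sub_eq_add_neg, ← Finset.sum_neg_distrib]
    simp_rw [← neg_smul]
    exact hφ.add hk h1
  have h2 := (tendsto_gsNorm_sub_sum hψ hk hws hφ ha).const_mul M
  rw [mul_zero] at h2
  have h3 : Filter.Tendsto (fun F : Finset ((Fin d → ℕ) × (Fin d → ℤ)) =>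
      f φ - ∑ i ∈ F, f (w i) * D i φ) Filter.atTop (nhds 0) := by
    refine squeeze_zero_norm (fun F => ?_) h2
    have h4 : f φ - ∑ i ∈ F, f (w i) * D i φ = f (φ - ∑ i ∈ F, D i φ • w i) := by
      rw [map_sub, map_sum]
      congr 1
      refine Finset.sum_congr rfl fun i _ => ?_
      rw [map_smul, smul_eq_mul, mul_comm]
    rw [h4]
    refine (hf _ (hfin F)).trans (le_of_eq ?_)
    rw [hval]
  have h5 := h3.const_sub (f φ)
  simp only [sub_sub_cancel, sub_zero] at h5
  exact h5

/-- Evaluating the weak-* expansion at `w j` leaves only the term with index j, by orthonormality.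
-/
theorem wilson_coeff_unique (hψ : ∀ j, IsWilsonGenerator (ψ j))
    (hw : ∀ i, val (w i) = wilson ψ i) (hD : ∀ i φ, D i φ = ∫ x, wilson ψ i x * val φ x)
    {f : StrongDual ℂ E} {c : (Fin d → ℕ) × (Fin d → ℤ) → ℂ}
    (hc : ∀ φ, HasSum (fun i => c i * D i φ) (f φ)) (j : (Fin d → ℕ) × (Fin d → ℤ)) :
    c j = f (w j) := by
  have h1 := hc (w j)
  have h2 : (fun i => c i * D i (w j)) = fun i => if i = j then c j else 0 := by
    funext i
    rw [hD, hw, integral_wilson_mul_wilson hψ]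
    by_cases hij : i = j
    · subst hij; simp
    · simp [hij]
  rw [h2] at h1
  exact (hasSum_ite_eq j (c j)).unique h1

end Functional

theorem tendsto_one_add_wilsonWeight_cofinite (d : ℕ) {s : ℝ} (hs : 1 < s) :
    Filter.Tendsto (fun i : (Fin d → ℕ) × (Fin d → ℤ) => 1 + wilsonWeight s i) Filter.cofinite
      Filter.atTop :=
  Filter.tendsto_atTop_add_const_left _ _ (tendsto_wilsonWeight_cofinite d hs)

/-! ### Ultradistributions of Roumieu type -/

section Roumieu

variable {d : ℕ} {s : ℝ} {ψ : Fin d → ℝ → ℝ} {w : (Fin d → ℕ) × (Fin d → ℤ) → GSRoumieu d s}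

/-- The underlying function of an element of `𝒮_s`. -/
def roumieuVal (d : ℕ) (s : ℝ) : GSRoumieu d s →ₗ[ℂ] (EuclideanSpace ℝ (Fin d) → ℂ) :=
  (gsRoumieu d s).subtype

theorem exists_norm_le_gsNorm_of_roumieu (f : StrongDual ℂ (GSRoumieu d s)) {k : ℝ} (hk : 0 < k) :
    ∃ M : ℝ, 0 ≤ M ∧ ∀ g : GSRoumieu d s, GSFinite s k g.1 → ‖f g‖ ≤ M * gsNorm s k g.1 := by
  obtain ⟨S, C, hC, h⟩ := exists_norm_le_sum_seminorm (roumieu_withSeminorms d s) f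
  choose N hN using fun q : RoumieuSeminorm d s => q.2 k hk
  refine ⟨C * ∑ q ∈ S, max (N q) 0,
    mul_nonneg hC (Finset.sum_nonneg fun q _ => le_max_right _ _), fun g hg => (h g).trans ?_⟩
  rw [mul_assoc, Finset.sum_mul]
  refine mul_le_mul_of_nonneg_left (Finset.sum_le_sum fun q _ => (hN q g hg).trans ?_) hC
  exact mul_le_mul_of_nonneg_right (le_max_left _ _) (gsNorm_nonneg s hk _)

/-- The weighted sum of pairings is itself a seminorm bounded on every step, hence one of those
defining the inductive limit topology; the general criterion applies with that seminorm and constant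
1. -/
theorem exists_hasSum_roumieu (hs : 1 < s) (hψ : ∀ k, IsWilsonGenerator (ψ k))
    (hw : ∀ i, (w i).1 = wilson ψ i) {c : (Fin d → ℕ) × (Fin d → ℤ) → ℂ}
    (hc : ∀ h : ℝ, 0 < h → WilsonSummable s h c) :
    ∃ f : StrongDual ℂ (GSRoumieu d s), HasSum (fun i => c i • roumieuToDual (w i)) f ∧
      ∀ φ, HasSum (fun i => c i * roumieuToDual (w i) φ) (f φ) := by
  have hs0 : 0 < s := by linarith
  have hpair : ∀ i (φ : GSRoumieu d s), roumieuToDual (w i) φ = ∫ x, wilson ψ i x * φ.1 x :=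
    fun i φ => by rw [← hw]; rfl
  have hstep : ∀ k : ℝ, 0 < k → ∃ M : ℝ, 0 ≤ M ∧ ∀ φ : GSRoumieu d s, GSFinite s k φ.1 →
      (Summable fun i => (1 + wilsonWeight s i) * ‖c i * roumieuToDual (w i) φ‖) ∧
      ∑' i, (1 + wilsonWeight s i) * ‖c i * roumieuToDual (w i) φ‖ ≤ M * gsNorm s k φ.1 := by
    intro k hk
    have hε : 0 < s / (8 * k ^ (1 / s) * ((d : ℝ) + 1)) / 4 := by positivity
    obtain ⟨C, hC, hcC⟩ := (hc _ hε).exists_norm_le hs hε.le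
    obtain ⟨M, hM, h⟩ := exists_tsum_weight_mul_coeff_le hs hk hψ hC hcC
    refine ⟨M, hM, fun φ hφ => ?_⟩
    simp_rw [hpair]
    exact h φ.1 hφ
  have hsum : ∀ φ : GSRoumieu d s,
      Summable fun i => (1 + wilsonWeight s i) * ‖c i * roumieuToDual (w i) φ‖ := fun φ => by
    obtain ⟨k, hk, hφ⟩ := φ.2
    obtain ⟨M, -, h⟩ := hstep k hk
    exact (h φ hφ).1
  let q : Seminorm ℂ (GSRoumieu d s) := Seminorm.of
    (fun φ => ∑' i, (1 + wilsonWeight s i) * ‖c i * roumieuToDual (w i) φ‖)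
    (fun φ χ => by
      rw [← (hsum φ).tsum_add (hsum χ)]
      refine (hsum _).tsum_le_tsum (fun i => ?_) ((hsum φ).add (hsum χ))
      have hT := wilsonWeight_nonneg s i
      rw [map_add, ← mul_add (1 + wilsonWeight s i), mul_add (c i)]
      gcongr
      exact norm_add_le _ _)
    (fun a φ => by
      rw [← tsum_mul_left]
      refine tsum_congr fun i => ?_
      rw [map_smul, smul_eq_mul, mul_left_comm, norm_mul a, mul_left_comm])
  have hq : ∀ h, 0 < h → ∃ M : ℝ, ∀ f : GSRoumieu d s, GSFinite s h f.1 →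
      q f ≤ M * gsNorm s h f.1 := fun k hk => by
    obtain ⟨M, -, h⟩ := hstep k hk
    exact ⟨M, fun φ hφ => (h φ hφ).2⟩
  exact exists_hasSum_strongDual (roumieu_withSeminorms d s)
    (u := fun i => c i • roumieuToDual (w i)) (tendsto_one_add_wilsonWeight_cofinite d hs)
    (fun i => by linarith [wilsonWeight_nonneg s i]) ⟨q, hq⟩ zero_le_one hsum
    fun φ => (one_mul (q φ)).ge

theorem wilsonSummable_roumieu (hs : 1 < s) (hψ : ∀ k, IsWilsonGenerator (ψ k))
    (hw : ∀ i, (w i).1 = wilson ψ i) (f : StrongDual ℂ (GSRoumieu d s)) {h : ℝ} (hh : 0 < h) :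
    WilsonSummable s h fun i => f (w i) := by
  have hε : 0 < h / (2 * (3 * (d : ℝ) + 1)) := by positivity
  obtain ⟨k, C, hk, hC, hstep⟩ := exists_wilsonStepBound_of_weight hs hε hψ
  obtain ⟨M, hM, hf⟩ := exists_norm_le_gsNorm_of_roumieu f hk
  refine wilsonSummable_of_norm_le hs hh (C := M * C) fun i => ?_
  have hi := hstep k le_rfl i
  rw [← hw] at hi
  rw [mul_assoc]
  exact (hf _ hi.1).trans (mul_le_mul_of_nonneg_left hi.2 hM)

theorem hasSum_roumieu_apply (hs : 1 < s) (hψ : ∀ k, IsWilsonGenerator (ψ k))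
    (hw : ∀ i, (w i).1 = wilson ψ i) (f : StrongDual ℂ (GSRoumieu d s)) (φ : GSRoumieu d s) :
    HasSum (fun i => f (w i) * roumieuToDual (w i) φ) (f φ) := by
  have hs0 : 0 < s := by linarith
  obtain ⟨k, hk, hφ⟩ := φ.2
  have hrate : 0 < s / (8 * k ^ (1 / s) * ((d : ℝ) + 1)) := by positivity
  -- The Wilson functions are made to grow at half the decay rate of the coefficients of φ. The step
  -- is then raised so that it contains φ as well.
  obtain ⟨k', C, hk', hC, hstep⟩ := exists_wilsonStepBound_of_weight hs (half_pos hrate) hψ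
  have hm : 0 < max k k' := lt_max_of_lt_left hk
  have hstep' := hstep (max k k') (le_max_right _ _)
  obtain ⟨M, -, hf⟩ := exists_norm_le_gsNorm_of_roumieu f hm
  exact hasSum_wilson_functional (val := roumieuVal d s) hψ hw
    (fun i χ => by rw [← hw]; rfl) hm hf (fun i => (hstep' i).1) (hφ.mono hk (le_max_left _ _))
    (summable_coeff_mul_gsNorm hs hk hm hψ (half_lt_self hrate) hstep' hφ)

end Roumieu

/-! ### Ultradistributions of Beurling type -/

theorem gsNorm_antitone {d : ℕ} {s h k : ℝ} (hh : 0 < h) (hhk : h ≤ k)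
    {f : EuclideanSpace ℝ (Fin d) → ℂ} (hf : GSFinite s h f) : gsNorm s k f ≤ gsNorm s h f := by
  refine ciSup_le fun p => le_trans ?_ (gsQuotient_le_gsNorm hf p)
  refine div_le_div_of_nonneg_left (norm_nonneg _) (gsQuotient_denom_pos s hh _ _) ?_
  gcongr

section Beurling

variable {d : ℕ} {s : ℝ} {ψ : Fin d → ℝ → ℝ} {w : (Fin d → ℕ) × (Fin d → ℤ) → GSBeurling d s}

/-- The underlying function of an element of `Σ_s`. -/
def beurlingVal (d : ℕ) (s : ℝ) : GSBeurling d s →ₗ[ℂ] (EuclideanSpace ℝ (Fin d) → ℂ) :=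
  (gsBeurling d s).subtype

/-- The norms increase as the step shrinks, so among finitely many steps a lower bound (found in the
order dual) dominates. -/
theorem exists_norm_le_gsNorm_of_beurling (f : StrongDual ℂ (GSBeurling d s)) :
    ∃ k M : ℝ, 0 < k ∧ 0 ≤ M ∧ ∀ g : GSBeurling d s, ‖f g‖ ≤ M * gsNorm s k g.1 := by
  obtain ⟨S, C, hC, h⟩ := exists_norm_le_sum_seminorm (beurling_withSeminorms d s) f
  obtain ⟨k, hk⟩ : ∃ k : {h : ℝ // 0 < h}, ∀ j ∈ S, k ≤ j :=
    Finset.exists_le (α := {h : ℝ // 0 < h}ᵒᵈ) S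
  refine ⟨k, C * S.card, k.2, by positivity, fun g => (h g).trans ?_⟩
  rw [mul_assoc, ← nsmul_eq_mul]
  refine mul_le_mul_of_nonneg_left (Finset.sum_le_card_nsmul _ _ _ fun j hj => ?_) hC
  exact gsNorm_antitone k.2 (hk j hj) (g.2 k k.2)

theorem exists_hasSum_beurling (hs : 1 < s) (hψ : ∀ k, IsWilsonGenerator (ψ k))
    (hw : ∀ i, (w i).1 = wilson ψ i) {c : (Fin d → ℕ) × (Fin d → ℤ) → ℂ} {h : ℝ} (hh : 0 ≤ h)
    (hc : WilsonSummable s h c) :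
    ∃ f : StrongDual ℂ (GSBeurling d s), HasSum (fun i => c i • beurlingToDual (w i)) f ∧
      ∀ φ, HasSum (fun i => c i * beurlingToDual (w i) φ) (f φ) := by
  have hpair : ∀ i (φ : GSBeurling d s), beurlingToDual (w i) φ = ∫ x, wilson ψ i x * φ.1 x :=
    fun i φ => by rw [← hw]; rfl
  -- A quarter of the decay rate is reserved for the coefficients; with rate 4(h + 1) that quarter
  -- exceeds h.
  obtain ⟨k, hk, hrate⟩ := exists_step_of_rate d (δ := 4 * (h + 1)) hs (by positivity)
  obtain ⟨C, hC, hcC⟩ := hc.exists_norm_le hs hh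
  obtain ⟨M, hM, hsum⟩ := exists_tsum_weight_mul_coeff_le hs hk hψ (c := c) hC fun i => by
    refine (hcC i).trans ?_
    have hT := wilsonWeight_nonneg s i
    rw [hrate]
    gcongr
    linarith
  refine exists_hasSum_strongDual (beurling_withSeminorms d s)
    (u := fun i => c i • beurlingToDual (w i)) (tendsto_one_add_wilsonWeight_cofinite d hs)
    (fun i => by linarith [wilsonWeight_nonneg s i]) ⟨k, hk⟩ hM (fun φ => ?_) fun φ => ?_
  · refine (hsum φ.1 (φ.2 k hk)).1.congr fun i => ?_
    rw [← hpair]; rfl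
  · refine le_trans (le_of_eq (tsum_congr fun i => ?_)) (hsum φ.1 (φ.2 k hk)).2
    rw [← hpair]; rfl

theorem exists_wilsonSummable_beurling (hs : 1 < s) (hψ : ∀ k, IsWilsonGenerator (ψ k))
    (hw : ∀ i, (w i).1 = wilson ψ i) (f : StrongDual ℂ (GSBeurling d s)) :
    ∃ h : ℝ, 0 ≤ h ∧ WilsonSummable s h fun i => f (w i) := by
  obtain ⟨k, M, hk, hM, hf⟩ := exists_norm_le_gsNorm_of_beurling f
  obtain ⟨ε, C, hε, hC, hstep⟩ := exists_wilsonStepBound_of_step hs hk hψ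
  have hd : (0 : ℝ) < 2 * (3 * d + 1) := by positivity
  refine ⟨ε * (2 * (3 * d + 1)), by positivity,
    wilsonSummable_of_norm_le hs (by positivity) (C := M * C) fun i => ?_⟩
  rw [mul_div_cancel_right₀ _ hd.ne', mul_assoc]
  refine (hf _).trans (mul_le_mul_of_nonneg_left ?_ hM)
  rw [hw]
  exact (hstep i).2

theorem hasSum_beurling_apply (hs : 1 < s) (hψ : ∀ k, IsWilsonGenerator (ψ k))
    (hw : ∀ i, (w i).1 = wilson ψ i) (f : StrongDual ℂ (GSBeurling d s)) (φ : GSBeurling d s) :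
    HasSum (fun i => f (w i) * beurlingToDual (w i) φ) (f φ) := by
  obtain ⟨k, M, hk, -, hf⟩ := exists_norm_le_gsNorm_of_beurling f
  obtain ⟨ε, C, hε, hC, hstep⟩ := exists_wilsonStepBound_of_step hs hk hψ
  -- The functional fixes the step k, hence the growth rate ε. Since φ lies in every step, a second
  -- step can be chosen where its coefficients decay faster than ε.
  obtain ⟨k₀, hk₀, hrate⟩ := exists_step_of_rate d (δ := ε + 1) hs (by positivity)
  exact hasSum_wilson_functional (val := beurlingVal d s) hψ hw
    (fun i χ => by rw [← hw]; rfl) hk (fun g _ => hf g) (fun i => (hstep i).1) (φ.2 k hk)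
    (summable_coeff_mul_gsNorm hs hk₀ hk hψ (by linarith) hstep (φ.2 k₀ hk₀))

end Beurling

end

/-! ### The expansion theorem -/

theorem theorem3p3 (d : ℕ) (s : ℝ) (hs : 1 < s) (ψ : Fin d → ℝ → ℝ)
    (hψ : ∀ k, IsWilsonGenerator (ψ k)) :
    -- Roumieu case: the Wilson functions are test functions `w i`
    (∃ w : (Fin d → ℕ) × (Fin d → ℤ) → GSRoumieu d s, (∀ i, (w i).1 = wilson ψ i) ∧
      -- expansion in the strong dual, uniqueness already for weak* convergence, coefficient bound
      (∀ f : StrongDual ℂ (GSRoumieu d s),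
        HasSum (fun i => f (w i) • roumieuToDual (w i)) f ∧
        (∀ c : (Fin d → ℕ) × (Fin d → ℤ) → ℂ,
          (∀ φ : GSRoumieu d s, HasSum (fun i => c i * roumieuToDual (w i) φ) (f φ)) →
          ∀ i, c i = f (w i)) ∧
        ∀ h : ℝ, 0 < h → WilsonSummable s h (fun i => f (w i))) ∧
      -- converse
      (∀ c : (Fin d → ℕ) × (Fin d → ℤ) → ℂ, (∀ h : ℝ, 0 < h → WilsonSummable s h c) →
        ∃ f : StrongDual ℂ (GSRoumieu d s), HasSum (fun i => c i • roumieuToDual (w i)) f)) ∧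
    -- Beurling case
    (∃ w : (Fin d → ℕ) × (Fin d → ℤ) → GSBeurling d s, (∀ i, (w i).1 = wilson ψ i) ∧
      (∀ f : StrongDual ℂ (GSBeurling d s),
        HasSum (fun i => f (w i) • beurlingToDual (w i)) f ∧
        (∀ c : (Fin d → ℕ) × (Fin d → ℤ) → ℂ,
          (∀ φ : GSBeurling d s, HasSum (fun i => c i * beurlingToDual (w i) φ) (f φ)) →
          ∀ i, c i = f (w i)) ∧
        ∃ h : ℝ, 0 ≤ h ∧ WilsonSummable s h (fun i => f (w i))) ∧
      (∀ c : (Fin d → ℕ) × (Fin d → ℤ) → ℂ, (∃ h : ℝ, 0 ≤ h ∧ WilsonSummable s h c) →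
        ∃ f : StrongDual ℂ (GSBeurling d s), HasSum (fun i => c i • beurlingToDual (w i)) f)) := by

  constructor
  · obtain ⟨ε, C, -, -, hstep⟩ := exists_wilsonStepBound_of_step hs one_pos hψ
    let w : (Fin d → ℕ) × (Fin d → ℤ) → GSRoumieu d s :=
      fun i => ⟨wilson ψ i, 1, one_pos, (hstep i).1⟩
    have hw : ∀ i, (w i).1 = wilson ψ i := fun i => rfl
    refine ⟨w, hw, fun f => ⟨?_, fun c hc => ?_, fun h hh => wilsonSummable_roumieu hs hψ hw f hh⟩,
      fun c hc => (exists_hasSum_roumieu hs hψ hw hc).imp fun f hf => hf.1⟩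
    -- The converse, applied to the coefficients of f, supplies a strong limit g; the pointwise
    -- expansion of f shows that g = f.
    · obtain ⟨g, hg, hg'⟩ := exists_hasSum_roumieu hs hψ hw
        (c := fun i => f (w i)) fun h hh => wilsonSummable_roumieu hs hψ hw f hh
      have hgf : g = f := ContinuousLinearMap.ext fun φ =>
        (hg' φ).unique (hasSum_roumieu_apply hs hψ hw f φ)
      rwa [hgf] at hg
    · exact wilson_coeff_unique (val := roumieuVal d s) hψ hw (fun i φ => rfl) hc
  · have hfin : ∀ i, wilson ψ i ∈ gsBeurling d s := fun i k hk => by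
      obtain ⟨ε, C, -, -, hstep⟩ := exists_wilsonStepBound_of_step hs hk hψ
      exact (hstep i).1
    let w : (Fin d → ℕ) × (Fin d → ℤ) → GSBeurling d s := fun i => ⟨wilson ψ i, hfin i⟩
    have hw : ∀ i, (w i).1 = wilson ψ i := fun i => rfl
    refine ⟨w, hw, fun f => ⟨?_, fun c hc => ?_, exists_wilsonSummable_beurling hs hψ hw f⟩,
      fun c ⟨h, hh, hc⟩ => (exists_hasSum_beurling hs hψ hw hh hc).imp fun f hf => hf.1⟩
    · obtain ⟨h, hh, hc⟩ := exists_wilsonSummable_beurling hs hψ hw f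
      obtain ⟨g, hg, hg'⟩ := exists_hasSum_beurling hs hψ hw hh hc
      have hgf : g = f := ContinuousLinearMap.ext fun φ =>
        (hg' φ).unique (hasSum_beurling_apply hs hψ hw f φ)
      rwa [hgf] at hg
    · exact wilson_coeff_unique (val := beurlingVal d s) hψ hw (fun i φ => rfl) hc
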